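/- Conventions. Let $H$ be a cocommutative Hopf algebra over $\mathbb C$ with bijective antipode $S$; all categories are small and $\mathbb C$-linear. A left $H$-category $\mathcal D$ is a category whose morphism spaces are left $H$-modules with $h\cdot \mathrm{id}_X=\varepsilon(h)\,\mathrm{id}_X$ and $h(gf)=(h_1g)(h_2f)$. For left $H$-categories $\mathcal D,\mathcal D'$ the category $\mathcal D\otimes\mathcal D'$ (objects are pairs, $\mathrm{Hom}((X,X'),(Y,Y'))=\mathrm{Hom}(X,Y)\otimes\mathrm{Hom}(X',Y')$) is a left $H$-category under the diagonal action. A right-left SAYD module $M$ is a right $H$-module and left $H$-comodule with $\rho(mh)=S(h_3)m_{(-1)}h_1\otimes m_{(0)}h_2$ and $m_{(0)}m_{(-1)}=m$. For SAYD modules $M,M'$ let $$M\,\square_H\,M'=\Big\{\textstyle\sum m\otimes m'\in M\otimes M' : \sum m_{(0)}\otimes m_{(-1)}\otimes m'=\sum m\otimes m'_{(-1)}\otimes m'_{(0)}\Big\};$$ if this is an $H$-submodule of $M\otimes M'$ for the diagonal right action, it is a SAYD module with coaction the restriction of $\rho_M\otimes \mathrm{id}$. Hopf-cyclic cohomology.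 Put $CN_n(\mathcal D)=\bigoplus_{X_0,\dots,X_n}\mathrm{Hom}(X_1,X_0)\otimes\mathrm{Hom}(X_2,X_1)\otimes\cdots\otimes\mathrm{Hom}(X_0,X_n)$, with the diagonal $H$-action, and let $C^n_H(\mathcal D,M)$ be the space of linear $\phi:M\otimes CN_n(\mathcal D)\to\mathbb C$ with $\phi(mh_1\otimes S(h_2)x)=\varepsilon(h)\phi(m\otimes x)$. Put $$(\tau_n\phi)(m\otimes f^0\otimes\cdots\otimes f^n)=\phi\big(m_{(0)}\otimes S^{-1}(m_{(-1)})f^n\otimes f^0\otimes\cdots\otimes f^{n-1}\big),$$ $$(b\phi)(m\otimes f^0\otimes\cdots\otimes f^{n+1})=\sum_{i=0}^n(-1)^i\phi(m\otimes f^0\otimes\cdots\otimes f^if^{i+1}\otimes\cdots\otimes f^{n+1})+(-1)^{n+1}\phi\big(m_{(0)}\otimes (S^{-1}(m_{(-1)})f^{n+1})f^0\otimes f^1\otimes\cdots\otimes f^n\big).$$ With $C^n_\lambda=\{\phi\in C^n_H(\mathcal D,M):(-1)^n\tau_n\phi=\phi\}$, let $Z^n_H(\mathcal D,M)=\{\phi\in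 C^n_\lambda: b\phi=0\}$, $B^n_H(\mathcal D,M)=b(C^{n-1}_\lambda)$ (with $B^0_H=0$) and $HC^n_H(\mathcal D,M)=Z^n_H(\mathcal D,M)/B^n_H(\mathcal D,M)$. Cycles. A left DGH-semicategory $(\mathcal S,\partial)$ is a $\mathbb C$-linear semicategory (identities need not exist) whose morphism spaces are cochain complexes $\mathrm{Hom}^n(X,Y)$, $n\ge 0$, of left $H$-modules, with composition a morphism of complexes and $h(gf)=(h_1g)(h_2f)$. A closed graded $(H,M)$-trace of dimension $n$ on $\mathcal S$ is a family of linear maps $T_X:M\otimes \mathrm{Hom}^n(X,X)\to\mathbb C$ with $$T_X(mh_1\otimes S(h_2)f)=\varepsilon(h)T_X(m\otimes f),\qquad T_X(m\otimes\partial f')=0,$$ $$T_X(m\otimes g'g)=(-1)^{ij}\,T_Y\big(m_{(0)}\otimes (S^{-1}(m_{(-1)})g)g'\big)$$ for $g\in\mathrm{Hom}^i(X,Y)$, $g'\in\mathrm{Hom}^j(Y,X)$, $i+j=n$. An $n$-dimensional cycle over $\mathcal D$ with coefficients in $M$ is $(\mathcal S,\partial,T,\rho)$ with $T$ such a trace and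 $\rho:\mathcal D\to\mathcal S^0$ an $H$-linear semifunctor; its character is $m\otimes f^0\otimes\cdots\otimes f^n\mapsto T(m\otimes\rho(f^0)\,\partial\rho(f^1)\cdots\partial\rho(f^n))$. The tensor product $\mathcal S\otimes\mathcal S'$ has pairs of objects, $\mathrm{Hom}^n=\bigoplus_{i+j=n}\mathrm{Hom}^i\otimes\mathrm{Hom}^j$, composition $(g\otimes g')(f\otimes f')=(-1)^{\deg g'\deg f}gf\otimes g'f'$, differential $f\otimes f'\mapsto\partial f\otimes f'+(-1)^{\deg f}f\otimes\partial' f'$ and the diagonal $H$-action. Theorem. Let $H$ be as above, let $M,M'$ be right-left SAYD modules over $H$ such that $M\square_HM'$ is an $H$-submodule of $M\otimes M'$, let $\mathcal D,\mathcal D'$ be left $H$-categories, and let $p,q\ge 0$. Then every element of $Z^p_H(\mathcal D,M)$ is the character of a $p$-dimensional cycle over $\mathcal D$, and every element of $Z^q_H(\mathcal D',M')$ is the character of a $q$-dimensional cycle over $\mathcal D'$. There is a bilinear map $$\gamma: Z^p_H(\mathcal D,M)\times Z^q_H(\mathcal D',M')\to Z^{p+q}_H(\mathcal D\otimes\mathcal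 D',M\square_HM')$$ such that, whenever $\phi$, $\phi'$ are the characters of cycles $(\mathcal S,\partial,T,\rho)$ over $\mathcal D$ and $(\mathcal S',\partial',T',\rho')$ over $\mathcal D'$, the family $$(T\# T')_{(X,X')}(m\otimes m'\otimes f\otimes f')=T_X(m\otimes f_p)\,T'_{X'}(m'\otimes f'_q)$$ (that is, $T\otimes T'$ applied to the component of degrees $(p,q)$) is a closed graded $(H,M\square_HM')$-trace of dimension $p+q$ on $\mathcal S\otimes\mathcal S'$, and $\gamma(\phi,\phi')$ is the character of the cycle $(\mathcal S\otimes\mathcal S',\partial\otimes\partial',T\# T',\rho\otimes\rho')$. The map $\gamma$ induces a linear map $$HC^p_H(\mathcal D,M)\otimes HC^q_H(\mathcal D',M')\to HC^{p+q}_H(\mathcal D\otimes\mathcal D',M\square_HM'),\qquad [\phi]\otimes[\phi']\mapsto[\gamma(\phi,\phi')].$$ -/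

import Mathlib

open scoped TensorProduct DirectSum
open CategoryTheory Coalgebra

namespace HopfCyclic

section Actions

variable {k H A B C : Type*} [Field k] [Ring H] [HopfAlgebra k H]
  [AddCommGroup A] [Module k A] [AddCommGroup B] [Module k B] [AddCommGroup C] [Module k C]

/-- The operators `x ⊗ y ↦ (a ⊗ b ↦ (u x) a ⊗ (v y) b)` for linear families `u`, `v` of
operators on `A` and on `B`. -/
noncomputable def pairAct {P Q A B : Type*} [AddCommGroup P] [Module k P]
    [AddCommGroup Q] [Module k Q] [AddCommGroup A] [Module k A] [AddCommGroup B] [Module k B]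
    (u : P →ₗ[k] Module.End k A) (v : Q →ₗ[k] Module.End k B) :
    P ⊗[k] Q →ₗ[k] Module.End k (A ⊗[k] B) :=
  TensorProduct.homTensorHomMap (.id k) A B A B ∘ₗ TensorProduct.map u v

@[simp] theorem pairAct_tmul {P Q A B : Type*} [AddCommGroup P] [Module k P]
    [AddCommGroup Q] [Module k Q] [AddCommGroup A] [Module k A] [AddCommGroup B] [Module k B]
    (u : P →ₗ[k] Module.End k A) (v : Q →ₗ[k] Module.End k B) (x : P) (y : Q) :
    pairAct u v (x ⊗ₜ y) = TensorProduct.map (u x) (v y) := rfl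

/-- The diagonal action `h (a ⊗ b) = h₁ a ⊗ h₂ b` of `H` on a tensor product of two left
`H`-modules. Throughout, a left `H`-module is a `k`-vector space `A` with an algebra map
`H → End_k A`. -/
noncomputable def diagAct (a : H →ₐ[k] Module.End k A) (b : H →ₐ[k] Module.End k B) :
    H →ₐ[k] Module.End k (A ⊗[k] B) :=
  (Module.endTensorEndAlgHom (R := k) (S := k) (A := k)).comp
    ((Algebra.TensorProduct.map a b).comp (Bialgebra.comulAlgHom k H))

theorem diagAct_apply (a : H →ₐ[k] Module.End k A) (b : H →ₐ[k] Module.End k B) (h : H) :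
    diagAct a b h = pairAct a.toLinearMap b.toLinearMap (comul (R := k) h) := by
  simp only [diagAct, AlgHom.comp_apply, Bialgebra.comulAlgHom_apply]
  induction comul (R := k) h with
  | zero => simp
  | add x y hx hy => simp only [map_add, hx, hy]
  | tmul x y => rfl

/-- The componentwise action on a direct sum of left `H`-modules. -/
noncomputable def sumAct {ι : Type*} {A : ι → Type*} [∀ i, AddCommGroup (A i)]
    [∀ i, Module k (A i)] (a : ∀ i, H →ₐ[k] Module.End k (A i)) :
    H →ₐ[k] Module.End k (⨁ i, A i) where
  toFun h := DirectSum.lmap fun i => a i h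
  map_one' := by ext; simp
  map_mul' g h := by ext; simp
  map_zero' := by ext; simp
  map_add' g h := by ext; simp
  commutes' c := by ext; simp [Module.algebraMap_end_apply]; rfl

@[simp] theorem sumAct_lof {ι : Type*} [DecidableEq ι] {A : ι → Type*} [∀ i, AddCommGroup (A i)]
    [∀ i, Module k (A i)] (a : ∀ i, H →ₐ[k] Module.End k (A i)) (h : H) (i : ι) (x : A i) :
    sumAct a h (DirectSum.lof k ι A i x) = DirectSum.lof k ι A i (a i h x) :=
  DirectSum.lmap_lof _ _ _

theorem diagAct_diagAct {A' B' : Type*} [AddCommGroup A'] [Module k A']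
    [AddCommGroup B'] [Module k B']
    (a : H →ₐ[k] Module.End k A) (a' : H →ₐ[k] Module.End k A')
    (b : H →ₐ[k] Module.End k B) (b' : H →ₐ[k] Module.End k B') (h : H) :
    diagAct (diagAct a a') (diagAct b b') h =
      pairAct (pairAct a.toLinearMap a'.toLinearMap) (pairAct b.toLinearMap b'.toLinearMap)
        (TensorProduct.map comul comul (comul (R := k) h)) := by
  rw [diagAct_apply]
  induction comul (R := k) h with
  | zero => simp
  | add x y hx hy => simp only [map_add, hx, hy]
  | tmul x y => simp [diagAct_apply]

/-- For cocommutative `H`, exchanging the two middle factors of `(A ⊗ A') ⊗ (B ⊗ B')` is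
`H`-linear. -/
theorem diagAct_middle [IsCocomm k H] {A' B' : Type*} [AddCommGroup A'] [Module k A']
    [AddCommGroup B'] [Module k B']
    (a : H →ₐ[k] Module.End k A) (a' : H →ₐ[k] Module.End k A')
    (b : H →ₐ[k] Module.End k B) (b' : H →ₐ[k] Module.End k B')
    (h : H) (x : (A ⊗[k] A') ⊗[k] (B ⊗[k] B')) :
    TensorProduct.tensorTensorTensorComm k A A' B B'
        (diagAct (diagAct a a') (diagAct b b') h x) =
      diagAct (diagAct a b) (diagAct a' b') h
        (TensorProduct.tensorTensorTensorComm k A A' B B' x) := by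
  have key : ∀ u : (H ⊗[k] H) ⊗[k] (H ⊗[k] H),
      (TensorProduct.tensorTensorTensorComm k A A' B B').toLinearMap ∘ₗ
        pairAct (pairAct a.toLinearMap a'.toLinearMap) (pairAct b.toLinearMap b'.toLinearMap) u =
      pairAct (pairAct a.toLinearMap b.toLinearMap) (pairAct a'.toLinearMap b'.toLinearMap)
        (TensorProduct.tensorTensorTensorComm k H H H H u) ∘ₗ
          (TensorProduct.tensorTensorTensorComm k A A' B B').toLinearMap := by
    intro u
    induction u with
    | zero => simp
    | add x y hx hy => simp only [map_add, LinearMap.comp_add, LinearMap.add_comp, hx, hy]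
    | tmul u v =>
      induction u with
      | zero => simp
      | add x y hx hy =>
        simp only [map_add, TensorProduct.add_tmul, LinearMap.comp_add, LinearMap.add_comp, hx, hy]
      | tmul u₁ u₂ =>
        induction v with
        | zero => simp
        | add x y hx hy =>
          simp only [map_add, TensorProduct.tmul_add, LinearMap.comp_add, LinearMap.add_comp,
            hx, hy]
        | tmul v₁ v₂ => ext; simp
  have hc : TensorProduct.tensorTensorTensorComm k H H H H
      (TensorProduct.map comul comul (comul (R := k) h)) =
      TensorProduct.map comul comul (comul (R := k) h) :=
    (LinearMap.congr_fun (comulCoalgHom k H).map_comp_comul h).symm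
  rw [diagAct_diagAct, diagAct_diagAct]
  have := LinearMap.congr_fun (key (TensorProduct.map comul comul (comul (R := k) h))) x
  rw [hc] at this
  exact this

end Actions

section SAYD

/-- The operator `x ↦ a x b` on `H`, linear in `a ⊗ b`. -/
noncomputable def sandwich (k H : Type*) [Field k] [Ring H] [HopfAlgebra k H] :
    H ⊗[k] H →ₗ[k] Module.End k H :=
  TensorProduct.lift ((LinearMap.mul k (Module.End k H)).compl₁₂
    (LinearMap.mul k H) (LinearMap.mul k H).flip)

/-- `h ↦ (S(h₃) ⊗ h₁) ⊗ h₂`. -/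
noncomputable def antipodeSplit (k H : Type*) [Field k] [Ring H] [HopfAlgebra k H] :
    H →ₗ[k] (H ⊗[k] H) ⊗[k] H :=
  (TensorProduct.rightComm k H H H).toLinearMap ∘ₗ
    ((HopfAlgebra.antipode k (A := H)).rTensor H).rTensor H ∘ₗ
    ((TensorProduct.comm k H H).toLinearMap).rTensor H ∘ₗ
    (TensorProduct.comm k H (H ⊗[k] H)).toLinearMap ∘ₗ
    (comul (R := k) (A := H)).lTensor H ∘ₗ comul

/-- The operator `x ⊗ m ↦ S(h₃) x h₁ ⊗ m h₂` on `H ⊗ M`, for a right action `r` on `M`. -/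
noncomputable def aydTwist {k H M : Type*} [Field k] [Ring H] [HopfAlgebra k H]
    [AddCommGroup M] [Module k M] (r : H →ₗ[k] Module.End k M) :
    H →ₗ[k] Module.End k (H ⊗[k] M) :=
  pairAct (sandwich k H) r ∘ₗ antipodeSplit k H

/-- The structure of a right-left stable anti-Yetter-Drinfeld module over `H` on the `k`-vector
space `M`: a right action `ract h m = m h` and a left coaction `m ↦ m₍₋₁₎ ⊗ m₍₀₎`. -/
structure SAYDModule (k H M : Type*) [Field k] [Ring H] [HopfAlgebra k H]
    [AddCommGroup M] [Module k M] where
  ract : H →ₗ[k] Module.End k M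
  ract_one : ∀ m, ract 1 m = m
  ract_mul : ∀ g h m, ract (g * h) m = ract h (ract g m)
  coact : M →ₗ[k] H ⊗[k] M
  coassoc : ∀ m, TensorProduct.assoc k H H M (comul.rTensor M (coact m)) =
    coact.lTensor H (coact m)
  counit_coact : ∀ m, TensorProduct.lid k M (counit.rTensor M (coact m)) = m
  /-- `ρ(m h) = S(h₃) m₍₋₁₎ h₁ ⊗ m₍₀₎ h₂` -/
  antiYetterDrinfeld : ∀ h m, coact (ract h m) = aydTwist ract h (coact m)
  /-- `m₍₀₎ m₍₋₁₎ = m` -/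
  stable : ∀ m, TensorProduct.lift ract (coact m) = m

variable {k H M M' : Type*} [Field k] [Ring H] [HopfAlgebra k H]
  [AddCommGroup M] [Module k M] [AddCommGroup M'] [Module k M']

/-- The map `ρ_M ⊗ id - id ⊗ ρ_{M'} : M ⊗ M' → M ⊗ H ⊗ M'`, where `M` is regarded as a right
comodule through `m ↦ m₍₀₎ ⊗ m₍₋₁₎`. -/
noncomputable def cotensorMap (𝓜 : SAYDModule k H M) (𝓜' : SAYDModule k H M') :
    M ⊗[k] M' →ₗ[k] M ⊗[k] (H ⊗[k] M') :=
  (TensorProduct.assoc k M H M').toLinearMap ∘ₗ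
      ((TensorProduct.comm k H M).toLinearMap ∘ₗ 𝓜.coact).rTensor M' -
    𝓜'.coact.lTensor M

/-- The cotensor product `M □_H M'`. -/
noncomputable abbrev Cotensor (𝓜 : SAYDModule k H M) (𝓜' : SAYDModule k H M') :
    Submodule k (M ⊗[k] M') :=
  LinearMap.ker (cotensorMap 𝓜 𝓜')

/-- The diagonal right action `(m ⊗ m') h = m h₁ ⊗ m' h₂` on `M ⊗ M'`. -/
noncomputable def diagRact (𝓜 : SAYDModule k H M) (𝓜' : SAYDModule k H M') :
    H →ₗ[k] Module.End k (M ⊗[k] M') :=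
  pairAct 𝓜.ract 𝓜'.ract ∘ₗ comul

/-- `M □_H M'` is an `H`-submodule of `M ⊗ M'`. -/
def CotensorIsSubmodule (𝓜 : SAYDModule k H M) (𝓜' : SAYDModule k H M') : Prop :=
  ∀ (h : H), ∀ x ∈ Cotensor 𝓜 𝓜', diagRact 𝓜 𝓜' h x ∈ Cotensor 𝓜 𝓜'

/-- The left coaction `ρ_M ⊗ id : M ⊗ M' → H ⊗ (M ⊗ M')`. -/
noncomputable def leftCoact (𝓜 : SAYDModule k H M) (M' : Type*) [AddCommGroup M'] [Module k M'] :
    M ⊗[k] M' →ₗ[k] H ⊗[k] (M ⊗[k] M') :=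
  (TensorProduct.assoc k H M M').toLinearMap ∘ₗ 𝓜.coact.rTensor M'

/-- `m₍₋₁₎ ⊗ m₍₀₎₍₀₎ ⊗ m₍₀₎₍₋₁₎` is symmetric in the two entries from `H`. -/
theorem coact_symm [IsCocomm k H] (𝓜 : SAYDModule k H M) (m : M) :
    𝓜.coact.lTensor H (𝓜.coact m) =
      TensorProduct.leftComm k H H M (𝓜.coact.lTensor H (𝓜.coact m)) := by
  rw [← 𝓜.coassoc]
  induction 𝓜.coact m with
  | zero => simp
  | add x y hx hy => simp only [map_add] at hx hy ⊢; rw [← hx, ← hy]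
  | tmul h m =>
    have : ∀ z : H ⊗[k] H, TensorProduct.leftComm k H H M
        (TensorProduct.assoc k H H M (z ⊗ₜ m)) =
        TensorProduct.assoc k H H M (TensorProduct.comm k H H z ⊗ₜ m) := by
      intro z
      induction z with
      | zero => simp
      | add x y hx hy => simp only [map_add, TensorProduct.add_tmul, hx, hy]
      | tmul x y => simp
    simp [this, comm_comul]

theorem leftCoact_mem [IsCocomm k H] (𝓜 : SAYDModule k H M) (𝓜' : SAYDModule k H M')
    (x : M ⊗[k] M') (hx : x ∈ Cotensor 𝓜 𝓜') :
    (cotensorMap 𝓜 𝓜').lTensor H (leftCoact 𝓜 M' x) = 0 := by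
  have key : (cotensorMap 𝓜 𝓜').lTensor H ∘ₗ leftCoact 𝓜 M' =
      ((TensorProduct.assoc k H M (H ⊗[k] M')).toLinearMap ∘ₗ 𝓜.coact.rTensor (H ⊗[k] M')) ∘ₗ
        cotensorMap 𝓜 𝓜' := by
    have h1 : ((TensorProduct.assoc k M H M').toLinearMap ∘ₗ
        ((TensorProduct.comm k H M).toLinearMap ∘ₗ 𝓜.coact).rTensor M').lTensor H ∘ₗ
          leftCoact 𝓜 M' =
        ((TensorProduct.assoc k H M (H ⊗[k] M')).toLinearMap ∘ₗ
          𝓜.coact.rTensor (H ⊗[k] M')) ∘ₗ ((TensorProduct.assoc k M H M').toLinearMap ∘ₗ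
      ((TensorProduct.comm k H M).toLinearMap ∘ₗ 𝓜.coact).rTensor M') := by
      ext m m'
      let F : H ⊗[k] (H ⊗[k] M) →ₗ[k] H ⊗[k] (M ⊗[k] (H ⊗[k] M')) :=
        ((TensorProduct.assoc k M H M').toLinearMap ∘ₗ (TensorProduct.mk k (M ⊗[k] H) M').flip m' ∘ₗ
          (TensorProduct.comm k H M).toLinearMap).lTensor H
      have e1 : ∀ z : H ⊗[k] M, ((TensorProduct.assoc k M H M').toLinearMap ∘ₗ
          ((TensorProduct.comm k H M).toLinearMap ∘ₗ 𝓜.coact).rTensor M').lTensor H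
            (TensorProduct.assoc k H M M' (z ⊗ₜ m')) = F (𝓜.coact.lTensor H z) := by
        intro z
        induction z with
        | zero => simp
        | add x y hx hy => simp only [map_add, TensorProduct.add_tmul, hx, hy]
        | tmul x y => simp [F]
      have e2 : ∀ z : H ⊗[k] M, TensorProduct.assoc k H M (H ⊗[k] M')
          (𝓜.coact.rTensor (H ⊗[k] M') (TensorProduct.assoc k M H M'
            (TensorProduct.comm k H M z ⊗ₜ m'))) =
          F (TensorProduct.leftComm k H H M (𝓜.coact.lTensor H z)) := by
        intro z
        induction z with
        | zero => simp
        | add x y hx hy => simp only [map_add, TensorProduct.add_tmul, hx, hy]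
        | tmul x y =>
          simp only [TensorProduct.comm_tmul, TensorProduct.assoc_tmul, LinearMap.rTensor_tmul,
            LinearMap.lTensor_tmul]
          generalize 𝓜.coact y = w
          induction w with
          | zero => simp
          | add x y hx hy =>
            simp only [map_add, TensorProduct.add_tmul, TensorProduct.tmul_add, hx, hy]
          | tmul x y => simp [F]
      have e := (e1 (𝓜.coact m)).trans ((congrArg F (coact_symm 𝓜 m)).trans
        (e2 (𝓜.coact m)).symm)
      exact e
    have h2 : (𝓜'.coact.lTensor M).lTensor H ∘ₗ leftCoact 𝓜 M' =
        ((TensorProduct.assoc k H M (H ⊗[k] M')).toLinearMap ∘ₗ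
          𝓜.coact.rTensor (H ⊗[k] M')) ∘ₗ 𝓜'.coact.lTensor M := by
      ext m m'
      simp only [leftCoact, TensorProduct.AlgebraTensorModule.curry_apply,
        LinearMap.restrictScalars_self, TensorProduct.curry_apply, LinearMap.coe_comp,
        LinearEquiv.coe_coe, Function.comp_apply, LinearMap.rTensor_tmul, LinearMap.lTensor_tmul]
      generalize 𝓜.coact m = w
      induction w with
      | zero => simp
      | add x y hx hy => simp only [map_add, TensorProduct.add_tmul, hx, hy]
      | tmul x y => simp
    rw [cotensorMap, LinearMap.lTensor_sub, LinearMap.sub_comp, LinearMap.comp_sub, h1, h2]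
  have := LinearMap.congr_fun key x
  simpa [LinearMap.mem_ker.mp hx] using this

/-- The coaction of `M □_H M'`: the restriction of `ρ_M ⊗ id`. -/
noncomputable def cotensorCoact [IsCocomm k H] (𝓜 : SAYDModule k H M) (𝓜' : SAYDModule k H M') :
    Cotensor 𝓜 𝓜' →ₗ[k] H ⊗[k] Cotensor 𝓜 𝓜' :=
  LinearMap.codRestrictOfInjective (leftCoact 𝓜 M' ∘ₗ (Cotensor 𝓜 𝓜').subtype)
    ((Cotensor 𝓜 𝓜').subtype.lTensor H)
    (Module.Flat.lTensor_preserves_injective_linearMap _ (Cotensor 𝓜 𝓜').injective_subtype)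
    (fun x => by
      have h := LinearMap.mem_ker.mpr (leftCoact_mem 𝓜 𝓜' x x.2)
      have e := Module.Flat.ker_lTensor_eq k H (cotensorMap 𝓜 𝓜')
      exact e.le h)

theorem subtype_cotensorCoact [IsCocomm k H] (𝓜 : SAYDModule k H M) (𝓜' : SAYDModule k H M')
    (x : Cotensor 𝓜 𝓜') :
    (Cotensor 𝓜 𝓜').subtype.lTensor H (cotensorCoact 𝓜 𝓜' x) = leftCoact 𝓜 M' x := by
  exact LinearMap.codRestrictOfInjective_comp_apply _ _ _ _ _

/-- `S(h₃) ⊗ h₁ ⊗ h₂ ⊗ h₄ = S(h₄) ⊗ h₁ ⊗ h₂ ⊗ h₃` for cocommutative `H`. -/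
theorem antipodeSplit_comul [IsCocomm k H] (h : H) :
    TensorProduct.assoc k (H ⊗[k] H) H H ((antipodeSplit k H).rTensor H (comul (R := k) h)) =
      comul.lTensor (H ⊗[k] H) (antipodeSplit k H h) := by
  let Pv : H ⊗[k] ((H ⊗[k] H) ⊗[k] H) →ₗ[k] (H ⊗[k] H) ⊗[k] (H ⊗[k] H) :=
    (TensorProduct.comm k (H ⊗[k] H) (H ⊗[k] H)).toLinearMap ∘ₗ
    (TensorProduct.assoc k (H ⊗[k] H) H H).toLinearMap ∘ₗ
    (TensorProduct.comm k H ((H ⊗[k] H) ⊗[k] H)).toLinearMap ∘ₗ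
      ((HopfAlgebra.antipode k (A := H)).lTensor (H ⊗[k] H)).lTensor H
  let perm : H ⊗[k] (H ⊗[k] H) →ₗ[k] (H ⊗[k] H) ⊗[k] H :=
    (TensorProduct.rightComm k H H H).toLinearMap ∘ₗ
    ((HopfAlgebra.antipode k (A := H)).rTensor H).rTensor H ∘ₗ
    ((TensorProduct.comm k H H).toLinearMap).rTensor H ∘ₗ
    (TensorProduct.comm k H (H ⊗[k] H)).toLinearMap
  have hv : ∀ z : H ⊗[k] (H ⊗[k] H), comul.lTensor (H ⊗[k] H) (perm z) =
      Pv ((comul.rTensor H).lTensor H z) := by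
    intro z
    refine LinearMap.congr_fun (f := comul.lTensor (H ⊗[k] H) ∘ₗ perm)
      (g := Pv ∘ₗ (comul.rTensor H).lTensor H) ?_ z
    ext x y w
    simp [perm, Pv]
  have hu : ∀ z : (H ⊗[k] H) ⊗[k] H, TensorProduct.assoc k (H ⊗[k] H) H H
      ((perm ∘ₗ comul.lTensor H).rTensor H z) =
      Pv ((TensorProduct.rightComm k H H H).toLinearMap.lTensor H
        ((comul.rTensor H).lTensor H (TensorProduct.assoc k H H H z))) := by
    intro z
    refine LinearMap.congr_fun
      (f := (TensorProduct.assoc k (H ⊗[k] H) H H).toLinearMap ∘ₗ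
        (perm ∘ₗ comul.lTensor H).rTensor H)
      (g := Pv ∘ₗ (TensorProduct.rightComm k H H H).toLinearMap.lTensor H ∘ₗ
        (comul.rTensor H).lTensor H ∘ₗ (TensorProduct.assoc k H H H).toLinearMap) ?_ z
    ext x y w
    simp only [TensorProduct.AlgebraTensorModule.curry_apply, LinearMap.restrictScalars_self,
      TensorProduct.curry_apply, LinearMap.coe_comp, LinearEquiv.coe_coe, Function.comp_apply,
      LinearMap.rTensor_tmul, LinearMap.lTensor_tmul, TensorProduct.assoc_tmul]
    generalize comul (R := k) y = t
    induction t with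
    | zero => simp
    | add x y hx hy =>
      simp only [map_add, TensorProduct.add_tmul, TensorProduct.tmul_add, hx, hy]
    | tmul x y => simp [perm, Pv]
  have hs : (TensorProduct.rightComm k H H H).toLinearMap ∘ₗ comul.rTensor H ∘ₗ
      comul (R := k) (A := H) = comul.rTensor H ∘ₗ comul := by
    have hr : ∀ z : H ⊗[k] (H ⊗[k] H), TensorProduct.rightComm k H H H
        ((TensorProduct.assoc k H H H).symm z) = (TensorProduct.assoc k H H H).symm
          ((TensorProduct.comm k H H).toLinearMap.lTensor H z) := by
      intro z
      refine LinearMap.congr_fun (f := (TensorProduct.rightComm k H H H).toLinearMap ∘ₗ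
        (TensorProduct.assoc k H H H).symm.toLinearMap) (g := (TensorProduct.assoc k H H H).symm
          ∘ₗ ((TensorProduct.comm k H H).toLinearMap.lTensor H)) ?_ z
      ext x y w
      simp
    ext1 y
    have e : comul.rTensor H (comul (R := k) y) =
        (TensorProduct.assoc k H H H).symm (comul.lTensor H (comul (R := k) y)) := by
      rw [coassoc_symm_apply]
    simp only [LinearMap.comp_apply, LinearEquiv.coe_coe]
    rw [e, hr, ← LinearMap.lTensor_comp_apply, IsCocomm.comm_comp_comul]
  have e1 : antipodeSplit k H = (perm ∘ₗ comul.lTensor H) ∘ₗ comul := rfl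
  have e2 : antipodeSplit k H h = perm (comul.lTensor H (comul (R := k) h)) := rfl
  have e3 : ∀ z : H ⊗[k] H, (TensorProduct.rightComm k H H H).toLinearMap.lTensor H
      ((comul.rTensor H).lTensor H (comul.lTensor H z)) =
      (comul.rTensor H).lTensor H (comul.lTensor H z) := by
    intro z
    rw [← LinearMap.lTensor_comp_apply, ← LinearMap.lTensor_comp_apply, LinearMap.comp_assoc, hs,
      LinearMap.lTensor_comp_apply]
  rw [e2, hv, e1, LinearMap.rTensor_comp_apply, hu, coassoc_apply, e3]

theorem leftCoact_coassoc (𝓜 : SAYDModule k H M) (x : M ⊗[k] M') :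
    TensorProduct.assoc k H H (M ⊗[k] M') (comul.rTensor (M ⊗[k] M') (leftCoact 𝓜 M' x)) =
      (leftCoact 𝓜 M').lTensor H (leftCoact 𝓜 M' x) := by
  refine LinearMap.congr_fun (f := (TensorProduct.assoc k H H (M ⊗[k] M')).toLinearMap ∘ₗ
    comul.rTensor (M ⊗[k] M') ∘ₗ leftCoact 𝓜 M')
    (g := (leftCoact 𝓜 M').lTensor H ∘ₗ leftCoact 𝓜 M') ?_ x
  ext m m'
  let G : H ⊗[k] (H ⊗[k] M) →ₗ[k] H ⊗[k] (H ⊗[k] (M ⊗[k] M')) :=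
    (((TensorProduct.mk k M M').flip m').lTensor H).lTensor H
  have e1 : ∀ z : H ⊗[k] M, TensorProduct.assoc k H H (M ⊗[k] M') (comul.rTensor (M ⊗[k] M')
      (TensorProduct.assoc k H M M' (z ⊗ₜ m'))) =
      G (TensorProduct.assoc k H H M (comul.rTensor M z)) := by
    intro z
    induction z with
    | zero => simp
    | add x y hx hy => simp only [map_add, TensorProduct.add_tmul, hx, hy]
    | tmul x y =>
      simp only [TensorProduct.assoc_tmul, LinearMap.rTensor_tmul]
      generalize comul (R := k) x = t
      induction t with
      | zero => simp
      | add x y hx hy => simp only [map_add, TensorProduct.add_tmul, hx, hy]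
      | tmul x y => simp [G]
  have e2 : ∀ z : H ⊗[k] M, (leftCoact 𝓜 M').lTensor H (TensorProduct.assoc k H M M' (z ⊗ₜ m')) =
      G (𝓜.coact.lTensor H z) := by
    intro z
    induction z with
    | zero => simp
    | add x y hx hy => simp only [map_add, TensorProduct.add_tmul, hx, hy]
    | tmul x y =>
      simp only [TensorProduct.assoc_tmul, LinearMap.lTensor_tmul, leftCoact, LinearMap.comp_apply,
        LinearMap.rTensor_tmul, LinearEquiv.coe_coe]
      generalize 𝓜.coact y = t
      induction t with
      | zero => simp
      | add x y hx hy => simp only [map_add, TensorProduct.add_tmul, TensorProduct.tmul_add, hx, hy]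
      | tmul x y => simp [G]
  exact (e1 (𝓜.coact m)).trans ((congrArg G (𝓜.coassoc m)).trans (e2 (𝓜.coact m)).symm)

theorem leftCoact_counit (𝓜 : SAYDModule k H M) (x : M ⊗[k] M') :
    TensorProduct.lid k (M ⊗[k] M') (counit.rTensor (M ⊗[k] M') (leftCoact 𝓜 M' x)) = x := by
  refine LinearMap.congr_fun (f := (TensorProduct.lid k (M ⊗[k] M')).toLinearMap ∘ₗ
    counit.rTensor (M ⊗[k] M') ∘ₗ leftCoact 𝓜 M') (g := LinearMap.id) ?_ x
  ext m m'
  have e1 : ∀ z : H ⊗[k] M, TensorProduct.lid k (M ⊗[k] M') (counit.rTensor (M ⊗[k] M')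
      (TensorProduct.assoc k H M M' (z ⊗ₜ m'))) =
      TensorProduct.lid k M (counit.rTensor M z) ⊗ₜ m' := by
    intro z
    induction z with
    | zero => simp
    | add x y hx hy => simp only [map_add, TensorProduct.add_tmul, hx, hy]
    | tmul x y => simp [TensorProduct.smul_tmul']
  exact (e1 (𝓜.coact m)).trans (congrArg (· ⊗ₜ m') (𝓜.counit_coact m))

theorem leftCoact_ayd [IsCocomm k H] (𝓜 : SAYDModule k H M) (𝓜' : SAYDModule k H M')
    (h : H) (x : M ⊗[k] M') :
    leftCoact 𝓜 M' (diagRact 𝓜 𝓜' h x) =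
      aydTwist (diagRact 𝓜 𝓜') h (leftCoact 𝓜 M' x) := by
  refine LinearMap.congr_fun (f := leftCoact 𝓜 M' ∘ₗ diagRact 𝓜 𝓜' h)
    (g := aydTwist (diagRact 𝓜 𝓜') h ∘ₗ leftCoact 𝓜 M') ?_ x
  ext m m'
  -- both sides in terms of a common fourfold action
  have e1 : ∀ z : H ⊗[k] H, leftCoact 𝓜 M' (pairAct 𝓜.ract 𝓜'.ract z (m ⊗ₜ m')) =
      TensorProduct.assoc k H M M' (pairAct (aydTwist 𝓜.ract) 𝓜'.ract z (𝓜.coact m ⊗ₜ m')) := by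
    intro z
    induction z with
    | zero => simp
    | add x y hx hy => simp only [map_add, LinearMap.add_apply, hx, hy]
    | tmul x y => simp [leftCoact, 𝓜.antiYetterDrinfeld]
  have e2 : ∀ (z : H ⊗[k] H) (w : (H ⊗[k] M) ⊗[k] M'),
      TensorProduct.assoc k H M M' (pairAct (aydTwist 𝓜.ract) 𝓜'.ract z w) =
      pairAct (sandwich k H) (pairAct 𝓜.ract 𝓜'.ract) (TensorProduct.assoc k (H ⊗[k] H) H H
        ((antipodeSplit k H).rTensor H z)) (TensorProduct.assoc k H M M' w) := by
    intro z w
    induction z with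
    | zero => simp
    | add x y hx hy => simp only [map_add, LinearMap.add_apply, hx, hy]
    | tmul x y =>
      simp only [aydTwist, pairAct_tmul, LinearMap.comp_apply, LinearMap.rTensor_tmul]
      generalize antipodeSplit k H x = t
      induction t with
      | zero => simp
      | add x y hx hy =>
        simp only [map_add, LinearMap.add_apply, TensorProduct.map_add_left,
          TensorProduct.add_tmul, hx, hy]
      | tmul x z =>
        simp only [TensorProduct.assoc_tmul, pairAct_tmul]
        exact (LinearMap.congr_fun (TensorProduct.map_map_comp_assoc_eq (R := k)
          (sandwich k H x) (𝓜.ract z) (𝓜'.ract y)) w).symm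
  have e3 : ∀ (t : (H ⊗[k] H) ⊗[k] H), pairAct (sandwich k H) (diagRact 𝓜 𝓜') t =
      pairAct (sandwich k H) (pairAct 𝓜.ract 𝓜'.ract) (comul.lTensor (H ⊗[k] H) t) := by
    intro t
    induction t with
    | zero => simp
    | add x y hx hy => simp only [map_add, hx, hy]
    | tmul x y => simp [diagRact]
  have f1 := (e1 (comul (R := k) h)).trans (e2 (comul (R := k) h) (𝓜.coact m ⊗ₜ m'))
  rw [antipodeSplit_comul, ← e3] at f1
  exact f1

theorem diagRact_stable [IsCocomm k H] (𝓜 : SAYDModule k H M) (𝓜' : SAYDModule k H M')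
    (x : M ⊗[k] M') (hx : x ∈ Cotensor 𝓜 𝓜') :
    TensorProduct.lift (diagRact 𝓜 𝓜') (leftCoact 𝓜 M' x) = x := by
  -- `m₍₀₎ ⊗ (m₍₋₁₎ ⊗ m') ↦ m₍₀₎ ⊗ m' m₍₋₁₎`
  let K : M ⊗[k] (H ⊗[k] M') →ₗ[k] M ⊗[k] M' := (TensorProduct.lift 𝓜'.ract).lTensor M
  have hK : TensorProduct.lift (diagRact 𝓜 𝓜') ∘ₗ leftCoact 𝓜 M' =
      K ∘ₗ (TensorProduct.assoc k M H M').toLinearMap ∘ₗ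
      ((TensorProduct.comm k H M).toLinearMap ∘ₗ 𝓜.coact).rTensor M' := by
    ext m m'
    let L : H ⊗[k] (H ⊗[k] M) →ₗ[k] M ⊗[k] M' :=
      TensorProduct.lift ((TensorProduct.mk k M M').flip ∘ₗ 𝓜'.ract.flip m') ∘ₗ
        (TensorProduct.lift 𝓜.ract).lTensor H
    have e1 : ∀ z : H ⊗[k] M, TensorProduct.lift (diagRact 𝓜 𝓜')
        (TensorProduct.assoc k H M M' (z ⊗ₜ m')) =
        L (TensorProduct.leftComm k H H M
          (TensorProduct.assoc k H H M (comul.rTensor M z))) := by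
      intro z
      induction z with
      | zero => simp
      | add x y hx hy => simp only [map_add, TensorProduct.add_tmul, hx, hy]
      | tmul x y =>
        simp only [TensorProduct.assoc_tmul, TensorProduct.lift.tmul, diagRact,
          LinearMap.comp_apply, LinearMap.rTensor_tmul]
        generalize comul (R := k) x = t
        induction t with
        | zero => simp
        | add x y hx hy =>
          simp only [map_add, TensorProduct.add_tmul, LinearMap.add_apply, hx, hy]
        | tmul x y => simp [L]
    have e2 : ∀ z : H ⊗[k] M, L (𝓜.coact.lTensor H z) =
        K (TensorProduct.assoc k M H M' (TensorProduct.comm k H M z ⊗ₜ m')) := by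
      intro z
      induction z with
      | zero => simp
      | add x y hx hy => simp only [map_add, TensorProduct.add_tmul, hx, hy]
      | tmul x y => simp [L, K, 𝓜.stable]
    have e3 := e1 (𝓜.coact m)
    rw [𝓜.coassoc, ← coact_symm, e2] at e3
    exact e3
  have hK' : K ∘ₗ 𝓜'.coact.lTensor M = LinearMap.id := by
    ext m m'
    simp [K, 𝓜'.stable]
  have h0 : cotensorMap 𝓜 𝓜' x = 0 := hx
  rw [cotensorMap, LinearMap.sub_apply, sub_eq_zero] at h0
  have h1 := LinearMap.congr_fun hK x
  have h2 := LinearMap.congr_fun hK' x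
  simp only [LinearMap.comp_apply] at h1 h0 h2
  rw [h1, h0, h2, LinearMap.id_apply]

theorem diagRact_one (𝓜 : SAYDModule k H M) (𝓜' : SAYDModule k H M') (x : M ⊗[k] M') :
    diagRact 𝓜 𝓜' 1 x = x := by
  have h1 : 𝓜.ract 1 = LinearMap.id := LinearMap.ext 𝓜.ract_one
  have h2 : 𝓜'.ract 1 = LinearMap.id := LinearMap.ext 𝓜'.ract_one
  simp [diagRact, Algebra.TensorProduct.one_def, h1, h2]

theorem diagRact_mul (𝓜 : SAYDModule k H M) (𝓜' : SAYDModule k H M') (g h : H) (x : M ⊗[k] M') :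
    diagRact 𝓜 𝓜' (g * h) x = diagRact 𝓜 𝓜' h (diagRact 𝓜 𝓜' g x) := by
  have h1 : ∀ a b, 𝓜.ract (a * b) = 𝓜.ract b ∘ₗ 𝓜.ract a := fun a b =>
    LinearMap.ext (𝓜.ract_mul a b)
  have h2 : ∀ a b, 𝓜'.ract (a * b) = 𝓜'.ract b ∘ₗ 𝓜'.ract a := fun a b =>
    LinearMap.ext (𝓜'.ract_mul a b)
  have key : ∀ u v : H ⊗[k] H, pairAct 𝓜.ract 𝓜'.ract (u * v) =
      pairAct 𝓜.ract 𝓜'.ract v ∘ₗ pairAct 𝓜.ract 𝓜'.ract u := by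
    intro u v
    induction u with
    | zero => simp
    | add x y hx hy => simp only [add_mul, map_add, LinearMap.comp_add, hx, hy]
    | tmul a b =>
      induction v with
      | zero => simp
      | add x y hx hy => simp only [mul_add, map_add, LinearMap.add_comp, hx, hy]
      | tmul c d => simp [h1, h2, TensorProduct.map_comp]
  simp [diagRact, Bialgebra.comul_mul, key]

/-- The stable anti-Yetter-Drinfeld module `M □_H M'`: the right action is the restriction of the
diagonal action on `M ⊗ M'`, the left coaction is the restriction of `ρ_M ⊗ id`. -/
noncomputable def SAYDModule.cotensor [IsCocomm k H] (𝓜 : SAYDModule k H M)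
    (𝓜' : SAYDModule k H M') (hsub : CotensorIsSubmodule 𝓜 𝓜') :
    SAYDModule k H (Cotensor 𝓜 𝓜') where
  ract :=
    { toFun := fun h => (diagRact 𝓜 𝓜' h).restrict (hsub h)
      map_add' := fun g h => by ext x; simp
      map_smul' := fun c h => by ext x; simp }
  ract_one x := Subtype.ext (diagRact_one 𝓜 𝓜' x)
  ract_mul g h x := Subtype.ext (diagRact_mul 𝓜 𝓜' g h x)
  coact := cotensorCoact 𝓜 𝓜'
  coassoc x := by
    have inj : Function.Injective (((Cotensor 𝓜 𝓜').subtype.lTensor H).lTensor H) :=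
      Module.Flat.lTensor_preserves_injective_linearMap _
        (Module.Flat.lTensor_preserves_injective_linearMap _ (Cotensor 𝓜 𝓜').injective_subtype)
    have n1 : ∀ z : H ⊗[k] Cotensor 𝓜 𝓜', ((Cotensor 𝓜 𝓜').subtype.lTensor H).lTensor H
        (TensorProduct.assoc k H H _ (comul.rTensor _ z)) =
        TensorProduct.assoc k H H _ (comul.rTensor _ ((Cotensor 𝓜 𝓜').subtype.lTensor H z)) := by
      intro z
      induction z with
      | zero => simp
      | add x y hx hy => simp only [map_add, hx, hy]
      | tmul x y =>
        simp only [LinearMap.rTensor_tmul, LinearMap.lTensor_tmul]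
        generalize comul (R := k) x = t
        induction t with
        | zero => simp
        | add x y hx hy => simp only [map_add, TensorProduct.add_tmul, hx, hy]
        | tmul x y => simp
    have n2 : (Cotensor 𝓜 𝓜').subtype.lTensor H ∘ₗ cotensorCoact 𝓜 𝓜' =
        leftCoact 𝓜 M' ∘ₗ (Cotensor 𝓜 𝓜').subtype :=
      LinearMap.ext (subtype_cotensorCoact 𝓜 𝓜')
    apply inj
    rw [n1, subtype_cotensorCoact, leftCoact_coassoc, ← LinearMap.lTensor_comp_apply, n2,
      LinearMap.lTensor_comp_apply, subtype_cotensorCoact]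
  counit_coact x := by
    have n1 : ∀ z : H ⊗[k] Cotensor 𝓜 𝓜',
        ((TensorProduct.lid k _ (counit.rTensor _ z) : Cotensor 𝓜 𝓜') : M ⊗[k] M') =
        TensorProduct.lid k _ (counit.rTensor _ ((Cotensor 𝓜 𝓜').subtype.lTensor H z)) := by
      intro z
      induction z with
      | zero => simp
      | add x y hx hy => simp only [map_add, Submodule.coe_add, hx, hy]
      | tmul x y => simp
    apply Subtype.ext
    rw [n1, subtype_cotensorCoact, leftCoact_counit]
  antiYetterDrinfeld h x := by
    apply Module.Flat.lTensor_preserves_injective_linearMap (M := H) _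
      (Cotensor 𝓜 𝓜').injective_subtype
    have n1 : ∀ r : H →ₗ[k] Module.End k (Cotensor 𝓜 𝓜'),
        (∀ h y, (r h y : M ⊗[k] M') = diagRact 𝓜 𝓜' h y) → ∀ z,
        (Cotensor 𝓜 𝓜').subtype.lTensor H (aydTwist r h z) =
        aydTwist (diagRact 𝓜 𝓜') h ((Cotensor 𝓜 𝓜').subtype.lTensor H z) := by
      intro r hr z
      simp only [aydTwist, LinearMap.comp_apply]
      generalize antipodeSplit k H h = t
      induction t with
      | zero => simp
      | add x y hx hy => simp only [map_add, LinearMap.add_apply, hx, hy]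
      | tmul x y =>
        simp only [pairAct_tmul]
        induction z with
        | zero => simp
        | add x y hx hy => simp only [map_add, hx, hy]
        | tmul a b => simp [hr]
    rw [n1 _ (fun h y => rfl), subtype_cotensorCoact, subtype_cotensorCoact, ← leftCoact_ayd]
    rfl
  stable x := by
    have n1 : ∀ r : H →ₗ[k] Module.End k (Cotensor 𝓜 𝓜'),
        (∀ h y, (r h y : M ⊗[k] M') = diagRact 𝓜 𝓜' h y) → ∀ z,
        (TensorProduct.lift r z : M ⊗[k] M') =
        TensorProduct.lift (diagRact 𝓜 𝓜') ((Cotensor 𝓜 𝓜').subtype.lTensor H z) := by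
      intro r hr z
      induction z with
      | zero => simp
      | add x y hx hy => simp only [map_add, Submodule.coe_add, hx, hy]
      | tmul x y => simp [hr]
    apply Subtype.ext
    rw [n1 _ (fun h y => rfl), subtype_cotensorCoact, diagRact_stable 𝓜 𝓜' x x.2]

end SAYD

section Categories

universe v u v' u'

/-- Composition in a `k`-linear category as a linear map, `g ⊗ f ↦ g ∘ f`. -/
noncomputable def compMap (k : Type*) {D : Type u} [Field k] [Category.{v} D] [Preadditive D]
    [Linear k D] (X Y Z : D) : (Y ⟶ Z) ⊗[k] (X ⟶ Y) →ₗ[k] (X ⟶ Z) :=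
  TensorProduct.lift (Linear.comp X Y Z).flip

@[simp] theorem compMap_tmul (k : Type*) {D : Type u} [Field k] [Category.{v} D] [Preadditive D]
    [Linear k D] {X Y Z : D} (g : Y ⟶ Z) (f : X ⟶ Y) : compMap k X Y Z (g ⊗ₜ f) = f ≫ g := rfl

/-- The structure of a left `H`-module category on a `k`-linear category `D`: every `Hom(X, Y)` is
a left `H`-module, `h id_X = ε(h) id_X`, and `h (g f) = (h₁ g) (h₂ f)`. -/
class HCategory (k H : Type*) (D : Type u) [Field k] [Ring H] [HopfAlgebra k H]
    [Category.{v} D] [Preadditive D] [Linear k D] where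
  act : ∀ X Y : D, H →ₐ[k] Module.End k (X ⟶ Y)
  act_id : ∀ (h : H) (X : D), act X X h (𝟙 X) = counit (R := k) h • 𝟙 X
  act_comp : ∀ (X Y Z : D) (h : H) (t : (Y ⟶ Z) ⊗[k] (X ⟶ Y)),
    act X Z h (compMap k X Y Z t) = compMap k X Y Z (diagAct (act Y Z) (act X Y) h t)

theorem diagAct_map {k H A B A' B' : Type*} [Field k] [Ring H] [HopfAlgebra k H]
    [AddCommGroup A] [Module k A] [AddCommGroup B] [Module k B]
    [AddCommGroup A'] [Module k A'] [AddCommGroup B'] [Module k B']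
    (a : H →ₐ[k] Module.End k A) (b : H →ₐ[k] Module.End k B)
    (a' : H →ₐ[k] Module.End k A') (b' : H →ₐ[k] Module.End k B')
    (f : A →ₗ[k] A') (g : B →ₗ[k] B')
    (hf : ∀ h x, f (a h x) = a' h (f x)) (hg : ∀ h x, g (b h x) = b' h (g x))
    (h : H) (t : A ⊗[k] B) :
    TensorProduct.map f g (diagAct a b h t) = diagAct a' b' h (TensorProduct.map f g t) := by
  rw [diagAct_apply, diagAct_apply]
  induction comul (R := k) h with
  | zero => simp
  | add x y hx hy => simp only [map_add, LinearMap.add_apply, hx, hy]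
  | tmul x y =>
    induction t with
    | zero => simp
    | add s t hs ht => simp only [map_add, hs, ht]
    | tmul s t => simp [hf, hg]

/-- The tensor product `D ⊗ D'` of `k`-linear categories: its objects are pairs of objects, and
`Hom((X, X'), (Y, Y')) = Hom(X, Y) ⊗ Hom(X', Y')`. -/
structure TensorCat (k : Type*) (D : Type u) (D' : Type u') where
  fst : D
  snd : D'

namespace TensorCat

variable {k : Type*} {D : Type u} {D' : Type u'} [Field k]
  [Category.{v} D] [Preadditive D] [Linear k D] [Category.{v'} D'] [Preadditive D'] [Linear k D']

/-- Composition in `D ⊗ D'`: `(g ⊗ g') ∘ (f ⊗ f') = (g ∘ f) ⊗ (g' ∘ f')`. -/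
noncomputable def compT (X Y Z : TensorCat k D D') :
    ((Y.fst ⟶ Z.fst) ⊗[k] (Y.snd ⟶ Z.snd)) ⊗[k] ((X.fst ⟶ Y.fst) ⊗[k] (X.snd ⟶ Y.snd)) →ₗ[k]
      (X.fst ⟶ Z.fst) ⊗[k] (X.snd ⟶ Z.snd) :=
  TensorProduct.map (compMap k X.fst Y.fst Z.fst) (compMap k X.snd Y.snd Z.snd) ∘ₗ
    (TensorProduct.tensorTensorTensorComm k _ _ _ _).toLinearMap

@[simp] theorem compT_tmul {X Y Z : TensorCat k D D'} (g : Y.fst ⟶ Z.fst) (g' : Y.snd ⟶ Z.snd)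
    (f : X.fst ⟶ Y.fst) (f' : X.snd ⟶ Y.snd) :
    compT X Y Z ((g ⊗ₜ g') ⊗ₜ (f ⊗ₜ f')) = (f ≫ g) ⊗ₜ (f' ≫ g') := rfl

noncomputable instance : Category.{max v v'} (TensorCat k D D') where
  Hom X Y := (X.fst ⟶ Y.fst) ⊗[k] (X.snd ⟶ Y.snd)
  id X := 𝟙 X.fst ⊗ₜ 𝟙 X.snd
  comp {X Y Z} f g := compT X Y Z (g ⊗ₜ f)
  id_comp {X Y} f := by
    induction f with
    | zero => simp
    | add x y hx hy => simp only [TensorProduct.add_tmul, map_add, hx, hy]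
    | tmul x y => simp
  comp_id {X Y} f := by
    induction f with
    | zero => simp
    | add x y hx hy => simp only [TensorProduct.tmul_add, map_add, hx, hy]
    | tmul x y => simp
  assoc {W X Y Z} f g h := by
    induction f with
    | zero => simp
    | add x y hx hy => simp only [TensorProduct.tmul_add, map_add, hx, hy]
    | tmul f f' =>
      induction g with
      | zero => simp
      | add x y hx hy => simp only [TensorProduct.tmul_add, TensorProduct.add_tmul, map_add, hx, hy]
      | tmul g g' =>
        induction h with
        | zero => simp
        | add x y hx hy => simp only [TensorProduct.add_tmul, map_add, hx, hy]
        | tmul h h' => simp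

noncomputable instance : Preadditive (TensorCat k D D') where
  homGroup X Y := TensorProduct.addCommGroup (R := k) (M := X.fst ⟶ Y.fst) (N := X.snd ⟶ Y.snd)
  add_comp X Y Z f f' g :=
    (congrArg (compT X Y Z) (TensorProduct.tmul_add (R := k)
      (M := (Y.fst ⟶ Z.fst) ⊗[k] (Y.snd ⟶ Z.snd))
      (N := (X.fst ⟶ Y.fst) ⊗[k] (X.snd ⟶ Y.snd)) g f f')).trans (map_add _ _ _)
  comp_add X Y Z f g g' :=
    (congrArg (compT X Y Z) (TensorProduct.add_tmul (R := k)
      (M := (Y.fst ⟶ Z.fst) ⊗[k] (Y.snd ⟶ Z.snd))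
      (N := (X.fst ⟶ Y.fst) ⊗[k] (X.snd ⟶ Y.snd)) g g' f)).trans (map_add _ _ _)

noncomputable instance : Linear k (TensorCat k D D') where
  homModule X Y := TensorProduct.instModule (R := k) (M := X.fst ⟶ Y.fst) (N := X.snd ⟶ Y.snd)
  smul_comp X Y Z c f g :=
    (congrArg (compT X Y Z) (TensorProduct.tmul_smul (R := k)
      (M := (Y.fst ⟶ Z.fst) ⊗[k] (Y.snd ⟶ Z.snd))
      (N := (X.fst ⟶ Y.fst) ⊗[k] (X.snd ⟶ Y.snd)) c g f)).trans (map_smul _ _ _)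
  comp_smul X Y Z f c g :=
    (congrArg (compT X Y Z) (TensorProduct.smul_tmul' (R := k)
      (M := (Y.fst ⟶ Z.fst) ⊗[k] (Y.snd ⟶ Z.snd))
      (N := (X.fst ⟶ Y.fst) ⊗[k] (X.snd ⟶ Y.snd)) c g f).symm).trans (map_smul _ _ _)

/-- For cocommutative `H`, the tensor product of left `H`-categories is a left `H`-category under
the diagonal action. -/
noncomputable instance {H : Type*} [Ring H] [HopfAlgebra k H] [IsCocomm k H]
    [HCategory k H D] [HCategory k H D'] : HCategory k H (TensorCat k D D') where
  act X Y := diagAct (HCategory.act X.fst Y.fst) (HCategory.act X.snd Y.snd)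
  act_id h X := by
    change diagAct _ _ h (𝟙 X.fst ⊗ₜ 𝟙 X.snd) = counit (R := k) h • (𝟙 X.fst ⊗ₜ[k] 𝟙 X.snd)
    rw [diagAct_apply]
    have e : ∀ z : H ⊗[k] H, pairAct (HCategory.act (k := k) X.fst X.fst).toLinearMap
        (HCategory.act (k := k) X.snd X.snd).toLinearMap z (𝟙 X.fst ⊗ₜ 𝟙 X.snd) =
        counit (R := k) (TensorProduct.lid k H (counit.rTensor H z)) •
          (𝟙 X.fst ⊗ₜ[k] 𝟙 X.snd) := by
      intro z
      induction z with
      | zero => simp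
      | add x y hx hy => simp only [map_add, LinearMap.add_apply, hx, hy, add_smul]
      | tmul x y =>
        simp [HCategory.act_id, TensorProduct.smul_tmul', TensorProduct.tmul_smul, smul_smul, mul_comm]
    rw [e, rTensor_counit_comul]
    simp
  act_comp X Y Z h t := by
    have e : ∀ t : ((Y.fst ⟶ Z.fst) ⊗[k] (Y.snd ⟶ Z.snd)) ⊗[k]
        ((X.fst ⟶ Y.fst) ⊗[k] (X.snd ⟶ Y.snd)),
        diagAct (HCategory.act (H := H) (k := k) X.fst Z.fst) (HCategory.act X.snd Z.snd) h
          (compT X Y Z t) =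
        compT X Y Z (diagAct (diagAct (HCategory.act Y.fst Z.fst) (HCategory.act Y.snd Z.snd))
          (diagAct (HCategory.act X.fst Y.fst) (HCategory.act X.snd Y.snd)) h t) := by
      intro t
      simp only [compT, LinearMap.comp_apply, LinearEquiv.coe_coe]
      rw [diagAct_middle]
      exact (diagAct_map _ _ _ _ _ _ (fun h x => (HCategory.act_comp _ _ _ h x).symm)
        (fun h x => (HCategory.act_comp _ _ _ h x).symm) h _).symm
    have e2 : compMap k X Y Z = compT X Y Z := TensorProduct.ext' fun _ _ => rfl
    rw [e2]
    exact e t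

end TensorCat

end Categories

section Strands

universe u

/-- The linear map out of `A ⊗ ⨁ i, B i` with given components. -/
noncomputable def sumRight {k A P : Type*} [Field k] [AddCommGroup A] [Module k A]
    [AddCommGroup P] [Module k P] {ι : Type*} {B : ι → Type*} [∀ i, AddCommGroup (B i)]
    [∀ i, Module k (B i)] (F : ∀ i, A ⊗[k] B i →ₗ[k] P) : A ⊗[k] (⨁ i, B i) →ₗ[k] P :=
  open Classical in
  TensorProduct.lift (DirectSum.toModule k ι (A →ₗ[k] P)
    fun i => (TensorProduct.curry (F i)).flip).flip

@[simp] theorem sumRight_tmul_lof {k A P : Type*} [Field k] [AddCommGroup A] [Module k A]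
    [AddCommGroup P] [Module k P] {ι : Type*} [DecidableEq ι] {B : ι → Type*}
    [∀ i, AddCommGroup (B i)] [∀ i, Module k (B i)] (F : ∀ i, A ⊗[k] B i →ₗ[k] P)
    (a : A) (i : ι) (b : B i) :
    sumRight F (a ⊗ₜ DirectSum.lof k ι B i b) = F i (a ⊗ₜ b) := by
  classical
  obtain rfl : ‹DecidableEq ι› = fun a b => Classical.propDecidable (a = b) :=
    Subsingleton.elim _ _
  simp [sumRight]

/-- For a small `k`-linear category `D`, the space
`⨁ Hom(X₁, X) ⊗ Hom(X₂, X₁) ⊗ ... ⊗ Hom(Y, Xₙ)`, summed over all `X₁, ..., Xₙ`. -/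
noncomputable def strand (k : Type*) {D : Type u} [Field k] [SmallCategory D] [Preadditive D]
    [Linear k D] : ℕ → D → D → ModuleCat.{u} k
  | 0, X, Y => ModuleCat.of k (Y ⟶ X)
  | n + 1, X, Y => ModuleCat.of k (⨁ Z : D, (Z ⟶ X) ⊗[k] strand k n Z Y)

variable {k H : Type*} {D : Type u} [Field k] [Ring H] [HopfAlgebra k H]
  [SmallCategory D] [Preadditive D] [Linear k D]

/-- The identification of `strand k 0 X Y` with `Hom(Y, X)`. -/
noncomputable def strandOne (X Y : D) : (Y ⟶ X) ≃ₗ[k] strand k 0 X Y :=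
  LinearEquiv.refl k (Y ⟶ X)

/-- `f ⊗ (f¹ ⊗ ... ⊗ fⁿ⁺¹) ↦ f ⊗ f¹ ⊗ ... ⊗ fⁿ⁺¹`. -/
noncomputable def strandCons (n : ℕ) (X Z Y : D) :
    (Z ⟶ X) ⊗[k] strand k n Z Y →ₗ[k] strand k (n + 1) X Y :=
  open Classical in
  DirectSum.lof k D (fun Z => (Z ⟶ X) ⊗[k] strand k n Z Y) Z

/-- The linear map out of `strand k (n + 1) X Y` with given components. -/
noncomputable def strandLift {P : Type*} [AddCommGroup P] [Module k P] {n : ℕ} {X Y : D}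
    (F : ∀ Z, (Z ⟶ X) ⊗[k] strand k n Z Y →ₗ[k] P) : strand k (n + 1) X Y →ₗ[k] P :=
  open Classical in
  DirectSum.toModule k D P F

@[simp] theorem strandLift_cons {P : Type*} [AddCommGroup P] [Module k P] {n : ℕ} {X Y Z : D}
    (F : ∀ Z, (Z ⟶ X) ⊗[k] strand k n Z Y →ₗ[k] P) (t : (Z ⟶ X) ⊗[k] strand k n Z Y) :
    strandLift F (strandCons n X Z Y t) = F Z t :=
  open Classical in
  DirectSum.toModule_lof _ _ _

/-- The diagonal action of `H` on `strand k n X Y`. -/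
noncomputable def strandAct [HCategory k H D] :
    ∀ (n : ℕ) (X Y : D), H →ₐ[k] Module.End k (strand k n X Y)
  | 0, X, Y => HCategory.act (k := k) Y X
  | n + 1, X, Y => sumAct fun Z => diagAct (HCategory.act Z X) (strandAct n Z Y)

/-- The action of `H` on the first tensor factor of `strand k n X Y`. -/
noncomputable def strandActHead [HCategory k H D] :
    ∀ (n : ℕ) (X Y : D), H →ₐ[k] Module.End k (strand k n X Y)
  | 0, X, Y => HCategory.act (k := k) Y X
  | _ + 1, X, _ => sumAct fun Z =>
      (Module.End.rTensorAlgHom k _ _).comp (HCategory.act (k := k) Z X)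

/-- `g ⊗ (f⁰ ⊗ f¹ ⊗ ... ⊗ fⁿ) ↦ g f⁰ ⊗ f¹ ⊗ ... ⊗ fⁿ`. -/
noncomputable def strandComp : ∀ (n : ℕ) (X Z Y : D),
    (Z ⟶ X) ⊗[k] strand k n Z Y →ₗ[k] strand k n X Y
  | 0, X, Z, Y => (strandOne X Y).toLinearMap ∘ₗ compMap k Y Z X ∘ₗ
      (strandOne Z Y).symm.toLinearMap.lTensor (Z ⟶ X)
  | n + 1, X, Z, Y => sumRight fun W => strandCons n X W Y ∘ₗ
      (compMap k W Z X).rTensor (strand k n W Y) ∘ₗ (TensorProduct.assoc k _ _ _).symm.toLinearMap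

/-- `f⁰ ⊗ ... ⊗ fⁿ⁺¹ ↦ f⁰ ⊗ ... ⊗ fⁱ fⁱ⁺¹ ⊗ ... ⊗ fⁿ⁺¹` for `0 ≤ i ≤ n`. -/
noncomputable def strandFace : ∀ (n : ℕ), Fin (n + 1) → ∀ (X Y : D),
    strand k (n + 1) X Y →ₗ[k] strand k n X Y
  | 0, _, X, Y => strandLift fun Z => strandComp 0 X Z Y
  | n + 1, i, X, Y => Fin.cases (strandLift fun Z => strandComp (n + 1) X Z Y)
      (fun j => strandLift fun Z =>
        strandCons n X Z Y ∘ₗ (strandFace n j Z Y).lTensor (Z ⟶ X)) i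

/-- Splitting off the last factor: `f⁰ ⊗ ... ⊗ fⁿ⁺¹ ↦ (f⁰ ⊗ ... ⊗ fⁿ) ⊗ fⁿ⁺¹`. -/
noncomputable def strandUnsnoc : ∀ (n : ℕ) (X Y : D),
    strand k (n + 1) X Y →ₗ[k] ⨁ Z : D, (strand k n X Z ⊗[k] (Y ⟶ Z))
  | 0, X, Y => open Classical in
      strandLift fun Z => DirectSum.lof k D (fun Z => strand k 0 X Z ⊗[k] (Y ⟶ Z)) Z ∘ₗ
        TensorProduct.map (strandOne X Z).toLinearMap (strandOne Z Y).symm.toLinearMap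
  | n + 1, X, Y => open Classical in
      strandLift fun Z => sumRight (fun W =>
        DirectSum.lof k D (fun W => strand k (n + 1) X W ⊗[k] (Y ⟶ W)) W ∘ₗ
        (strandCons n X Z W).rTensor (Y ⟶ W) ∘ₗ
        (TensorProduct.assoc k _ _ _).symm.toLinearMap) ∘ₗ (strandUnsnoc n Z Y).lTensor (Z ⟶ X)

variable (k D) in
/-- `CNₙ(D) = ⨁ Hom(X₁, X₀) ⊗ Hom(X₂, X₁) ⊗ ... ⊗ Hom(X₀, Xₙ)`. -/
def CN (n : ℕ) : Type u := ⨁ X : D, strand k n X X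

noncomputable instance (n : ℕ) : AddCommGroup (CN k D n) :=
  inferInstanceAs (AddCommGroup (⨁ X : D, strand k n X X))

noncomputable instance (n : ℕ) : Module k (CN k D n) :=
  inferInstanceAs (Module k (⨁ X : D, strand k n X X))

/-- The inclusion of the summands with given `X₀`. -/
noncomputable def CN.of (n : ℕ) (X : D) : strand k n X X →ₗ[k] CN k D n :=
  open Classical in
  DirectSum.lof k D (fun X => strand k n X X) X

/-- The linear map out of `CNₙ(D)` with given components. -/
noncomputable def CN.lift {P : Type*} [AddCommGroup P] [Module k P] {n : ℕ}
    (F : ∀ X : D, strand k n X X →ₗ[k] P) : CN k D n →ₗ[k] P :=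
  open Classical in
  DirectSum.toModule k D P F

@[simp] theorem CN.lift_of {P : Type*} [AddCommGroup P] [Module k P] {n : ℕ}
    (F : ∀ X : D, strand k n X X →ₗ[k] P) (X : D) (t : strand k n X X) :
    CN.lift F (CN.of n X t) = F X t :=
  open Classical in
  DirectSum.toModule_lof (R := k) (ι := D) (M := fun X => strand k n X X) (N := P) (φ := F) X t

/-- The diagonal action of `H` on `CNₙ(D)`. -/
noncomputable def CN.act [HCategory k H D] (n : ℕ) : H →ₐ[k] Module.End k (CN k D n) :=
  sumAct fun X => strandAct n X X

/-- The action of `H` on the first tensor factor of `CNₙ(D)`. -/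
noncomputable def CN.actHead [HCategory k H D] (n : ℕ) : H →ₐ[k] Module.End k (CN k D n) :=
  sumAct fun X => strandActHead n X X

/-- `f⁰ ⊗ ... ⊗ fⁿ ↦ fⁿ ⊗ f⁰ ⊗ ... ⊗ fⁿ⁻¹`. -/
noncomputable def CN.rotate : ∀ n : ℕ, CN k D n →ₗ[k] CN k D n
  | 0 => LinearMap.id
  | n + 1 => open Classical in
      CN.lift fun X => (DirectSum.toModule k D _ fun Z =>
        CN.of (n + 1) Z ∘ₗ strandCons n Z X Z ∘ₗ
          (TensorProduct.comm k (strand k n X Z) (X ⟶ Z)).toLinearMap) ∘ₗ strandUnsnoc n X X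

/-- `f⁰ ⊗ ... ⊗ fⁿ⁺¹ ↦ f⁰ ⊗ ... ⊗ fⁱ fⁱ⁺¹ ⊗ ... ⊗ fⁿ⁺¹` for `0 ≤ i ≤ n`. -/
noncomputable def CN.face (n : ℕ) (i : Fin (n + 1)) : CN k D (n + 1) →ₗ[k] CN k D n :=
  CN.lift fun X => CN.of n X ∘ₗ strandFace n i X X

end Strands

section Cohomology

universe u

/-- The antipode of `H` is bijective. -/
class BijectiveAntipode (k H : Type*) [Field k] [Ring H] [HopfAlgebra k H] : Prop where
  bijective : Function.Bijective (HopfAlgebra.antipode k (A := H))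

/-- The inverse `S⁻¹` of the antipode. -/
noncomputable def antipodeInv (k H : Type*) [Field k] [Ring H] [HopfAlgebra k H]
    [BijectiveAntipode k H] : H →ₗ[k] H :=
  (LinearEquiv.ofBijective (HopfAlgebra.antipode k (A := H))
    BijectiveAntipode.bijective).symm.toLinearMap

variable {k H M : Type*} [Field k] [Ring H] [HopfAlgebra k H] [AddCommGroup M] [Module k M]
  {A : Type*} [AddCommGroup A] [Module k A]

/-- The right action `(m ⊗ a) h = m h₁ ⊗ S(h₂) a` of `H` on `M ⊗ A`, for a left `H`-module `A`. -/
noncomputable def twistedRact (𝓜 : SAYDModule k H M) (a : H →ₐ[k] Module.End k A) :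
    H →ₗ[k] Module.End k (M ⊗[k] A) :=
  pairAct 𝓜.ract (a.toLinearMap ∘ₗ HopfAlgebra.antipode k) ∘ₗ comul

/-- The map `m ⊗ a ↦ m₍₀₎ ⊗ S⁻¹(m₍₋₁₎) a` on `M ⊗ A`, for an action of `H` on `A`. -/
noncomputable def coTwist [BijectiveAntipode k H] (𝓜 : SAYDModule k H M)
    (a : H →ₐ[k] Module.End k A) : M ⊗[k] A →ₗ[k] M ⊗[k] A :=
  (TensorProduct.lift (a.toLinearMap ∘ₗ antipodeInv k H)).lTensor M ∘ₗ
    (TensorProduct.assoc k M H A).toLinearMap ∘ₗ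
    ((TensorProduct.comm k H M).toLinearMap ∘ₗ 𝓜.coact).rTensor A

/-- The quotient `Z / (B ∩ Z)` of subspaces of a vector space. -/
abbrev Subquotient {V : Type*} [AddCommGroup V] [Module k V] (Z B : Submodule k V) :=
  Z ⧸ B.submoduleOf Z

/-- The class in `Z / (B ∩ Z)` of an element of `Z`. -/
noncomputable def Subquotient.mk {V : Type*} [AddCommGroup V] [Module k V]
    (Z B : Submodule k V) : Z →ₗ[k] Subquotient Z B :=
  (B.submoduleOf Z).mkQ

variable (𝓜 : SAYDModule k H M) (D : Type u) [SmallCategory D] [Preadditive D] [Linear k D]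
  [HCategory k H D]

/-- The operator
`m ⊗ f⁰ ⊗ ... ⊗ fⁿ ↦ m₍₀₎ ⊗ S⁻¹(m₍₋₁₎) fⁿ ⊗ f⁰ ⊗ ... ⊗ fⁿ⁻¹` on `M ⊗ CNₙ(D)`. -/
noncomputable def cyclicOp [BijectiveAntipode k H] (n : ℕ) :
    M ⊗[k] CN k D n →ₗ[k] M ⊗[k] CN k D n :=
  coTwist 𝓜 (CN.actHead n) ∘ₗ (CN.rotate n).lTensor M

/-- The face maps `M ⊗ CNₙ₊₁(D) → M ⊗ CNₙ(D)`: for `i ≤ n` the `i`-th one multiplies `fⁱ` and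
`fⁱ⁺¹`, and the last one sends `m ⊗ f⁰ ⊗ ... ⊗ fⁿ⁺¹` to
`m₍₀₎ ⊗ (S⁻¹(m₍₋₁₎) fⁿ⁺¹) f⁰ ⊗ f¹ ⊗ ... ⊗ fⁿ`. -/
noncomputable def faceOp [BijectiveAntipode k H] (n : ℕ) (i : Fin (n + 2)) :
    M ⊗[k] CN k D (n + 1) →ₗ[k] M ⊗[k] CN k D n :=
  Fin.lastCases (motive := fun _ => M ⊗[k] CN k D (n + 1) →ₗ[k] M ⊗[k] CN k D n)
    ((CN.face n 0).lTensor M ∘ₗ cyclicOp 𝓜 D (n + 1))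
    (fun j => (CN.face n j).lTensor M) i

/-- `Cⁿ(D, M) = Hom_k(M ⊗ CNₙ(D), k)`. (Only the underlying space of `M` matters here.) -/
abbrev Cochain (_ : SAYDModule k H M) (D : Type u) [SmallCategory D] [Preadditive D]
    [Linear k D] (n : ℕ) :=
  M ⊗[k] CN k D n →ₗ[k] k

/-- The Hochschild differential `b = ∑ (-1)ⁱ δᵢ`, where `δᵢ φ = φ ∘ dᵢ`. -/
noncomputable def hochschild [BijectiveAntipode k H] (n : ℕ) :
    Cochain 𝓜 D n →ₗ[k] Cochain 𝓜 D (n + 1) :=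
  ∑ i : Fin (n + 2), (-1 : k) ^ (i : ℕ) • LinearMap.lcomp k k (faceOp 𝓜 D n i)

/-- The signed cyclic operator `λₙ φ = (-1)ⁿ φ ∘ tₙ`. -/
noncomputable def cyclicSigned [BijectiveAntipode k H] (n : ℕ) :
    Cochain 𝓜 D n →ₗ[k] Cochain 𝓜 D n :=
  (-1 : k) ^ n • LinearMap.lcomp k k (cyclicOp 𝓜 D n)

/-- `Cⁿ_H(D, M) = Hom_H(M ⊗ CNₙ(D), k)`: the `φ` with
`φ(m h₁ ⊗ S(h₂)(f⁰ ⊗ ... ⊗ fⁿ)) = ε(h) φ(m ⊗ f⁰ ⊗ ... ⊗ fⁿ)`. -/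
def invariantCochains (n : ℕ) : Submodule k (Cochain 𝓜 D n) where
  carrier := {φ | ∀ (h : H) x, φ (twistedRact 𝓜 (CN.act n) h x) = counit (R := k) h * φ x}
  zero_mem' := by simp
  add_mem' := by
    intro φ ψ hφ hψ h x
    rw [LinearMap.add_apply, LinearMap.add_apply, hφ, hψ, mul_add]
  smul_mem' := by
    intro c φ hφ h x
    rw [LinearMap.smul_apply, LinearMap.smul_apply, hφ, smul_eq_mul, smul_eq_mul, mul_left_comm]

/-- The cyclic cochains `Ker(1 - λ)` in `Cⁿ_H(D, M)`. -/
noncomputable def cyclicCochains [BijectiveAntipode k H] (n : ℕ) : Submodule k (Cochain 𝓜 D n) :=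
  invariantCochains 𝓜 D n ⊓ LinearMap.ker (LinearMap.id - cyclicSigned 𝓜 D n)

/-- The cyclic cocycles `Zⁿ_H(D, M)`. -/
noncomputable def cocycles [BijectiveAntipode k H] (n : ℕ) : Submodule k (Cochain 𝓜 D n) :=
  cyclicCochains 𝓜 D n ⊓ LinearMap.ker (hochschild 𝓜 D n)

/-- The cyclic coboundaries `Bⁿ_H(D, M)`. -/
noncomputable def coboundaries [BijectiveAntipode k H] : ∀ n : ℕ, Submodule k (Cochain 𝓜 D n)
  | 0 => ⊥
  | n + 1 => (cyclicCochains 𝓜 D n).map (hochschild 𝓜 D n)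

/-- The Hopf-cyclic cohomology `HCⁿ_H(D, M) = Zⁿ_H(D, M) / Bⁿ_H(D, M)`. -/
abbrev HC [BijectiveAntipode k H] (n : ℕ) :=
  Subquotient (cocycles 𝓜 D n) (coboundaries 𝓜 D n)

/-- The class in `HCⁿ_H(D, M)` of a cocycle. -/
noncomputable def HC.mk [BijectiveAntipode k H] (n : ℕ) :
    cocycles 𝓜 D n →ₗ[k] HC 𝓜 D n :=
  Subquotient.mk (cocycles 𝓜 D n) (coboundaries 𝓜 D n)

end Cohomology

section Cycles

universe u u' w v w' v'

set_option linter.checkUnivs false in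
/-- A left DGH-semicategory over `H`: a `k`-linear semicategory (identities are not required to
exist) whose morphism spaces are cochain complexes `Homⁿ(X, Y)`, `n ≥ 0`, of left `H`-modules, with
composition a morphism of complexes satisfying `h (g f) = (h₁ g) (h₂ f)`. The degree of the target
of a composition or of the differential is a separate variable `n` with a proof `h` that it is
the right one. -/
structure DGHSemicat (k H : Type*) [Field k] [Ring H] [HopfAlgebra k H] where
  Ob : Type w
  Hom : ℕ → Ob → Ob → Type v
  [addCommGroup : ∀ n X Y, AddCommGroup (Hom n X Y)]
  [module : ∀ n X Y, Module k (Hom n X Y)]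
  comp : ∀ {i j n : ℕ} (_ : i + j = n) (X Y Z : Ob), Hom i Y Z ⊗[k] Hom j X Y →ₗ[k] Hom n X Z
  assoc : ∀ {i j l a b n : ℕ} (ha : i + j = a) (hb : j + l = b) (h₁ : a + l = n) (h₂ : i + b = n)
    {W X Y Z : Ob} (p : Hom i Y Z) (g : Hom j X Y) (f : Hom l W X),
    comp h₁ W X Z (comp ha X Y Z (p ⊗ₜ g) ⊗ₜ f) = comp h₂ W Y Z (p ⊗ₜ comp hb W X Y (g ⊗ₜ f))
  d : ∀ {i n : ℕ} (_ : i + 1 = n) (X Y : Ob), Hom i X Y →ₗ[k] Hom n X Y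
  d_d : ∀ {i j n : ℕ} (h : i + 1 = j) (h' : j + 1 = n) {X Y : Ob} (f : Hom i X Y),
    d h' X Y (d h X Y f) = 0
  leibniz : ∀ {i j n i' j' n' : ℕ} (h : i + j = n) (hi : i + 1 = i') (hj : j + 1 = j')
    (hn : n + 1 = n') (h₁ : i' + j = n') (h₂ : i + j' = n') {X Y Z : Ob}
    (g : Hom i Y Z) (f : Hom j X Y),
    d hn X Z (comp h X Y Z (g ⊗ₜ f)) = comp h₁ X Y Z (d hi Y Z g ⊗ₜ f) +
      (-1 : k) ^ i • comp h₂ X Y Z (g ⊗ₜ d hj X Y f)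
  act : ∀ (n : ℕ) (X Y : Ob), H →ₐ[k] Module.End k (Hom n X Y)
  act_comp : ∀ {i j n : ℕ} (h : i + j = n) (X Y Z : Ob) (a : H) (t : Hom i Y Z ⊗[k] Hom j X Y),
    act n X Z a (comp h X Y Z t) = comp h X Y Z (diagAct (act i Y Z) (act j X Y) a t)
  act_d : ∀ {i n : ℕ} (h : i + 1 = n) (X Y : Ob) (a : H) (f : Hom i X Y),
    act n X Y a (d h X Y f) = d h X Y (act i X Y a f)

attribute [instance] DGHSemicat.addCommGroup DGHSemicat.module

variable {k H : Type*} [Field k] [Ring H] [HopfAlgebra k H]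

/-- An `H`-linear semifunctor from an `H`-category `D` to the degree `0` part of `S`. -/
structure HSemifunctor (D : Type u) [SmallCategory D] [Preadditive D] [Linear k D]
    [HCategory k H D] (S : DGHSemicat.{w, v} k H) where
  obj : D → S.Ob
  map : ∀ X Y : D, (X ⟶ Y) →ₗ[k] S.Hom 0 (obj X) (obj Y)
  map_comp : ∀ {X Y Z : D} (g : Y ⟶ Z) (f : X ⟶ Y),
    map X Z (f ≫ g) = S.comp (add_zero 0) (obj X) (obj Y) (obj Z) (map Y Z g ⊗ₜ map X Y f)
  map_act : ∀ {X Y : D} (h : H) (f : X ⟶ Y),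
    map X Y (HCategory.act (k := k) X Y h f) = S.act 0 (obj X) (obj Y) h (map X Y f)

section Trace

variable {M : Type*} [AddCommGroup M] [Module k M]

/-- The conditions on a family `T_X : M ⊗ Homⁿ(X, X) → k` to be a closed graded `(H, M)`-trace of
dimension `n`. -/
structure IsClosedGradedTrace [BijectiveAntipode k H] (𝓜 : SAYDModule k H M)
    (S : DGHSemicat.{w, v} k H) (n : ℕ) (T : ∀ X : S.Ob, M ⊗[k] S.Hom n X X →ₗ[k] k) : Prop where
  /-- `T_X(m h₁ ⊗ S(h₂) f) = ε(h) T_X(m ⊗ f)` -/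
  invariant : ∀ (X : S.Ob) (h : H) (x : M ⊗[k] S.Hom n X X),
    T X (twistedRact 𝓜 (S.act n X X) h x) = counit (R := k) h * T X x
  /-- `T_X(m ⊗ d f') = 0` -/
  closed : ∀ {i : ℕ} (h : i + 1 = n) (X : S.Ob) (m : M) (f : S.Hom i X X),
    T X (m ⊗ₜ S.d h X X f) = 0
  /-- `T_X(m ⊗ g' g) = (-1)^{ij} T_Y(m₍₀₎ ⊗ (S⁻¹(m₍₋₁₎) g) g')` for `g : X → Y` of degree `i` and
  `g' : Y → X` of degree `j` -/
  graded : ∀ {i j : ℕ} (h : j + i = n) (h' : i + j = n) (X Y : S.Ob) (m : M)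
    (g : S.Hom i X Y) (g' : S.Hom j Y X),
    T X (m ⊗ₜ S.comp h X Y X (g' ⊗ₜ g)) = (-1 : k) ^ (i * j) *
      T Y ((S.comp h' Y X Y ∘ₗ (TensorProduct.mk k (S.Hom i X Y) (S.Hom j Y X)).flip g').lTensor M
        (coTwist 𝓜 (S.act i X Y) (m ⊗ₜ g)))

variable {D : Type u} [SmallCategory D] [Preadditive D] [Linear k D] [HCategory k H D]

/-- `f¹ ⊗ ... ⊗ fⁿ⁺¹ ↦ d(ρ f¹) ... d(ρ fⁿ⁺¹)`. -/
noncomputable def HSemifunctor.dword {S : DGHSemicat.{w, v} k H} (ρ : HSemifunctor D S) :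
    ∀ (n : ℕ) (X Y : D), strand k n X Y →ₗ[k] S.Hom (n + 1) (ρ.obj Y) (ρ.obj X)
  | 0, X, Y => S.d (zero_add 1) (ρ.obj Y) (ρ.obj X) ∘ₗ ρ.map Y X ∘ₗ
      (strandOne X Y).symm.toLinearMap
  | n + 1, X, Y => strandLift fun Z =>
      S.comp (Nat.add_comm 1 (n + 1)) (ρ.obj Y) (ρ.obj Z) (ρ.obj X) ∘ₗ
        TensorProduct.map (S.d (zero_add 1) (ρ.obj Z) (ρ.obj X) ∘ₗ ρ.map Z X) (ρ.dword n Z Y)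

/-- `f⁰ ⊗ f¹ ⊗ ... ⊗ fⁿ ↦ (ρ f⁰) d(ρ f¹) ... d(ρ fⁿ)`. -/
noncomputable def HSemifunctor.word {S : DGHSemicat.{w, v} k H} (ρ : HSemifunctor D S) :
    ∀ (n : ℕ) (X Y : D), strand k n X Y →ₗ[k] S.Hom n (ρ.obj Y) (ρ.obj X)
  | 0, X, Y => ρ.map Y X ∘ₗ (strandOne X Y).symm.toLinearMap
  | n + 1, X, Y => strandLift fun Z =>
      S.comp (Nat.zero_add (n + 1)) (ρ.obj Y) (ρ.obj Z) (ρ.obj X) ∘ₗ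
        TensorProduct.map (ρ.map Z X) (ρ.dword n Z Y)

set_option linter.checkUnivs false in
variable (D) in
/-- An `n`-dimensional cycle over `D` with coefficients in `M`. -/
structure CycleOver [BijectiveAntipode k H] (𝓜 : SAYDModule k H M) (n : ℕ) where
  S : DGHSemicat.{w, v} k H
  T : ∀ X : S.Ob, M ⊗[k] S.Hom n X X →ₗ[k] k
  isTrace : IsClosedGradedTrace 𝓜 S n T
  ρ : HSemifunctor D S

/-- The character of a cycle:
`m ⊗ f⁰ ⊗ ... ⊗ fⁿ ↦ T(m ⊗ (ρ f⁰) d(ρ f¹) ... d(ρ fⁿ))`. -/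
noncomputable def CycleOver.character [BijectiveAntipode k H] {𝓜 : SAYDModule k H M} {n : ℕ}
    (C : CycleOver.{u, w, v} D 𝓜 n) : Cochain 𝓜 D n :=
  TensorProduct.lift (LinearMap.flip (CN.lift fun X =>
    (TensorProduct.curry (C.T (C.ρ.obj X) ∘ₗ (C.ρ.word n X X).lTensor M)).flip))

end Trace

namespace DGHSemicat

variable (S : DGHSemicat.{w, v} k H) (S' : DGHSemicat.{w', v'} k H)

/-- `⨁_{i+j=n} Homⁱ(X, Y) ⊗ Homʲ(X', Y')`. -/
def THom (n : ℕ) (X Y : S.Ob × S'.Ob) : Type (max v v') :=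
  ⨁ ij : Finset.HasAntidiagonal.antidiagonal n, S.Hom ij.1.1 X.1 Y.1 ⊗[k] S'.Hom ij.1.2 X.2 Y.2

noncomputable instance (n : ℕ) (X Y : S.Ob × S'.Ob) : AddCommGroup (S.THom S' n X Y) :=
  inferInstanceAs (AddCommGroup (⨁ _ : Finset.HasAntidiagonal.antidiagonal n, _))

noncomputable instance (n : ℕ) (X Y : S.Ob × S'.Ob) : Module k (S.THom S' n X Y) :=
  inferInstanceAs (Module k (⨁ _ : Finset.HasAntidiagonal.antidiagonal n, _))

variable {S S'}

/-- The inclusion of the summand with indices `i, j`. -/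
noncomputable def incl {i j n : ℕ} (h : i + j = n) (X Y : S.Ob × S'.Ob) :
    S.Hom i X.1 Y.1 ⊗[k] S'.Hom j X.2 Y.2 →ₗ[k] S.THom S' n X Y :=
  DirectSum.lof k (Finset.HasAntidiagonal.antidiagonal n)
    (fun ij => S.Hom ij.1.1 X.1 Y.1 ⊗[k] S'.Hom ij.1.2 X.2 Y.2)
    ⟨(i, j), Finset.HasAntidiagonal.mem_antidiagonal.mpr h⟩

/-- The linear map out of `THom` with given components. -/
noncomputable def tlift {P : Type*} [AddCommGroup P] [Module k P] {n : ℕ} {X Y : S.Ob × S'.Ob}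
    (F : ∀ i j, i + j = n → S.Hom i X.1 Y.1 ⊗[k] S'.Hom j X.2 Y.2 →ₗ[k] P) :
    S.THom S' n X Y →ₗ[k] P :=
  DirectSum.toModule k (Finset.HasAntidiagonal.antidiagonal n) P
    fun ij => F ij.1.1 ij.1.2 (Finset.HasAntidiagonal.mem_antidiagonal.mp ij.2)

@[simp] theorem tlift_incl {P : Type*} [AddCommGroup P] [Module k P] {i j n : ℕ}
    {X Y : S.Ob × S'.Ob} (F : ∀ i j, i + j = n → S.Hom i X.1 Y.1 ⊗[k] S'.Hom j X.2 Y.2 →ₗ[k] P)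
    (h : i + j = n) (x : S.Hom i X.1 Y.1 ⊗[k] S'.Hom j X.2 Y.2) :
    tlift F (incl h X Y x) = F i j h x :=
  DirectSum.toModule_lof (R := k) (ι := Finset.HasAntidiagonal.antidiagonal n)
    (M := fun ij => S.Hom ij.1.1 X.1 Y.1 ⊗[k] S'.Hom ij.1.2 X.2 Y.2) (N := P)
    (φ := fun ij => F ij.1.1 ij.1.2 (Finset.HasAntidiagonal.mem_antidiagonal.mp ij.2))
    ⟨(i, j), Finset.HasAntidiagonal.mem_antidiagonal.mpr h⟩ x

theorem THom.induction {n : ℕ} {X Y : S.Ob × S'.Ob} {motive : S.THom S' n X Y → Prop}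
    (x : S.THom S' n X Y) (zero : motive 0) (add : ∀ x y, motive x → motive y → motive (x + y))
    (incl_tmul : ∀ (i j : ℕ) (h : i + j = n) (f : S.Hom i X.1 Y.1) (f' : S'.Hom j X.2 Y.2),
      motive (incl h X Y (f ⊗ₜ f'))) : motive x := by
  have key : ∀ x : (⨁ ij : Finset.HasAntidiagonal.antidiagonal n,
      S.Hom ij.1.1 X.1 Y.1 ⊗[k] S'.Hom ij.1.2 X.2 Y.2), motive x := by
    intro x
    induction x using DirectSum.induction_on with
    | zero => exact zero
    | add x y hx hy => exact add x y hx hy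
    | of ij y =>
      induction y with
      | zero => rw [map_zero]; exact zero
      | add x y hx hy => rw [map_add]; exact add _ _ hx hy
      | tmul f f' => exact incl_tmul ij.1.1 ij.1.2 (Finset.HasAntidiagonal.mem_antidiagonal.mp ij.2) f f'
  exact key x

/-- Composition in `S ⊗ S'`: `(g ⊗ g') (f ⊗ f') = (-1)^{deg g' deg f} g f ⊗ g' f'`. -/
noncomputable def tcomp {m l n : ℕ} (h : m + l = n) (X Y Z : S.Ob × S'.Ob) :
    S.THom S' m Y Z ⊗[k] S.THom S' l X Y →ₗ[k] S.THom S' n X Z :=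
  TensorProduct.lift (tlift fun i i' hi => LinearMap.flip (tlift fun j j' hj =>
    LinearMap.flip (TensorProduct.curry ((-1 : k) ^ (i' * j) •
      incl (S := S) (S' := S') (i := i + j) (j := i' + j') (by omega) X Z ∘ₗ
      TensorProduct.map (S.comp rfl X.1 Y.1 Z.1) (S'.comp rfl X.2 Y.2 Z.2) ∘ₗ
      (TensorProduct.tensorTensorTensorComm k (S.Hom i Y.1 Z.1) (S'.Hom i' Y.2 Z.2)
        (S.Hom j X.1 Y.1) (S'.Hom j' X.2 Y.2)).toLinearMap))))

theorem tcomp_incl {i i' j j' m l n a b : ℕ} (hi : i + i' = m) (hj : j + j' = l) (h : m + l = n)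
    (ha : i + j = a) (hb : i' + j' = b) (hn : a + b = n) {X Y Z : S.Ob × S'.Ob}
    (g : S.Hom i Y.1 Z.1) (g' : S'.Hom i' Y.2 Z.2) (f : S.Hom j X.1 Y.1) (f' : S'.Hom j' X.2 Y.2) :
    tcomp h X Y Z (incl hi Y Z (g ⊗ₜ g') ⊗ₜ incl hj X Y (f ⊗ₜ f')) =
      (-1 : k) ^ (i' * j) •
        incl hn X Z (S.comp ha X.1 Y.1 Z.1 (g ⊗ₜ f) ⊗ₜ S'.comp hb X.2 Y.2 Z.2 (g' ⊗ₜ f')) := by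
  subst ha hb
  simp [tcomp]

/-- The differential of `S ⊗ S'`: `d(f ⊗ f') = d f ⊗ f' + (-1)^{deg f} f ⊗ d f'`. -/
noncomputable def tdiff {m n : ℕ} (h : m + 1 = n) (X Y : S.Ob × S'.Ob) :
    S.THom S' m X Y →ₗ[k] S.THom S' n X Y :=
  tlift fun i j hij =>
    incl (i := i + 1) (j := j) (by omega) X Y ∘ₗ (S.d rfl X.1 Y.1).rTensor (S'.Hom j X.2 Y.2) +
    (-1 : k) ^ i • incl (i := i) (j := j + 1) (by omega) X Y ∘ₗ
      (S'.d rfl X.2 Y.2).lTensor (S.Hom i X.1 Y.1)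

theorem tdiff_incl {i j m n a b : ℕ} (hm : i + j = m) (h : m + 1 = n) (ha : i + 1 = a)
    (hb : j + 1 = b) (h₁ : a + j = n) (h₂ : i + b = n) {X Y : S.Ob × S'.Ob}
    (f : S.Hom i X.1 Y.1) (f' : S'.Hom j X.2 Y.2) :
    tdiff h X Y (incl hm X Y (f ⊗ₜ f')) = incl h₁ X Y (S.d ha X.1 Y.1 f ⊗ₜ f') +
      (-1 : k) ^ i • incl h₂ X Y (f ⊗ₜ S'.d hb X.2 Y.2 f') := by
  subst ha hb
  simp [tdiff]

/-- The diagonal action of `H` on `Homⁿ` of `S ⊗ S'`. -/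
noncomputable def tact (n : ℕ) (X Y : S.Ob × S'.Ob) : H →ₐ[k] Module.End k (S.THom S' n X Y) :=
  sumAct fun ij : Finset.HasAntidiagonal.antidiagonal n =>
    diagAct (S.act ij.1.1 X.1 Y.1) (S'.act ij.1.2 X.2 Y.2)

theorem tact_incl {i j n : ℕ} (h : i + j = n) (X Y : S.Ob × S'.Ob) (a : H)
    (x : S.Hom i X.1 Y.1 ⊗[k] S'.Hom j X.2 Y.2) :
    tact n X Y a (incl h X Y x) =
      incl h X Y (diagAct (S.act i X.1 Y.1) (S'.act j X.2 Y.2) a x) :=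
  sumAct_lof (fun ij : Finset.HasAntidiagonal.antidiagonal n =>
    diagAct (S.act ij.1.1 X.1 Y.1) (S'.act ij.1.2 X.2 Y.2)) a
    ⟨(i, j), Finset.HasAntidiagonal.mem_antidiagonal.mpr h⟩ x

/-- The tensor product `S ⊗ S'` of DGH-semicategories, for cocommutative `H`. -/
noncomputable def tensor [IsCocomm k H] (S : DGHSemicat.{w, v} k H)
    (S' : DGHSemicat.{w', v'} k H) : DGHSemicat.{max w w', max v v'} k H where
  Ob := S.Ob × S'.Ob
  Hom n X Y := S.THom S' n X Y
  comp h X Y Z := tcomp h X Y Z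
  assoc {i j l a b n} ha hb h₁ h₂ {W X Y Z} p g f := by
    induction p using THom.induction with
    | zero => simp only [TensorProduct.zero_tmul, map_zero]
    | add x y hx hy => simp only [TensorProduct.add_tmul, map_add, hx, hy]
    | incl_tmul i i' hi p p' =>
      induction g using THom.induction with
      | zero => simp only [TensorProduct.zero_tmul, TensorProduct.tmul_zero, map_zero]
      | add x y hx hy =>
        simp only [TensorProduct.add_tmul, TensorProduct.tmul_add, map_add, hx, hy]
      | incl_tmul j j' hj g g' =>
        induction f using THom.induction with
        | zero => simp only [TensorProduct.tmul_zero, map_zero]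
        | add x y hx hy => simp only [TensorProduct.tmul_add, map_add, hx, hy]
        | incl_tmul l l' hl f f' =>
          rw [tcomp_incl hi hj ha rfl rfl (by omega), tcomp_incl hj hl hb rfl rfl (by omega),
            TensorProduct.tmul_smul, ← TensorProduct.smul_tmul', map_smul, map_smul,
            tcomp_incl _ hl h₁ rfl rfl (by omega), tcomp_incl hi _ h₂ (add_assoc i j l).symm
              (add_assoc i' j' l').symm (by omega), S.assoc rfl rfl _ (add_assoc i j l).symm,
            S'.assoc rfl rfl _ (add_assoc i' j' l').symm, smul_smul, smul_smul]
          congr 1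
          ring
  d h X Y := tdiff h X Y
  d_d {_ _ _} h h' {X Y} f := by
    induction f using THom.induction with
    | zero => simp only [map_zero]
    | add x y hx hy => simp only [map_add, hx, hy, add_zero]
    | incl_tmul i j hij f f' =>
      rw [tdiff_incl hij h rfl rfl (by omega) (by omega), map_add, map_smul,
        tdiff_incl _ h' rfl rfl (by omega) (by omega),
        tdiff_incl _ h' rfl rfl (by omega) (by omega), S.d_d, S'.d_d, TensorProduct.zero_tmul,
        TensorProduct.tmul_zero, map_zero, map_zero, smul_zero, add_zero, zero_add, pow_succ,
        ← add_smul]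
      simp
  leibniz {i j n i' j' n'} h hi hj hn h₁ h₂ {X Y Z} g f := by
    induction g using THom.induction with
    | zero => simp only [TensorProduct.zero_tmul, map_zero, smul_zero, add_zero]
    | add x y hx hy =>
      simp only [TensorProduct.add_tmul, map_add, hx, hy, smul_add]
      abel
    | incl_tmul a a' ha g g' =>
      induction f using THom.induction with
      | zero => simp only [TensorProduct.tmul_zero, map_zero, smul_zero, add_zero]
      | add x y hx hy =>
        simp only [TensorProduct.tmul_add, map_add, hx, hy, smul_add]
        abel
      | incl_tmul b b' hb f f' =>
        rw [tcomp_incl ha hb h rfl rfl (by omega), map_smul,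
          tdiff_incl _ hn rfl rfl (by omega) (by omega),
          tdiff_incl ha hi rfl rfl (by omega) (by omega),
          tdiff_incl hb hj rfl rfl (by omega) (by omega),
          S.leibniz rfl rfl rfl rfl (by omega) (by omega),
          S'.leibniz rfl rfl rfl rfl (by omega) (by omega)]
        simp only [TensorProduct.add_tmul, TensorProduct.tmul_add, TensorProduct.tmul_smul,
          ← TensorProduct.smul_tmul', map_add, map_smul]
        rw [tcomp_incl _ hb h₁ (a := a + b + 1) (b := a' + b') (by omega) rfl (by omega),
          tcomp_incl _ hb h₁ (a := a + b) (b := a' + b' + 1) rfl (by omega) (by omega),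
          tcomp_incl ha _ h₂ (a := a + b + 1) (b := a' + b') (by omega) rfl (by omega),
          tcomp_incl ha _ h₂ (a := a + b) (b := a' + b' + 1) rfl (by omega) (by omega)]
        simp only [smul_add, smul_smul]
        have ei : (-1 : k) ^ i = (-1) ^ a * (-1) ^ a' := by rw [← ha, pow_add]
        have sq : (-1 : k) ^ a' * (-1) ^ a' = 1 := by rw [← mul_pow]; simp
        have e1 : (-1 : k) ^ a * (-1) ^ ((a' + 1) * b) = (-1) ^ (a' * b) * (-1) ^ (a + b) := by
          ring
        have e2 : (-1 : k) ^ i * (-1) ^ (a' * (b + 1)) = (-1) ^ (a' * b) * (-1) ^ a := by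
          rw [ei, mul_add, pow_add, mul_one]
          linear_combination (-1 : k) ^ a * (-1) ^ (a' * b) * sq
        have e3 : (-1 : k) ^ i * ((-1) ^ b * (-1) ^ (a' * b)) =
            (-1) ^ (a' * b) * ((-1) ^ (a + b) * (-1) ^ a') := by
          rw [ei]
          ring
        rw [e1, e2, e3]
        abel
  act n X Y := tact n X Y
  act_comp {i j n} h X Y Z a t := by
    induction t with
    | zero => simp only [map_zero]
    | add x y hx hy => simp only [map_add, hx, hy]
    | tmul g f =>
      induction g using THom.induction with
      | zero => simp only [TensorProduct.zero_tmul, map_zero]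
      | add x y hx hy => simp only [TensorProduct.add_tmul, map_add, hx, hy]
      | incl_tmul b b' hb g g' =>
        induction f using THom.induction with
        | zero => simp only [TensorProduct.tmul_zero, map_zero]
        | add x y hx hy => simp only [TensorProduct.tmul_add, map_add, hx, hy]
        | incl_tmul c c' hc f f' =>
          let F := tcomp (S := S) (S' := S') h X Y Z ∘ₗ
            TensorProduct.map (incl hb Y Z) (incl hc X Y)
          let G := (-1 : k) ^ (b' * c) • incl (S := S) (S' := S') (i := b + c) (j := b' + c')
            (n := n) (by omega) X Z ∘ₗ
            TensorProduct.map (S.comp rfl X.1 Y.1 Z.1) (S'.comp rfl X.2 Y.2 Z.2) ∘ₗ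
            (TensorProduct.tensorTensorTensorComm k (S.Hom b Y.1 Z.1) (S'.Hom b' Y.2 Z.2)
              (S.Hom c X.1 Y.1) (S'.Hom c' X.2 Y.2)).toLinearMap
          have hFG : F = G := by
            ext g g' f f'
            exact tcomp_incl hb hc h rfl rfl (by omega) g g' f f'
          have h1 : tcomp (S := S) (S' := S') h X Y Z
              (incl hb Y Z (g ⊗ₜ g') ⊗ₜ incl hc X Y (f ⊗ₜ f')) =
              F ((g ⊗ₜ g') ⊗ₜ (f ⊗ₜ f')) := rfl
          have h2 := TensorProduct.map_tmul (incl (S := S) (S' := S') hb Y Z)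
            (incl (S := S) (S' := S') hc X Y) (g ⊗ₜ[k] g') (f ⊗ₜ[k] f')
          rw [h1, ← h2, ← diagAct_map _ _ _ _ _ _ (fun h x => (tact_incl hb Y Z h x).symm)
            (fun h x => (tact_incl hc X Y h x).symm)]
          change tact n X Z a (F _) = F _
          rw [hFG]
          simp only [G, LinearMap.smul_apply, LinearMap.comp_apply, map_smul, tact_incl,
            LinearEquiv.coe_coe]
          rw [diagAct_middle, ← diagAct_map _ _ _ _ _ _
            (fun h x => (S.act_comp _ X.1 Y.1 Z.1 h x).symm)
            (fun h x => (S'.act_comp _ X.2 Y.2 Z.2 h x).symm)]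
  act_d {m n} h X Y a f := by
    induction f using THom.induction with
    | zero => simp only [map_zero]
    | add x y hx hy => simp only [map_add, hx, hy]
    | incl_tmul i j hij f f' =>
      have e : ∀ z : S.Hom i X.1 Y.1 ⊗[k] S'.Hom j X.2 Y.2,
          tdiff (S := S) (S' := S') h X Y (incl hij X Y z) =
          incl (i := i + 1) (j := j) (by omega) X Y
            (TensorProduct.map (S.d rfl X.1 Y.1) LinearMap.id z) +
          (-1 : k) ^ i • incl (i := i) (j := j + 1) (by omega) X Y
            (TensorProduct.map LinearMap.id (S'.d rfl X.2 Y.2) z) := by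
        intro z
        simp [tdiff, LinearMap.rTensor, LinearMap.lTensor]
      rw [tact_incl, e, e, map_add, map_smul, tact_incl, tact_incl,
        diagAct_map _ _ _ _ _ _ (fun h x => (S.act_d rfl X.1 Y.1 h x).symm) (fun _ _ => rfl),
        diagAct_map _ _ _ _ _ _ (fun _ _ => rfl) (fun h x => (S'.act_d rfl X.2 Y.2 h x).symm)]

/-- The projection of `Homⁿ` of `S ⊗ S'` to the summand with indices `i, j`. -/
noncomputable def tproj {S : DGHSemicat.{w, v} k H} {S' : DGHSemicat.{w', v'} k H} {i j n : ℕ}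
    (h : i + j = n) (X Y : S.Ob × S'.Ob) :
    S.THom S' n X Y →ₗ[k] S.Hom i X.1 Y.1 ⊗[k] S'.Hom j X.2 Y.2 :=
  DirectSum.component k (Finset.HasAntidiagonal.antidiagonal n)
    (fun ij => S.Hom ij.1.1 X.1 Y.1 ⊗[k] S'.Hom ij.1.2 X.2 Y.2)
    ⟨(i, j), Finset.HasAntidiagonal.mem_antidiagonal.mpr h⟩

end DGHSemicat

variable {D : Type u} [SmallCategory D] [Preadditive D] [Linear k D] [HCategory k H D]
  {D' : Type u'} [SmallCategory D'] [Preadditive D'] [Linear k D'] [HCategory k H D']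
  [IsCocomm k H]

/-- `f ⊗ f' ↦ (ρ f) ⊗ (ρ' f')`. -/
noncomputable def HSemifunctor.tmap {S : DGHSemicat.{w, v} k H} {S' : DGHSemicat.{w', v'} k H}
    (ρ : HSemifunctor D S) (ρ' : HSemifunctor D' S') (X Y : TensorCat k D D') :
    (X.fst ⟶ Y.fst) ⊗[k] (X.snd ⟶ Y.snd) →ₗ[k]
      S.THom S' 0 (ρ.obj X.fst, ρ'.obj X.snd) (ρ.obj Y.fst, ρ'.obj Y.snd) :=
  DGHSemicat.incl (add_zero 0) (ρ.obj X.fst, ρ'.obj X.snd) (ρ.obj Y.fst, ρ'.obj Y.snd) ∘ₗ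
    TensorProduct.map (ρ.map X.fst Y.fst) (ρ'.map X.snd Y.snd)

/-- The `H`-linear semifunctor `ρ ⊗ ρ'` from `D ⊗ D'` to the degree `0` part of `S ⊗ S'`. -/
noncomputable def HSemifunctor.tensor {S : DGHSemicat.{w, v} k H} {S' : DGHSemicat.{w', v'} k H}
    (ρ : HSemifunctor D S) (ρ' : HSemifunctor D' S') :
    HSemifunctor (TensorCat k D D') (S.tensor S') where
  obj X := (ρ.obj X.fst, ρ'.obj X.snd)
  map X Y := ρ.tmap ρ' X Y
  map_comp {X Y Z} g f := by
    have e : ∀ (g : (Y.fst ⟶ Z.fst) ⊗[k] (Y.snd ⟶ Z.snd))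
        (f : (X.fst ⟶ Y.fst) ⊗[k] (X.snd ⟶ Y.snd)),
        ρ.tmap ρ' X Z (TensorCat.compT X Y Z (g ⊗ₜ f)) =
        DGHSemicat.tcomp (add_zero 0) _ _ _ (ρ.tmap ρ' Y Z g ⊗ₜ ρ.tmap ρ' X Y f) := by
      intro g f
      induction g with
      | zero => simp
      | add x y hx hy => simp only [TensorProduct.add_tmul, map_add, hx, hy]
      | tmul g g' =>
        induction f with
        | zero => simp
        | add x y hx hy => simp only [TensorProduct.tmul_add, map_add, hx, hy]
        | tmul f f' =>
          simp only [HSemifunctor.tmap, LinearMap.comp_apply, TensorProduct.map_tmul,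
            TensorCat.compT_tmul, ρ.map_comp, ρ'.map_comp]
          rw [DGHSemicat.tcomp_incl (add_zero 0) (add_zero 0) (add_zero 0) (add_zero 0)
            (add_zero 0) (add_zero 0)]
          simp
    exact e g f
  map_act {X Y} h f := by
    have e : ∀ f : (X.fst ⟶ Y.fst) ⊗[k] (X.snd ⟶ Y.snd),
        ρ.tmap ρ' X Y (diagAct (HCategory.act X.fst Y.fst) (HCategory.act X.snd Y.snd) h f) =
        DGHSemicat.tact 0 _ _ h (ρ.tmap ρ' X Y f) := by
      intro f
      simp only [HSemifunctor.tmap, LinearMap.comp_apply]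
      rw [diagAct_map _ _ _ _ _ _ (fun h x => ρ.map_act h x) (fun h x => ρ'.map_act h x)]
      exact (DGHSemicat.tact_incl _ _ _ _ _).symm
    exact e f

variable {M M' : Type*} [AddCommGroup M] [Module k M] [AddCommGroup M'] [Module k M']

/-- The family `T # T'` on `S ⊗ S'`:
`(T # T')(m ⊗ m' ⊗ f ⊗ f') = T(m ⊗ f_p) T'(m' ⊗ f'_q)` for `m ⊗ m'` in `M □_H M'`. -/
noncomputable def traceTensor (𝓜 : SAYDModule k H M) (𝓜' : SAYDModule k H M')
    {S : DGHSemicat.{w, v} k H} {S' : DGHSemicat.{w', v'} k H} {p q : ℕ}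
    (T : ∀ X : S.Ob, M ⊗[k] S.Hom p X X →ₗ[k] k) (T' : ∀ X : S'.Ob, M' ⊗[k] S'.Hom q X X →ₗ[k] k)
    (X : (S.tensor S').Ob) :
    Cotensor 𝓜 𝓜' ⊗[k] (S.tensor S').Hom (p + q) X X →ₗ[k] k :=
  LinearMap.mul' k k ∘ₗ TensorProduct.map (T X.1) (T' X.2) ∘ₗ
    (TensorProduct.tensorTensorTensorComm k M M' (S.Hom p X.1 X.1)
      (S'.Hom q X.2 X.2)).toLinearMap ∘ₗ
    TensorProduct.map (Cotensor 𝓜 𝓜').subtype (DGHSemicat.tproj (S := S) (S' := S') rfl X X)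

/-- The tensor product `(S ⊗ S', d ⊗ d', T # T', ρ ⊗ ρ')` of two cycles, provided that `T # T'` is
a closed graded trace. -/
noncomputable def CycleOver.tensor [BijectiveAntipode k H] {𝓜 : SAYDModule k H M}
    {𝓜' : SAYDModule k H M'} (hsub : CotensorIsSubmodule 𝓜 𝓜') {p q : ℕ}
    (C : CycleOver.{u, w, v} D 𝓜 p) (C' : CycleOver.{u', w', v'} D' 𝓜' q)
    (h : IsClosedGradedTrace (𝓜.cotensor 𝓜' hsub) (C.S.tensor C'.S) (p + q)
      (traceTensor 𝓜 𝓜' C.T C'.T)) :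
    CycleOver.{max u u', max w w', max v v'} (TensorCat k D D') (𝓜.cotensor 𝓜' hsub) (p + q) where
  S := C.S.tensor C'.S
  T := traceTensor 𝓜 𝓜' C.T C'.T
  isTrace := h
  ρ := C.ρ.tensor C'.ρ

end Cycles

end HopfCyclic

open HopfCyclic

universe u u'

/-! Everything is read off from the universal differential forms `Om` of an `H`-category `D`. A form
of degree n is a word f⁰df¹…dfⁿ plus a word dg¹…dgⁿ, multiplied as the Leibniz rule dictates. A
cochain φ gives a functional `formTrace` on forms: evaluate φ on the words of the first kind, and
send the second kind, the exact words, to zero. Its twisted commutator with a morphism f of `D` is,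
up to sign, bφ on words of the first kind and φ − λφ on words of the second kind
(`formTrace_commutator_inl`, `formTrace_commutator_dform`). So φ is a cyclic cocycle exactly when it
is invariant and its functional commutes with morphisms of `D`. Since forms are generated from
morphisms by d and by left multiplication with morphisms, commuting with morphisms already makes the
functional a closed graded trace (`formTrace_mul_swap`). Every cocycle is therefore the character of
a cycle, `universalCycle`. Conversely a semifunctor `D → S⁰` extends to a map `Om.lift` from forms
to `S`, traces pull back along it, and so every character is a cocycle.

For the product, an element of M □_H M' allows the coaction of M to be traded for that of M'. With
coassociativity and cocommutativity, twisting g ⊗ g' by the coaction of M □_H M' becomes twisting g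
by M and g' by M' (`cotensorMiddle_coTwist`), and T # T' inherits the trace property from T and T'.
Pulling T # T' back along the maps from universal forms shows that the character of a product of
cycles depends only on the two characters (`character_prod`). The product of the universal cycles
thus serves as γ, bilinear because only the traces depend on the cocycles.

For coboundaries, let φ = bψ have degree p + 1 and let φ' have degree q. The functional τ = ψ # φ'
on the tensor product of forms is closed and invariant, and its commutator with a morphism F of `D ⊗
D'` is ±T(y Λ(dF)). Here T is the trace of the product cycle and Λ is the derivation multiplying
bidegree (i, j) by i. For τ to bound the character directly, ±T(y dF) would be needed instead. A map
K of degree one (`GradedDerivation.homotopy`), left linear over morphisms and with a prescribed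
defect of right linearity, corrects this. The functional (n + 1)τ − T∘K, with n = p + q, has
commutator ±T(Λ(y dF)) = ±(p + 1) T(y dF), since T only sees bidegree (p + 1, q). It comes from a
cyclic cochain whose Hochschild coboundary is (p + 1) times the character
(`CycleOver.character_mem_coboundaries`), and p + 1 is invertible in characteristic zero. The other
variable is treated with the second degree in place of the first. -/

namespace HopfCyclic

/-! ### The antipode and its inverse as coalgebra maps. -/

section Antipode

variable {k H : Type*} [Field k] [Ring H] [HopfAlgebra k H]

/-- The antipode of a cocommutative Hopf algebra is comultiplicative. -/
theorem comul_antipode [IsCocomm k H] (h : H) :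
    comul (R := k) (HopfAlgebra.antipode k h) =
      TensorProduct.map (HopfAlgebra.antipode k) (HopfAlgebra.antipode k) (comul (R := k) h) := by
  -- In the convolution algebra Hom(H, H ⊗ H), the map Δ∘S is a right inverse of Δ. Cocommutativity
  -- makes Δ a coalgebra map, so precomposing S * id = 1 on H ⊗ H with Δ exhibits (S ⊗ S)∘Δ as a
  -- left inverse, and the two inverses coincide.
  have hl : WithConv.toConv (TensorProduct.map (HopfAlgebra.antipode k (A := H))
      (HopfAlgebra.antipode k (A := H)) ∘ₗ comul (R := k)) *
      WithConv.toConv (comul (R := k) (A := H)) = 1 := by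
    have h1 := LinearMap.convMul_comp_coalgHom_distrib
      (WithConv.toConv (HopfAlgebra.antipode k (A := H ⊗[k] H)))
      (WithConv.toConv (LinearMap.id (R := k) (M := H ⊗[k] H))) (comulCoalgHom k H)
    rw [LinearMap.antipode_mul_id] at h1
    apply WithConv.ofConv_injective
    refine Eq.trans h1.symm ?_
    ext x
    simp [LinearMap.convOne_def]
  have := left_inv_eq_right_inv hl LinearMap.comul_right_inv
  exact (LinearMap.congr_fun (WithConv.toConv_injective this) h).symm

@[simp] theorem antipode_antipodeInv [BijectiveAntipode k H] (h : H) :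
    HopfAlgebra.antipode k (antipodeInv k H h) = h :=
  (LinearEquiv.ofBijective (HopfAlgebra.antipode k (A := H))
    BijectiveAntipode.bijective).apply_symm_apply h

@[simp] theorem antipodeInv_antipode [BijectiveAntipode k H] (h : H) :
    antipodeInv k H (HopfAlgebra.antipode k h) = h :=
  (LinearEquiv.ofBijective (HopfAlgebra.antipode k (A := H))
    BijectiveAntipode.bijective).symm_apply_apply h

theorem comul_antipodeInv [IsCocomm k H] [BijectiveAntipode k H] (h : H) :
    comul (R := k) (antipodeInv k H h) =
      TensorProduct.map (antipodeInv k H) (antipodeInv k H) (comul (R := k) h) := by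
  conv_rhs => rw [← antipode_antipodeInv (k := k) h, comul_antipode]
  have e : (antipodeInv k H) ∘ₗ HopfAlgebra.antipode k = LinearMap.id :=
    LinearMap.ext antipodeInv_antipode
  have e' := LinearMap.congr_fun (TensorProduct.map_comp (antipodeInv k H) (antipodeInv k H)
    (HopfAlgebra.antipode k (A := H)) (HopfAlgebra.antipode k (A := H)))
    (comul (R := k) (antipodeInv k H h))
  rw [LinearMap.comp_apply] at e'
  rw [← e', e, TensorProduct.map_id, LinearMap.id_apply]

end Antipode

/-! ### Twisting by the coaction of a SAYD module. -/

section Spread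

variable {k H M V W A B : Type*} [Field k] [Ring H] [HopfAlgebra k H]
  [AddCommGroup M] [Module k M] [AddCommGroup V] [Module k V] [AddCommGroup W] [Module k W]
  [AddCommGroup A] [Module k A] [AddCommGroup B] [Module k B]

/-- `m ↦ m₍₀₎ ⊗ u(m₍₋₁₎)`, linear in `u : H → V`. -/
noncomputable def spread (𝓜 : SAYDModule k H M) : (H →ₗ[k] V) →ₗ[k] M →ₗ[k] M ⊗[k] V :=
  (LinearMap.llcomp k M (H ⊗[k] M) (M ⊗[k] V)).flip 𝓜.coact ∘ₗ
    LinearMap.llcomp k (H ⊗[k] M) (V ⊗[k] M) (M ⊗[k] V) (TensorProduct.comm k V M).toLinearMap ∘ₗ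
    LinearMap.rTensorHom M

theorem spread_apply (𝓜 : SAYDModule k H M) (u : H →ₗ[k] V) (m : M) :
    spread 𝓜 u m = TensorProduct.comm k V M (u.rTensor M (𝓜.coact m)) := rfl

theorem lTensor_spread (𝓜 : SAYDModule k H M) (f : V →ₗ[k] W) (u : H →ₗ[k] V) (m : M) :
    f.lTensor M (spread 𝓜 u m) = spread 𝓜 (f ∘ₗ u) m := by
  rw [spread_apply, spread_apply]
  induction 𝓜.coact m with
  | zero => simp
  | add x y hx hy => simp only [map_add, hx, hy]
  | tmul x y => simp

/-- Coassociativity: the iterated coaction m₍₀₎₍₀₎ ⊗ w(m₍₋₁₎)(m₍₀₎₍₋₁₎) is a single coaction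
followed by the comultiplication of m₍₋₁₎. It turns two successive twists into one. -/
theorem lift_spread (𝓜 : SAYDModule k H M) (w : H →ₗ[k] H →ₗ[k] V) (m : M) :
    TensorProduct.lift (spread 𝓜 ∘ₗ w) (𝓜.coact m) =
      spread 𝓜 (TensorProduct.lift w ∘ₗ comul) m := by
  let F : H ⊗[k] (H ⊗[k] M) →ₗ[k] M ⊗[k] V :=
    (TensorProduct.comm k V M).toLinearMap ∘ₗ (TensorProduct.lift w).rTensor M ∘ₗ
      (TensorProduct.assoc k H H M).symm.toLinearMap
  have e1 : ∀ z : H ⊗[k] M, TensorProduct.lift (spread 𝓜 ∘ₗ w) z =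
      F (𝓜.coact.lTensor H z) := by
    intro z
    induction z with
    | zero => simp
    | add x y hx hy => simp only [map_add, hx, hy]
    | tmul x y =>
      simp only [TensorProduct.lift.tmul, LinearMap.comp_apply, spread_apply,
        LinearMap.lTensor_tmul]
      generalize 𝓜.coact y = t
      induction t with
      | zero => simp
      | add x y hx hy => simp only [map_add, TensorProduct.tmul_add, hx, hy]
      | tmul x y => simp [F]
  have e2 : ∀ z : H ⊗[k] M, F (TensorProduct.assoc k H H M (comul.rTensor M z)) =
      TensorProduct.comm k V M ((TensorProduct.lift w ∘ₗ comul).rTensor M z) := by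
    intro z
    simp only [F, LinearMap.comp_apply, LinearEquiv.coe_coe, LinearEquiv.symm_apply_apply,
      LinearMap.rTensor_comp]
  rw [e1, ← 𝓜.coassoc, e2, spread_apply]

variable [BijectiveAntipode k H]

/-- `h ↦ S⁻¹(h) x`. -/
noncomputable def orbit (a : H →ₐ[k] Module.End k A) : A →ₗ[k] H →ₗ[k] A :=
  (a.toLinearMap ∘ₗ antipodeInv k H).flip

@[simp] theorem orbit_apply (a : H →ₐ[k] Module.End k A) (x : A) (h : H) :
    orbit a x h = a (antipodeInv k H h) x := rfl

theorem coTwist_tmul (𝓜 : SAYDModule k H M) (a : H →ₐ[k] Module.End k A) (m : M) (x : A) :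
    coTwist 𝓜 a (m ⊗ₜ x) = spread 𝓜 (orbit a x) m := by
  rw [spread_apply]
  simp only [coTwist, LinearMap.comp_apply, LinearMap.rTensor_tmul, LinearEquiv.coe_coe]
  induction 𝓜.coact m with
  | zero => simp
  | add x y hx hy => simp only [map_add, TensorProduct.add_tmul, hx, hy]
  | tmul x y => simp

theorem diagAct_antipodeInv [IsCocomm k H] (a : H →ₐ[k] Module.End k A)
    (b : H →ₐ[k] Module.End k B) (x : A) (y : B) (h : H) :
    diagAct a b (antipodeInv k H h) (x ⊗ₜ y) =
      TensorProduct.map (orbit a x) (orbit b y) (comul (R := k) h) := by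
  rw [diagAct_apply, comul_antipodeInv]
  induction comul (R := k) h with
  | zero => simp
  | add s t hs ht => simp only [map_add, LinearMap.add_apply, hs, ht]
  | tmul s t => simp

/-- Cocommutativity allows the two entries of Δ(h) to be interchanged. This order is the one
produced by an iterated coaction in `tw_mul`, where the outer entry acts on the right-hand factor.
-/
theorem diagAct_antipodeInv_swap [IsCocomm k H] (a : H →ₐ[k] Module.End k A)
    (b : H →ₐ[k] Module.End k B) (x : A) (y : B) (h : H) :
    diagAct a b (antipodeInv k H h) (x ⊗ₜ y) =
      TensorProduct.map (orbit a x) (orbit b y)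
        (TensorProduct.comm k H H (comul (R := k) h)) := by
  rw [diagAct_antipodeInv, comm_comul]

end Spread

/-! ### Twisted actions on the cotensor product. -/

section Cotensor

variable {k H M M' A B : Type*} [Field k] [Ring H] [HopfAlgebra k H] [IsCocomm k H]
  [AddCommGroup M] [Module k M] [AddCommGroup M'] [Module k M']
  [AddCommGroup A] [Module k A] [AddCommGroup B] [Module k B]

/-- The inclusion of `(M □_H M') ⊗ (A ⊗ B)` in `(M ⊗ A) ⊗ (M' ⊗ B)`. -/
noncomputable def cotensorMiddle (𝓜 : SAYDModule k H M) (𝓜' : SAYDModule k H M')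
    (A B : Type*) [AddCommGroup A] [Module k A] [AddCommGroup B] [Module k B] :
    Cotensor 𝓜 𝓜' ⊗[k] (A ⊗[k] B) →ₗ[k] (M ⊗[k] A) ⊗[k] (M' ⊗[k] B) :=
  (TensorProduct.tensorTensorTensorComm k M M' A B).toLinearMap ∘ₗ
    (Cotensor 𝓜 𝓜').subtype.rTensor (A ⊗[k] B)

/-- On the cotensor product, the coaction acts on both factors at once. -/
theorem cotensorMiddle_coTwist [BijectiveAntipode k H] (𝓜 : SAYDModule k H M)
    (𝓜' : SAYDModule k H M') (hsub : CotensorIsSubmodule 𝓜 𝓜')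
    (a : H →ₐ[k] Module.End k A) (b : H →ₐ[k] Module.End k B)
    (z : Cotensor 𝓜 𝓜') (x : A) (y : B) :
    cotensorMiddle 𝓜 𝓜' A B (coTwist (𝓜.cotensor 𝓜' hsub) (diagAct a b) (z ⊗ₜ (x ⊗ₜ y))) =
      TensorProduct.map (coTwist 𝓜 a) (coTwist 𝓜' b)
        (cotensorMiddle 𝓜 𝓜' A B (z ⊗ₜ (x ⊗ₜ y))) := by
  -- `R` is m ⊗ h ⊗ m' ↦ (m₍₀₎ ⊗ S⁻¹(m₍₋₁₎)x) ⊗ (m' ⊗ S⁻¹(h)y), and `Q` distributes the two halves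
  -- of Δ(m₍₋₁₎) to x and y. The left side is `Q` of the coaction of `z`; coassociativity rewrites
  -- it as `R` of m₍₀₎ ⊗ m₍₋₁₎ ⊗ m', and the cotensor equation then makes it the right side.
  let R : M ⊗[k] (H ⊗[k] M') →ₗ[k] (M ⊗[k] A) ⊗[k] (M' ⊗[k] B) :=
    TensorProduct.map (spread 𝓜 (orbit a x))
      ((TensorProduct.comm k B M').toLinearMap ∘ₗ (orbit b y).rTensor M')
  let Q : (H ⊗[k] H) ⊗[k] (M ⊗[k] M') →ₗ[k] (M ⊗[k] A) ⊗[k] (M' ⊗[k] B) :=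
    (TensorProduct.tensorTensorTensorComm k M M' A B).toLinearMap ∘ₗ
      (TensorProduct.comm k (A ⊗[k] B) (M ⊗[k] M')).toLinearMap ∘ₗ
      (TensorProduct.map (orbit a x) (orbit b y)).rTensor (M ⊗[k] M')
  -- The defining equation of M □_H M': an entry of H produced by M may be regarded as produced by
  -- M'.
  have hz : TensorProduct.assoc k M H M'
      (((TensorProduct.comm k H M).toLinearMap ∘ₗ 𝓜.coact).rTensor M' z) =
      𝓜'.coact.lTensor M z := by
    have h0 : cotensorMap 𝓜 𝓜' z = 0 := z.2
    rwa [cotensorMap, LinearMap.sub_apply, sub_eq_zero] at h0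
  have r1 : ∀ w : M ⊗[k] M', R (𝓜'.coact.lTensor M w) =
      TensorProduct.map (coTwist 𝓜 a) (coTwist 𝓜' b)
        (TensorProduct.tensorTensorTensorComm k M M' A B (w ⊗ₜ (x ⊗ₜ y))) := by
    intro w
    induction w with
    | zero => simp
    | add s t hs ht => simp only [map_add, TensorProduct.add_tmul, hs, ht]
    | tmul m m' =>
      simp only [LinearMap.lTensor_tmul, R, TensorProduct.map_tmul,
        TensorProduct.tensorTensorTensorComm_tmul, coTwist_tmul]
      rfl
  have l1 : ∀ w : H ⊗[k] Cotensor 𝓜 𝓜', cotensorMiddle 𝓜 𝓜' A B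
      (TensorProduct.comm k (A ⊗[k] B) _ ((orbit (diagAct a b) (x ⊗ₜ y)).rTensor _ w)) =
      Q (comul.rTensor (M ⊗[k] M') ((Cotensor 𝓜 𝓜').subtype.lTensor H w)) := by
    intro w
    induction w with
    | zero => simp
    | add s t hs ht => simp only [map_add, hs, ht]
    | tmul h m =>
      simp [Q, cotensorMiddle, diagAct_antipodeInv]
  have m1 : ∀ w : M ⊗[k] M', Q (comul.rTensor (M ⊗[k] M') (leftCoact 𝓜 M' w)) =
      R (TensorProduct.assoc k M H M'
        (((TensorProduct.comm k H M).toLinearMap ∘ₗ 𝓜.coact).rTensor M' w)) := by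
    intro w
    induction w with
    | zero => simp
    | add s t hs ht => simp only [map_add, hs, ht]
    | tmul m m' =>
      let G : H ⊗[k] (H ⊗[k] M) →ₗ[k] (M ⊗[k] A) ⊗[k] (M' ⊗[k] B) :=
        Q ∘ₗ (TensorProduct.assoc k H H (M ⊗[k] M')).symm.toLinearMap ∘ₗ
          (((TensorProduct.mk k M M').flip m').lTensor H).lTensor H
      have g1 : ∀ v : H ⊗[k] M, Q (comul.rTensor (M ⊗[k] M')
          (TensorProduct.assoc k H M M' (v ⊗ₜ m'))) =
          G (TensorProduct.assoc k H H M (comul.rTensor M v)) := by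
        intro v
        induction v with
        | zero => simp
        | add s t hs ht => simp only [map_add, TensorProduct.add_tmul, hs, ht]
        | tmul h m =>
          simp only [TensorProduct.assoc_tmul, LinearMap.rTensor_tmul]
          generalize comul (R := k) h = t
          induction t with
          | zero => simp
          | add s t hs ht => simp only [map_add, TensorProduct.add_tmul, hs, ht]
          | tmul s t => simp [G]
      have g2 : ∀ v : H ⊗[k] M, G (TensorProduct.leftComm k H H M (𝓜.coact.lTensor H v)) =
          R (TensorProduct.assoc k M H M' (TensorProduct.comm k H M v ⊗ₜ m')) := by
        intro v
        induction v with
        | zero => simp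
        | add s t hs ht => simp only [map_add, TensorProduct.add_tmul, hs, ht]
        | tmul h m =>
          simp only [LinearMap.lTensor_tmul, TensorProduct.comm_tmul, TensorProduct.assoc_tmul, R,
            TensorProduct.map_tmul, spread_apply]
          generalize 𝓜.coact m = t
          induction t with
          | zero => simp
          | add s t hs ht =>
            simp only [map_add, TensorProduct.tmul_add, TensorProduct.add_tmul, hs, ht]
          | tmul s t => simp [G, Q]
      have e := g1 (𝓜.coact m)
      -- After coassociativity the outer entry of the iterated coaction acts on x and the inner one
      -- on y, while `R` uses them the other way round. The symmetry `coact_symm`, a consequence of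
      -- cocommutativity, interchanges them.
      rw [𝓜.coassoc, coact_symm, g2] at e
      exact e
  rw [coTwist_tmul, spread_apply, l1]
  have e := subtype_cotensorCoact 𝓜 𝓜' z
  change Q (comul.rTensor (M ⊗[k] M') ((Cotensor 𝓜 𝓜').subtype.lTensor H
    (cotensorCoact 𝓜 𝓜' z))) = _
  rw [e, m1, hz, r1]
  rfl

/-- `(m ⊗ m') h₁ ⊗ S(h₂)(f ⊗ f')` as a product of two twisted actions. -/
theorem cotensorMiddle_twistedRact (𝓜 : SAYDModule k H M)
    (𝓜' : SAYDModule k H M') (hsub : CotensorIsSubmodule 𝓜 𝓜')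
    (a : H →ₐ[k] Module.End k A) (b : H →ₐ[k] Module.End k B) (h : H)
    (z : Cotensor 𝓜 𝓜' ⊗[k] (A ⊗[k] B)) :
    cotensorMiddle 𝓜 𝓜' A B (twistedRact (𝓜.cotensor 𝓜' hsub) (diagAct a b) h z) =
      pairAct (twistedRact 𝓜 a) (twistedRact 𝓜' b) (comul (R := k) h)
        (cotensorMiddle 𝓜 𝓜' A B z) := by
  let sa := a.toLinearMap ∘ₗ HopfAlgebra.antipode k
  let sb := b.toLinearMap ∘ₗ HopfAlgebra.antipode k
  let P : (H ⊗[k] H) ⊗[k] (H ⊗[k] H) →ₗ[k] Module.End k ((M ⊗[k] A) ⊗[k] (M' ⊗[k] B)) :=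
    pairAct (pairAct 𝓜.ract sa) (pairAct 𝓜'.ract sb)
  have l1 : ∀ u : H ⊗[k] H, cotensorMiddle 𝓜 𝓜' A B
      (pairAct (𝓜.cotensor 𝓜' hsub).ract ((diagAct a b).toLinearMap ∘ₗ HopfAlgebra.antipode k) u z)
      = P (TensorProduct.tensorTensorTensorComm k H H H H (TensorProduct.map comul comul u))
        (cotensorMiddle 𝓜 𝓜' A B z) := by
    intro u
    induction u with
    | zero => simp
    | add s t hs ht => simp only [map_add, LinearMap.add_apply, hs, ht]
    | tmul g h =>
      induction z with
      | zero => simp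
      | add s t hs ht => simp only [map_add, hs, ht]
      | tmul z w =>
        induction w with
        | zero => simp
        | add s t hs ht => simp only [map_add, TensorProduct.tmul_add, hs, ht]
        | tmul x y =>
          have hg : (((𝓜.cotensor 𝓜' hsub).ract g z : Cotensor 𝓜 𝓜') : M ⊗[k] M') =
            diagRact 𝓜 𝓜' g z := rfl
          simp only [pairAct_tmul, TensorProduct.map_tmul, cotensorMiddle, LinearMap.comp_apply,
            LinearMap.rTensor_tmul, Submodule.subtype_apply, hg, LinearEquiv.coe_coe,
            AlgHom.toLinearMap_apply, diagAct_apply, comul_antipode, diagRact]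
          generalize (z : M ⊗[k] M') = w
          generalize comul (R := k) g = s
          generalize comul (R := k) h = t
          induction w with
          | zero => simp
          | add s t hs ht => simp only [map_add, TensorProduct.add_tmul, hs, ht]
          | tmul m m' =>
            induction s with
            | zero => simp
            | add s t hs ht => simp only [map_add, LinearMap.add_apply, TensorProduct.add_tmul, hs, ht]
            | tmul s s' =>
              induction t with
              | zero => simp
              | add s t hs ht =>
                simp only [map_add, LinearMap.add_apply, TensorProduct.tmul_add, hs, ht]
              | tmul t t' => simp [P, sa, sb]
  have r1 : ∀ u : H ⊗[k] H, pairAct (twistedRact 𝓜 a) (twistedRact 𝓜' b) u =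
      P (TensorProduct.map comul comul u) := by
    intro u
    induction u with
    | zero => simp
    | add s t hs ht => simp only [map_add, hs, ht]
    | tmul g h => simp [P, twistedRact, sa, sb]
  -- The left side groups the four components of h as (m, m', x, y), the right side as (m, x, m',
  -- y). Cocommutativity makes the two groupings equal.
  have hc : TensorProduct.tensorTensorTensorComm k H H H H
      (TensorProduct.map comul comul (comul (R := k) h)) =
      TensorProduct.map comul comul (comul (R := k) h) :=
    (LinearMap.congr_fun (comulCoalgHom k H).map_comp_comul h).symm
  rw [r1, ← hc]
  exact l1 (comul (R := k) h)

end Cotensor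

end HopfCyclic

namespace HopfCyclic

/-! ### Coassociativity of the diagonal action. -/

section DiagAct

variable {k H A B C : Type*} [Field k] [Ring H] [HopfAlgebra k H]
  [AddCommGroup A] [Module k A] [AddCommGroup B] [Module k B] [AddCommGroup C] [Module k C]

theorem diagAct_assoc (a : H →ₐ[k] Module.End k A) (b : H →ₐ[k] Module.End k B)
    (c : H →ₐ[k] Module.End k C) (h : H) (x : (A ⊗[k] B) ⊗[k] C) :
    TensorProduct.assoc k A B C (diagAct (diagAct a b) c h x) =
      diagAct a (diagAct b c) h (TensorProduct.assoc k A B C x) := by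
  let P : H ⊗[k] (H ⊗[k] H) →ₗ[k] Module.End k (A ⊗[k] (B ⊗[k] C)) :=
    pairAct a.toLinearMap (pairAct b.toLinearMap c.toLinearMap)
  have l : ∀ u : H ⊗[k] H, TensorProduct.assoc k A B C
      (pairAct (diagAct a b).toLinearMap c.toLinearMap u x) =
      P (TensorProduct.assoc k H H H (comul.rTensor H u)) (TensorProduct.assoc k A B C x) := by
    intro u
    induction u with
    | zero => simp
    | add s t hs ht => simp only [map_add, LinearMap.add_apply, hs, ht]
    | tmul g h =>
      simp only [pairAct_tmul, AlgHom.toLinearMap_apply, diagAct_apply, LinearMap.rTensor_tmul]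
      generalize comul (R := k) g = t
      induction t with
      | zero => simp
      | add s t hs ht =>
        simp only [map_add, LinearMap.add_apply, TensorProduct.map_add_left,
          TensorProduct.add_tmul, hs, ht]
      | tmul s t =>
        exact (LinearMap.congr_fun (TensorProduct.map_map_comp_assoc_eq (R := k)
          (a s) (b t) (c h)) x).symm
  have r : ∀ u : H ⊗[k] H, pairAct a.toLinearMap (diagAct b c).toLinearMap u =
      P (comul.lTensor H u) := by
    intro u
    induction u with
    | zero => simp
    | add s t hs ht => simp only [map_add, hs, ht]
    | tmul g h => simp [P, diagAct_apply]
  rw [diagAct_apply, l, coassoc_apply, ← r, diagAct_apply]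

end DiagAct

/-! ### Strands of composable morphisms, opened at either end. -/

section Strands

variable {k H : Type*} {D : Type u} [Field k] [Ring H] [HopfAlgebra k H]
  [SmallCategory D] [Preadditive D] [Linear k D]

theorem strand_cons_induction {n : ℕ} {X Y : D} {motive : strand k (n + 1) X Y → Prop}
    (a : strand k (n + 1) X Y) (zero : motive 0)
    (add : ∀ a b, motive a → motive b → motive (a + b))
    (cons : ∀ (Z : D) (f : Z ⟶ X) (a : strand k n Z Y), motive (strandCons n X Z Y (f ⊗ₜ a))) :
    motive a := by
  classical
  have key : ∀ a : (⨁ Z : D, (Z ⟶ X) ⊗[k] strand k n Z Y), motive a := by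
    intro a
    induction a using DirectSum.induction_on with
    | zero => exact zero
    | add x y hx hy => exact add x y hx hy
    | of Z t =>
      have e : DirectSum.of (fun Z => (Z ⟶ X) ⊗[k] strand k n Z Y) Z t =
          strandCons n X Z Y t := by
        simp only [strandCons]
        rw [← DirectSum.lof_eq_of k]
        congr
      rw [e]
      induction t with
      | zero => rw [map_zero]; exact zero
      | add x y hx hy =>
        rw [map_add]
        refine add _ _ (hx ?_) (hy ?_) <;>
        · simp only [strandCons]
          rw [← DirectSum.lof_eq_of k]
          congr
      | tmul f a => exact cons Z f a
  exact key a

/-- `(f⁰ ⊗ ... ⊗ fⁿ) ⊗ f ↦ f⁰ ⊗ ... ⊗ fⁿ ⊗ f`. -/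
noncomputable def strandSnoc : ∀ (n : ℕ) (X Z Y : D),
    strand k n X Z ⊗[k] (Y ⟶ Z) →ₗ[k] strand k (n + 1) X Y
  | 0, X, Z, Y => strandCons 0 X Z Y ∘ₗ
      TensorProduct.map (strandOne X Z).symm.toLinearMap (strandOne Z Y).toLinearMap
  | n + 1, X, Z, Y => TensorProduct.lift (strandLift fun W => TensorProduct.curry
      (strandCons (n + 1) X W Y ∘ₗ (strandSnoc n W Z Y).lTensor (W ⟶ X) ∘ₗ
        (TensorProduct.assoc k _ _ _).toLinearMap))

theorem strandSnoc_one {X Z Y : D} (f : Z ⟶ X) (g : Y ⟶ Z) :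
    strandSnoc 0 X Z Y (strandOne (k := k) X Z f ⊗ₜ g) =
      strandCons 0 X Z Y (f ⊗ₜ strandOne Z Y g) := rfl

theorem strandSnoc_cons_apply {n : ℕ} {X W Z Y : D} (t : (W ⟶ X) ⊗[k] strand k n W Z)
    (g : Y ⟶ Z) : strandSnoc (n + 1) X Z Y (strandCons n X W Z t ⊗ₜ g) =
      strandCons (n + 1) X W Y ((strandSnoc n W Z Y).lTensor (W ⟶ X)
        (TensorProduct.assoc k _ _ _ (t ⊗ₜ g))) := by
  simp only [strandSnoc, TensorProduct.lift.tmul, strandLift_cons]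
  rfl

theorem strandSnoc_cons {n : ℕ} {X W Z Y : D} (f : W ⟶ X) (a : strand k n W Z) (g : Y ⟶ Z) :
    strandSnoc (n + 1) X Z Y (strandCons n X W Z (f ⊗ₜ a) ⊗ₜ g) =
      strandCons (n + 1) X W Y (f ⊗ₜ strandSnoc n W Z Y (a ⊗ₜ g)) :=
  strandSnoc_cons_apply _ _

/-- Strands are defined by adding factors in front, whereas rotation and the last face act on the
last factor. This principle makes tensors a ⊗ f with f at the end available as generators. -/
theorem strand_snoc_induction {n : ℕ} {X Y : D} {motive : strand k (n + 1) X Y → Prop}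
    (a : strand k (n + 1) X Y) (zero : motive 0)
    (add : ∀ a b, motive a → motive b → motive (a + b))
    (snoc : ∀ (Z : D) (a : strand k n X Z) (f : Y ⟶ Z),
      motive (strandSnoc n X Z Y (a ⊗ₜ f))) : motive a := by
  induction n generalizing X with
  | zero =>
    induction a using strand_cons_induction with
    | zero => exact zero
    | add a b ha hb => exact add a b ha hb
    | cons Z f a => exact snoc Z (strandOne X Z f) ((strandOne Z Y).symm a)
  | succ n ih =>
    induction a using strand_cons_induction with
    | zero => exact zero
    | add a b ha hb => exact add a b ha hb
    | cons W f a =>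
      refine ih (X := W) (motive := fun a => motive (strandCons (n + 1) X W Y (f ⊗ₜ a))) a ?_ ?_ ?_
      · simpa using zero
      · intro a b ha hb
        rw [TensorProduct.tmul_add, map_add]
        exact add _ _ ha hb
      · intro Z a g
        rw [← strandSnoc_cons]
        exact snoc _ _ _

theorem strandUnsnoc_snoc [DecidableEq D] {n : ℕ} {X Z Y : D} (a : strand k n X Z) (f : Y ⟶ Z) :
    strandUnsnoc n X Y (strandSnoc n X Z Y (a ⊗ₜ f)) =
      DirectSum.lof k D (fun Z => strand k n X Z ⊗[k] (Y ⟶ Z)) Z (a ⊗ₜ f) := by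
  obtain rfl : ‹DecidableEq D› = fun a b => Classical.propDecidable (a = b) :=
    Subsingleton.elim _ _
  induction n generalizing X with
  | zero =>
    obtain ⟨f, rfl⟩ := (strandOne X Z).surjective a
    rw [strandSnoc_one]
    simp only [strandUnsnoc, strandLift_cons]
    simp
  | succ n ih =>
    induction a using strand_cons_induction with
    | zero => simp
    | add a b ha hb => simp only [map_add, TensorProduct.add_tmul, ha, hb]
    | cons W g a =>
      rw [strandSnoc_cons]
      simp only [strandUnsnoc, strandLift_cons, LinearMap.comp_apply, LinearMap.lTensor_tmul, ih]
      simp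

theorem CN.rotate_snoc {n : ℕ} {X Z : D} (a : strand k n X Z) (f : X ⟶ Z) :
    CN.rotate (n + 1) (CN.of (n + 1) X (strandSnoc n X Z X (a ⊗ₜ f))) =
      CN.of (n + 1) Z (strandCons n Z X Z (f ⊗ₜ a)) := by
  classical
  simp only [CN.rotate, CN.lift_of, LinearMap.comp_apply]
  rw [strandUnsnoc_snoc]
  exact DirectSum.toModule_lof _ _ _

theorem CN.induction {n : ℕ} {motive : CN k D n → Prop} (x : CN k D n) (zero : motive 0)
    (add : ∀ a b, motive a → motive b → motive (a + b))
    (of : ∀ (X : D) (a : strand k n X X), motive (CN.of n X a)) : motive x := by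
  classical
  have key : ∀ x : (⨁ X : D, strand k n X X), motive x := by
    intro x
    induction x using DirectSum.induction_on with
    | zero => exact zero
    | add x y hx hy => exact add x y hx hy
    | of X t =>
      have e : DirectSum.of (fun X => strand k n X X) X t = CN.of n X t := by
        simp only [CN.of]
        rw [← DirectSum.lof_eq_of k]
        congr
      rw [e]
      exact of X t
  exact key x

variable [HCategory k H D]

@[simp] theorem strandAct_one {X Y : D} (h : H) (f : Y ⟶ X) :
    strandAct (k := k) 0 X Y h (strandOne X Y f) = strandOne X Y (HCategory.act (k := k) Y X h f) := rfl

theorem strandAct_cons {n : ℕ} {X Z Y : D} (h : H) (t : (Z ⟶ X) ⊗[k] strand k n Z Y) :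
    strandAct (n + 1) X Y h (strandCons n X Z Y t) =
      strandCons n X Z Y (diagAct (HCategory.act Z X) (strandAct n Z Y) h t) := by
  classical
  exact sumAct_lof _ _ _ _

theorem strandActHead_cons {n : ℕ} {X Z Y : D} (h : H) (f : Z ⟶ X) (a : strand k n Z Y) :
    strandActHead (n + 1) X Y h (strandCons n X Z Y (f ⊗ₜ a)) =
      strandCons n X Z Y (HCategory.act (k := k) Z X h f ⊗ₜ a) := by
  classical
  exact sumAct_lof _ _ _ _

theorem CN.act_of {n : ℕ} {X : D} (h : H) (a : strand k n X X) :
    CN.act n h (CN.of n X a) = CN.of n X (strandAct n X X h a) := by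
  classical
  exact sumAct_lof (A := fun X : D => strand k n X X) (fun X => strandAct n X X) _ _ _

theorem CN.actHead_of {n : ℕ} {X : D} (h : H) (a : strand k n X X) :
    CN.actHead n h (CN.of n X a) = CN.of n X (strandActHead n X X h a) := by
  classical
  exact sumAct_lof (A := fun X : D => strand k n X X) (fun X => strandActHead n X X) _ _ _

end Strands

end HopfCyclic

namespace HopfCyclic

/-! ### The words f⁰df¹…dfⁿ in a DGH-semicategory. -/

section Words

universe w v w' v'

variable {k H : Type*} [Field k] [Ring H] [HopfAlgebra k H]

namespace DGHSemicat

variable (S : DGHSemicat.{w, v} k H)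

/-- Composition in `S` as a bilinear map. -/
noncomputable def mul {i j n : ℕ} (h : i + j = n) {X Y Z : S.Ob} :
    S.Hom i Y Z →ₗ[k] S.Hom j X Y →ₗ[k] S.Hom n X Z :=
  TensorProduct.curry (S.comp h X Y Z)

/-- The differential of `S` with implicit objects. -/
noncomputable abbrev del {i n : ℕ} (h : i + 1 = n) {X Y : S.Ob} : S.Hom i X Y →ₗ[k] S.Hom n X Y :=
  S.d h X Y

variable {S}

theorem comp_tmul {i j n : ℕ} (h : i + j = n) {X Y Z : S.Ob} (g : S.Hom i Y Z) (f : S.Hom j X Y) :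
    S.comp h X Y Z (g ⊗ₜ f) = S.mul h g f := rfl

theorem mul_assoc {i j l a b n : ℕ} (ha : i + j = a) (hb : j + l = b) (h₁ : a + l = n)
    (h₂ : i + b = n) {W X Y Z : S.Ob} (p : S.Hom i Y Z) (g : S.Hom j X Y) (f : S.Hom l W X) :
    S.mul h₁ (S.mul ha p g) f = S.mul h₂ p (S.mul hb g f) :=
  S.assoc ha hb h₁ h₂ p g f

theorem del_del {i j n : ℕ} (h : i + 1 = j) (h' : j + 1 = n) {X Y : S.Ob} (f : S.Hom i X Y) :
    S.del h' (S.del h f) = 0 := S.d_d h h' f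

theorem del_mul {i j n i' j' n' : ℕ} (h : i + j = n) (hi : i + 1 = i') (hj : j + 1 = j')
    (hn : n + 1 = n') (h₁ : i' + j = n') (h₂ : i + j' = n') {X Y Z : S.Ob}
    (g : S.Hom i Y Z) (f : S.Hom j X Y) :
    S.del hn (S.mul h g f) = S.mul h₁ (S.del hi g) f + (-1 : k) ^ i • S.mul h₂ g (S.del hj f) :=
  S.leibniz h hi hj hn h₁ h₂ g f

theorem act_del {i n : ℕ} (h : i + 1 = n) {X Y : S.Ob} (a : H) (f : S.Hom i X Y) :
    S.act n X Y a (S.del h f) = S.del h (S.act i X Y a f) := S.act_d h X Y a f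

end DGHSemicat

variable {D : Type u} [SmallCategory D] [Preadditive D] [Linear k D] [HCategory k H D]
  {S : DGHSemicat.{w, v} k H} (ρ : HSemifunctor D S)

namespace HSemifunctor

@[simp] theorem word_one {X Y : D} (f : Y ⟶ X) :
    ρ.word 0 X Y (strandOne (k := k) X Y f) = ρ.map Y X f := rfl

@[simp] theorem dword_one {X Y : D} (f : Y ⟶ X) :
    ρ.dword 0 X Y (strandOne (k := k) X Y f) = S.del (zero_add 1) (ρ.map Y X f) := rfl

theorem word_cons {n : ℕ} {X Z Y : D} (f : Z ⟶ X) (a : strand k n Z Y) :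
    ρ.word (n + 1) X Y (strandCons n X Z Y (f ⊗ₜ a)) =
      S.mul (Nat.zero_add (n + 1)) (ρ.map Z X f) (ρ.dword n Z Y a) := by
  simp only [word, strandLift_cons]
  rfl

theorem dword_cons {n : ℕ} {X Z Y : D} (f : Z ⟶ X) (a : strand k n Z Y) :
    ρ.dword (n + 1) X Y (strandCons n X Z Y (f ⊗ₜ a)) =
      S.mul (Nat.add_comm 1 (n + 1)) (S.del (zero_add 1) (ρ.map Z X f)) (ρ.dword n Z Y a) := by
  simp only [dword, strandLift_cons]
  rfl

/-- In d(f⁰ · df¹…dfⁿ) the Leibniz rule leaves df⁰df¹…dfⁿ, because the tail df¹…dfⁿ is closed. The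
tail is closed since, by the first statement for the shorter word, it is itself a differential; the
two statements therefore travel together. -/
theorem del_word_aux (n : ℕ) {X Y : D} (a : strand k n X Y) :
    S.del rfl (ρ.word n X Y a) = ρ.dword n X Y a ∧
      ∀ (l : ℕ) (h : n + 1 + 1 = l), S.del h (ρ.dword n X Y a) = 0 := by
  have key : ∀ X (a : strand k n X Y), S.del rfl (ρ.word n X Y a) = ρ.dword n X Y a := by
    clear a
    induction n with
    | zero => exact fun X a => rfl
    | succ n ih =>
      intro X a
      induction a using strand_cons_induction with
      | zero => simp only [map_zero]
      | add a b ha hb => simp only [map_add, ha, hb]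
      | cons Z f a =>
        rw [word_cons, dword_cons, DGHSemicat.del_mul (Nat.zero_add (n + 1)) (zero_add 1) rfl rfl
          (Nat.add_comm 1 (n + 1)) (by omega), ← ih, DGHSemicat.del_del, map_zero, smul_zero,
          add_zero]
  refine ⟨key X a, fun l h => ?_⟩
  rw [← key, DGHSemicat.del_del]

theorem del_word_rfl {n : ℕ} {X Y : D} (a : strand k n X Y) :
    S.del rfl (ρ.word n X Y a) = ρ.dword n X Y a := (ρ.del_word_aux n a).1

theorem del_dword {n l : ℕ} (h : n + 1 + 1 = l) {X Y : D} (a : strand k n X Y) :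
    S.del h (ρ.dword n X Y a) = 0 := (ρ.del_word_aux n a).2 l h

theorem map_comp_mul {X Y Z : D} (g : Y ⟶ Z) (f : X ⟶ Y) :
    ρ.map X Z (f ≫ g) = S.mul (add_zero 0) (ρ.map Y Z g) (ρ.map X Y f) := ρ.map_comp g f

theorem word_strandComp {n : ℕ} {X Z Y : D} (f : Z ⟶ X) (a : strand k n Z Y) :
    ρ.word n X Y (strandComp n X Z Y (f ⊗ₜ a)) =
      S.mul (Nat.zero_add n) (ρ.map Z X f) (ρ.word n Z Y a) := by
  cases n with
  | zero => exact ρ.map_comp _ _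
  | succ n =>
    induction a using strand_cons_induction with
    | zero => simp only [TensorProduct.tmul_zero, map_zero]
    | add a b ha hb => simp only [TensorProduct.tmul_add, map_add, ha, hb]
    | cons W g a =>
      have e : strandComp (n + 1) X Z Y (f ⊗ₜ strandCons n Z W Y (g ⊗ₜ a)) =
          strandCons n X W Y ((g ≫ f) ⊗ₜ[k] a) := by
        classical
        simp only [strandComp]
        exact sumRight_tmul_lof _ _ _ _
      rw [e, word_cons, word_cons, map_comp_mul, DGHSemicat.mul_assoc]

theorem dword_snoc {n : ℕ} {X Z Y : D} (a : strand k n X Z) (f : Y ⟶ Z) :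
    ρ.dword (n + 1) X Y (strandSnoc n X Z Y (a ⊗ₜ f)) =
      S.mul rfl (ρ.dword n X Z a) (S.del (zero_add 1) (ρ.map Y Z f)) := by
  induction n generalizing X with
  | zero =>
    obtain ⟨g, rfl⟩ := (strandOne X Z).surjective a
    rw [strandSnoc_one, dword_cons]
    simp
  | succ n ih =>
    induction a using strand_cons_induction with
    | zero => simp only [TensorProduct.zero_tmul, map_zero, LinearMap.zero_apply]
    | add a b ha hb => simp only [TensorProduct.add_tmul, map_add, LinearMap.add_apply, ha, hb]
    | cons W g a =>
      rw [strandSnoc_cons, dword_cons, ih, dword_cons, DGHSemicat.mul_assoc]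

theorem word_snoc {n : ℕ} {X Z Y : D} (a : strand k n X Z) (f : Y ⟶ Z) :
    ρ.word (n + 1) X Y (strandSnoc n X Z Y (a ⊗ₜ f)) =
      S.mul rfl (ρ.word n X Z a) (S.del (zero_add 1) (ρ.map Y Z f)) := by
  cases n with
  | zero =>
    obtain ⟨g, rfl⟩ := (strandOne X Z).surjective a
    rw [strandSnoc_one, word_cons]
    simp
  | succ n =>
    induction a using strand_cons_induction with
    | zero => simp only [TensorProduct.zero_tmul, map_zero, LinearMap.zero_apply]
    | add a b ha hb => simp only [TensorProduct.add_tmul, map_add, LinearMap.add_apply, ha, hb]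
    | cons W g a =>
      rw [strandSnoc_cons, word_cons, dword_snoc, word_cons, DGHSemicat.mul_assoc]

theorem strandFace_zero_cons {n : ℕ} {X Z Y : D} (f : Z ⟶ X) (a : strand k n Z Y) :
    strandFace n 0 X Y (strandCons n X Z Y (f ⊗ₜ a)) = strandComp n X Z Y (f ⊗ₜ a) := by
  cases n <;> simp [strandFace]

theorem strandFace_succ_cons {n : ℕ} (i : Fin (n + 1)) {X Z Y : D} (f : Z ⟶ X)
    (a : strand k (n + 1) Z Y) :
    strandFace (n + 1) i.succ X Y (strandCons (n + 1) X Z Y (f ⊗ₜ a)) =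
      strandCons n X Z Y (f ⊗ₜ strandFace n i Z Y a) := by
  simp [strandFace]

/-- Right multiplication of `(ρ f⁰) d(ρ f¹) ... d(ρ fⁿ)` by `ρ f`. -/
theorem word_mul_map {n : ℕ} {X Z Y : D} (a : strand k n X Z) (f : Y ⟶ Z) :
    S.mul (add_zero n) (ρ.word n X Z a) (ρ.map Y Z f) =
      ∑ i : Fin (n + 1), (-1 : k) ^ (n + (i : ℕ)) •
        ρ.word n X Y (strandFace n i X Y (strandSnoc n X Z Y (a ⊗ₜ f))) := by
  induction n generalizing X with
  | zero =>
    obtain ⟨g, rfl⟩ := (strandOne X Z).surjective a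
    rw [strandSnoc_one]
    simp only [Nat.reduceAdd, Finset.univ_unique, Fin.default_eq_zero, Finset.sum_singleton]
    rw [strandFace_zero_cons, word_strandComp]
    simp
  | succ n ih =>
    induction a using strand_cons_induction with
    | zero => simp
    | add a b ha hb =>
      simp only [TensorProduct.add_tmul, map_add, LinearMap.add_apply, ha, hb, smul_add,
        Finset.sum_add_distrib]
    | cons W g a =>
      -- Differentiating the induction hypothesis isolates (df¹…dfⁿ)f: the Leibniz rule applied to
      -- (word)·f gives this product plus (−1)ⁿ times the word ending in df. Multiplication by the
      -- head g then turns that extra word into the face that composes the first two factors.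
      have hd : S.mul (add_zero (n + 1)) (ρ.dword n W Z a) (ρ.map Y Z f) =
          ∑ i : Fin (n + 1), (-1 : k) ^ (n + (i : ℕ)) •
            ρ.dword n W Y (strandFace n i W Y (strandSnoc n W Z Y (a ⊗ₜ f))) -
          (-1 : k) ^ n • ρ.word (n + 1) W Y (strandSnoc n W Z Y (a ⊗ₜ f)) := by
        have e := congrArg (S.del rfl) (ih (X := W) a)
        rw [DGHSemicat.del_mul (add_zero n) rfl (zero_add 1) rfl (add_zero (n + 1)) rfl] at e
        simp only [map_sum, map_smul, del_word_rfl] at e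
        rw [← e, word_snoc, add_sub_cancel_right]
      rw [strandSnoc_cons, Fin.sum_univ_succ, word_cons,
        DGHSemicat.mul_assoc (Nat.zero_add (n + 1)) (add_zero (n + 1)) (add_zero (n + 1))
        (Nat.zero_add (n + 1)), hd, strandFace_zero_cons, word_strandComp]
      simp only [strandFace_succ_cons, word_cons, map_sub, map_sum, map_smul]
      rw [sub_eq_neg_add]
      congr 1
      · rw [← neg_smul]
        congr 1
        simp [pow_succ]
      · refine Finset.sum_congr rfl fun i _ => ?_
        congr 1
        rw [Fin.val_succ]
        ring

/-- Apply d to `word_mul_map`. The faces become exact words, and the Leibniz term containing df,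
moved to the other side, is the only part that is not visibly exact. That part is what detects
cyclicity later. -/
theorem dword_mul_map {n : ℕ} {X Z Y : D} (a : strand k n X Z) (f : Y ⟶ Z) :
    S.mul (add_zero (n + 1)) (ρ.dword n X Z a) (ρ.map Y Z f) =
      ∑ i : Fin (n + 1), (-1 : k) ^ (n + (i : ℕ)) •
        ρ.dword n X Y (strandFace n i X Y (strandSnoc n X Z Y (a ⊗ₜ f))) -
      (-1 : k) ^ n • ρ.word (n + 1) X Y (strandSnoc n X Z Y (a ⊗ₜ f)) := by
  have e := congrArg (S.del rfl) (ρ.word_mul_map a f)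
  rw [DGHSemicat.del_mul (add_zero n) rfl (zero_add 1) rfl (add_zero (n + 1)) rfl] at e
  simp only [map_sum, map_smul, del_word_rfl] at e
  rw [← e, word_snoc, add_sub_cancel_right]

theorem dword_act {n : ℕ} {X Y : D} (h : H) (a : strand k n X Y) :
    ρ.dword n X Y (strandAct n X Y h a) = S.act (n + 1) _ _ h (ρ.dword n X Y a) := by
  induction n generalizing X h with
  | zero =>
    obtain ⟨g, rfl⟩ := (strandOne X Y).surjective a
    rw [strandAct_one, dword_one, dword_one, DGHSemicat.act_del, ρ.map_act]
  | succ n ih =>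
    induction a using strand_cons_induction with
    | zero => simp only [map_zero]
    | add a b ha hb => simp only [map_add, ha, hb]
    | cons Z f a =>
      have e : ∀ t : (Z ⟶ X) ⊗[k] strand k n Z Y, ρ.dword (n + 1) X Y (strandCons n X Z Y t) =
          S.comp (Nat.add_comm 1 (n + 1)) (ρ.obj Y) (ρ.obj Z) (ρ.obj X)
          (TensorProduct.map (S.d (zero_add 1) (ρ.obj Z) (ρ.obj X) ∘ₗ ρ.map Z X)
            (ρ.dword n Z Y) t) := by
        intro t
        simp only [dword, strandLift_cons, LinearMap.comp_apply]
      rw [strandAct_cons, e, e, S.act_comp, diagAct_map]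
      · intro h x
        simp only [LinearMap.comp_apply, ρ.map_act, S.act_d]
      · exact fun h x => ih (X := Z) (h := h) x

theorem word_act {n : ℕ} {X Y : D} (h : H) (a : strand k n X Y) :
    ρ.word n X Y (strandAct n X Y h a) = S.act n _ _ h (ρ.word n X Y a) := by
  cases n with
  | zero =>
    obtain ⟨g, rfl⟩ := (strandOne X Y).surjective a
    rw [strandAct_one, word_one, word_one, ρ.map_act]
  | succ n =>
    induction a using strand_cons_induction with
    | zero => simp only [map_zero]
    | add a b ha hb => simp only [map_add, ha, hb]
    | cons Z f a =>
      have e : ∀ t : (Z ⟶ X) ⊗[k] strand k n Z Y, ρ.word (n + 1) X Y (strandCons n X Z Y t) =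
          S.comp (Nat.zero_add (n + 1)) (ρ.obj Y) (ρ.obj Z) (ρ.obj X)
          (TensorProduct.map (ρ.map Z X) (ρ.dword n Z Y) t) := by
        intro t
        simp only [word, strandLift_cons, LinearMap.comp_apply]
      rw [strandAct_cons, e, e, S.act_comp, diagAct_map]
      · exact ρ.map_act
      · exact ρ.dword_act

end HSemifunctor

end Words

end HopfCyclic

/-! ### The DGH-semicategory of universal differential forms. -/

namespace HopfCyclic

/-- Equivariance of `g` is required only on the orbit of the single vector `y`. This is the form
available inside inductions, where equivariance is known only for the element at hand. -/
theorem diagAct_map_right_of {k H A B B' : Type*} [Field k] [Ring H] [HopfAlgebra k H]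
    [AddCommGroup A] [Module k A] [AddCommGroup B] [Module k B] [AddCommGroup B'] [Module k B']
    (a : H →ₐ[k] Module.End k A) (b : H →ₐ[k] Module.End k B) (b' : H →ₐ[k] Module.End k B')
    (g : B →ₗ[k] B') (y : B) (hy : ∀ h, g (b h y) = b' h (g y)) (h : H) (x : A) :
    g.lTensor A (diagAct a b h (x ⊗ₜ y)) = diagAct a b' h (x ⊗ₜ g y) := by
  rw [diagAct_apply, diagAct_apply]
  induction comul (R := k) h with
  | zero => simp
  | add s t hs ht => simp only [map_add, LinearMap.add_apply, hs, ht]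
  | tmul s t => simp [hy]

theorem diagAct_assoc_symm {k H A B C : Type*} [Field k] [Ring H] [HopfAlgebra k H]
    [AddCommGroup A] [Module k A] [AddCommGroup B] [Module k B] [AddCommGroup C] [Module k C]
    (a : H →ₐ[k] Module.End k A) (b : H →ₐ[k] Module.End k B)
    (c : H →ₐ[k] Module.End k C) (h : H) (x : A ⊗[k] (B ⊗[k] C)) :
    diagAct (diagAct a b) c h ((TensorProduct.assoc k A B C).symm x) =
      (TensorProduct.assoc k A B C).symm (diagAct a (diagAct b c) h x) := by
  rw [LinearEquiv.eq_symm_apply, diagAct_assoc, LinearEquiv.apply_symm_apply]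

section Universal

universe w v w' v'

variable {k H : Type*} [Field k] [Ring H] [HopfAlgebra k H]
  {D : Type u} [SmallCategory D] [Preadditive D] [Linear k D]

/-- `strand k (n - 1) X Y`, to be read as zero for `n = 0`. -/
noncomputable def preStrand (k : Type*) {D : Type u} [Field k] [SmallCategory D] [Preadditive D]
    [Linear k D] : ℕ → D → D → ModuleCat.{u} k
  | 0, _, _ => ModuleCat.of k PUnit
  | n + 1, X, Y => strand k n X Y

/-- The universal differential forms: the pair `(f⁰ ⊗ ... ⊗ fⁿ, g¹ ⊗ ... ⊗ gⁿ)` stands for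
`f⁰ df¹ ... dfⁿ + dg¹ ... dgⁿ`. -/
def Om (k : Type*) {D : Type u} [Field k] [SmallCategory D] [Preadditive D] [Linear k D]
    (n : ℕ) (X Y : D) : Type u :=
  strand k n Y X × preStrand k n Y X

namespace Om

noncomputable instance (n : ℕ) (X Y : D) : AddCommGroup (Om k n X Y) :=
  inferInstanceAs (AddCommGroup (strand k n Y X × preStrand k n Y X))

noncomputable instance (n : ℕ) (X Y : D) : Module k (Om k n X Y) :=
  inferInstanceAs (Module k (strand k n Y X × preStrand k n Y X))

/-- `f⁰ ⊗ ... ⊗ fⁿ ↦ f⁰ df¹ ... dfⁿ`. -/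
noncomputable def inl (n : ℕ) (X Y : D) : strand k n Y X →ₗ[k] Om k n X Y :=
  LinearMap.inl k (strand k n Y X) (preStrand k n Y X)

/-- `g¹ ⊗ ... ⊗ gⁿ ↦ dg¹ ... dgⁿ`. -/
noncomputable def inr (n : ℕ) (X Y : D) : preStrand k n Y X →ₗ[k] Om k n X Y :=
  LinearMap.inr k (strand k n Y X) (preStrand k n Y X)

/-- The first component of a form. -/
noncomputable def fst (n : ℕ) (X Y : D) : Om k n X Y →ₗ[k] strand k n Y X :=
  LinearMap.fst k (strand k n Y X) (preStrand k n Y X)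

/-- The second component of a form. -/
noncomputable def snd (n : ℕ) (X Y : D) : Om k n X Y →ₗ[k] preStrand k n Y X :=
  LinearMap.snd k (strand k n Y X) (preStrand k n Y X)

@[simp] theorem fst_inl {n : ℕ} {X Y : D} (a : strand k n Y X) : fst n X Y (inl n X Y a) = a := rfl
@[simp] theorem snd_inl {n : ℕ} {X Y : D} (a : strand k n Y X) : snd n X Y (inl n X Y a) = 0 := rfl
@[simp] theorem fst_inr {n : ℕ} {X Y : D} (a : preStrand k n Y X) :
    fst n X Y (inr n X Y a) = 0 := rfl
@[simp] theorem snd_inr {n : ℕ} {X Y : D} (a : preStrand k n Y X) :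
    snd n X Y (inr n X Y a) = a := rfl

theorem inl_add_inr {n : ℕ} {X Y : D} (x : Om k n X Y) :
    inl n X Y (fst n X Y x) + inr n X Y (snd n X Y x) = x :=
  Prod.ext (add_zero _) (zero_add _)

/-- The linear map out of `Om` with given components. -/
noncomputable def coprod {P : Type*} [AddCommGroup P] [Module k P] {n : ℕ} {X Y : D}
    (F : strand k n Y X →ₗ[k] P) (G : preStrand k n Y X →ₗ[k] P) : Om k n X Y →ₗ[k] P :=
  F ∘ₗ fst n X Y + G ∘ₗ snd n X Y

@[simp] theorem coprod_inl {P : Type*} [AddCommGroup P] [Module k P] {n : ℕ} {X Y : D}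
    (F : strand k n Y X →ₗ[k] P) (G : preStrand k n Y X →ₗ[k] P) (a : strand k n Y X) :
    coprod F G (inl n X Y a) = F a := by simp [coprod]

@[simp] theorem coprod_inr {P : Type*} [AddCommGroup P] [Module k P] {n : ℕ} {X Y : D}
    (F : strand k n Y X →ₗ[k] P) (G : preStrand k n Y X →ₗ[k] P) (a : preStrand k n Y X) :
    coprod F G (inr n X Y a) = G a := by simp [coprod]

/-- The differential of forms. -/
noncomputable def d {i n : ℕ} (h : i + 1 = n) (X Y : D) : Om k i X Y →ₗ[k] Om k n X Y := by
  subst h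
  exact (inr (k := k) (i + 1) X Y) ∘ₗ fst i X Y

/-- `g¹ ⊗ ... ⊗ gⁿ⁺¹ ↦ dg¹ ... dgⁿ⁺¹`. -/
noncomputable def dform (n : ℕ) (X Y : D) : strand k n Y X →ₗ[k] Om k (n + 1) X Y :=
  inr (n + 1) X Y

theorem exists_eq_inl_add_dform {n : ℕ} {X Y : D} (x : Om k (n + 1) X Y) :
    ∃ a b, x = inl (n + 1) X Y a + dform n X Y b :=
  ⟨_, _, (inl_add_inr x).symm⟩

theorem exists_eq_inl {X Y : D} (x : Om k 0 X Y) : ∃ a, x = inl 0 X Y a :=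
  ⟨fst 0 X Y x, Prod.ext rfl rfl⟩

@[simp] theorem coprod_dform {P : Type*} [AddCommGroup P] [Module k P] {n : ℕ} {X Y : D}
    (F : strand k (n + 1) Y X →ₗ[k] P) (G : strand k n Y X →ₗ[k] P) (a : strand k n Y X) :
    coprod (n := n + 1) F G (dform n X Y a) = G a :=
  coprod_inr (n := n + 1) F G a

@[simp] theorem d_inl {i : ℕ} {X Y : D} (a : strand k i Y X) :
    d rfl X Y (inl i X Y a) = dform i X Y a := rfl

theorem d_inr {i n : ℕ} (h : i + 1 = n) {X Y : D} (a : preStrand k i Y X) :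
    d h X Y (inr i X Y a) = 0 := by
  subst h
  change inr (k := k) (i + 1) X Y 0 = 0
  exact map_zero _

@[simp] theorem d_dform {i n : ℕ} (h : i + 1 + 1 = n) {X Y : D} (a : strand k i Y X) :
    d h X Y (dform i X Y a) = 0 := d_inr h a

theorem d_d {i j n : ℕ} (h : i + 1 = j) (h' : j + 1 = n) {X Y : D} (f : Om k i X Y) :
    d h' X Y (d h X Y f) = 0 := by
  subst h
  exact d_inr h' _

/-- `f ⊗ (f¹ ⊗ ... ⊗ fⁿ) ↦ f ⊗ f¹ ⊗ ... ⊗ fⁿ`. -/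
noncomputable def preCons : ∀ (n : ℕ) (X Z Y : D),
    (Z ⟶ X) ⊗[k] preStrand k n Z Y →ₗ[k] strand k n X Y
  | 0, _, _, _ => 0
  | n + 1, X, Z, Y => strandCons n X Z Y

/-- `f ⊗ x ↦ f x`. -/
noncomputable def head (n : ℕ) (X Y Z : D) : (Y ⟶ Z) ⊗[k] Om k n X Y →ₗ[k] Om k n X Z :=
  inl n X Z ∘ₗ (strandComp n Z Y X ∘ₗ (fst n X Y).lTensor (Y ⟶ Z) +
    preCons n Z Y X ∘ₗ (snd n X Y).lTensor (Y ⟶ Z))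

theorem head_inl {n : ℕ} {X Y Z : D} (f : Y ⟶ Z) (a : strand k n Y X) :
    head n X Y Z (f ⊗ₜ inl n X Y a) = inl n X Z (strandComp n Z Y X (f ⊗ₜ a)) := by
  simp [head]

theorem head_inr {n : ℕ} {X Y Z : D} (f : Y ⟶ Z) (a : preStrand k n Y X) :
    head n X Y Z (f ⊗ₜ inr n X Y a) = inl n X Z (preCons n Z Y X (f ⊗ₜ a)) := by
  simp [head]

theorem head_dform {n : ℕ} {X Y Z : D} (f : Y ⟶ Z) (a : strand k n Y X) :
    head (n + 1) X Y Z (f ⊗ₜ dform n X Y a) = inl (n + 1) X Z (strandCons n Z Y X (f ⊗ₜ a)) :=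
  head_inr (n := n + 1) f a

theorem strandComp_cons {n : ℕ} {X Z W Y : D} (f : Z ⟶ X) (g : W ⟶ Z) (a : strand k n W Y) :
    strandComp (n + 1) X Z Y (f ⊗ₜ strandCons n Z W Y (g ⊗ₜ a)) =
      strandCons n X W Y ((g ≫ f) ⊗ₜ[k] a) := by
  classical
  simp only [strandComp]
  exact sumRight_tmul_lof _ _ _ _

theorem strandComp_one {X Z Y : D} (f : Z ⟶ X) (g : Y ⟶ Z) :
    strandComp 0 X Z Y (f ⊗ₜ strandOne (k := k) Z Y g) = strandOne X Y (g ≫ f) := rfl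

theorem strandComp_strandComp {n : ℕ} {X Z W Y : D} (f : Z ⟶ X) (g : W ⟶ Z)
    (a : strand k n W Y) : strandComp n X Z Y (f ⊗ₜ strandComp n Z W Y (g ⊗ₜ a)) =
      strandComp n X W Y ((g ≫ f) ⊗ₜ[k] a) := by
  cases n with
  | zero =>
    obtain ⟨e, rfl⟩ := (strandOne W Y).surjective a
    simp only [strandComp_one, Category.assoc]
  | succ n =>
    induction a using strand_cons_induction with
    | zero => simp only [TensorProduct.tmul_zero, map_zero]
    | add a b ha hb => simp only [TensorProduct.tmul_add, map_add, ha, hb]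
    | cons V e a => simp only [strandComp_cons, Category.assoc]

theorem head_head {n : ℕ} {X W Y Z : D} (f : Y ⟶ Z) (g : W ⟶ Y) (x : Om k n X W) :
    head n X Y Z (f ⊗ₜ head n X W Y (g ⊗ₜ x)) = head n X W Z ((g ≫ f) ⊗ₜ x) := by
  cases n with
  | zero =>
    obtain ⟨a, rfl⟩ := exists_eq_inl x
    simp only [head_inl, strandComp_strandComp]
  | succ n =>
    obtain ⟨a, b, rfl⟩ := exists_eq_inl_add_dform x
    simp only [TensorProduct.tmul_add, map_add, head_inl, head_dform, strandComp_strandComp,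
      strandComp_cons]

/-- The operator `x ↦ d(a x) - (-1)ⁱ a (dx)` for a family of operators of degree `i`. -/
noncomputable def bracket {i : ℕ} {A : Type*} [AddCommGroup A] [Module k A] {X Y Z : D}
    (L : ∀ {j n : ℕ}, i + j = n → A →ₗ[k] Om k j X Y →ₗ[k] Om k n X Z)
    {j n : ℕ} (h : i + 1 + j = n) : A →ₗ[k] Om k j X Y →ₗ[k] Om k n X Z :=
  (L (j := j) (n := i + j) rfl).compr₂ (d (by omega) X Z) -
    (-1 : k) ^ i • (L (j := j + 1) (n := n) (by omega)).compl₂ (d rfl X Y)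

/-- Left multiplication by `f⁰ df¹ ... dfⁱ`. -/
noncomputable def lmul : ∀ (i : ℕ) {j n : ℕ} (_ : i + j = n) (X Y Z : D),
    strand k i Z Y →ₗ[k] Om k j X Y →ₗ[k] Om k n X Z
  | 0, j, n, h, X, Y, Z => by
      obtain rfl : j = n := by omega
      exact TensorProduct.curry (head j X Y Z) ∘ₗ (strandOne Z Y).symm.toLinearMap
  -- The Leibniz rule forces (da)y = d(ay) − (−1)ⁱ a(dy), so left multiplication by da is the graded
  -- commutator of d with left multiplication by a. Multiplication by f·da is that commutator
  -- followed by f. The product is thereby defined by recursion on the left factor alone.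
  | i + 1, _, n, h, X, Y, Z => strandLift fun W => TensorProduct.lift
      ((LinearMap.llcomp k _ _ _ ∘ₗ TensorProduct.curry (head n X W Z)).compl₂
        (bracket (fun h => lmul i h X Y W) h))

/-- Left multiplication by `dg¹ ... dgⁱ`. -/
noncomputable def dmul : ∀ (i : ℕ) {j n : ℕ} (_ : i + j = n) (X Y Z : D),
    preStrand k i Z Y →ₗ[k] Om k j X Y →ₗ[k] Om k n X Z
  | 0, _, _, _, _, _, _ => 0
  | i + 1, _, _, h, X, Y, Z => bracket (fun h => lmul i h X Y Z) h

/-- Multiplication of forms. -/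
noncomputable def mul {i j n : ℕ} (h : i + j = n) (X Y Z : D) :
    Om k i Y Z →ₗ[k] Om k j X Y →ₗ[k] Om k n X Z :=
  coprod (lmul i h X Y Z) (dmul i h X Y Z)

/-- `f ↦ f`, as a form of degree zero. -/
noncomputable def of (X Y : D) : (X ⟶ Y) →ₗ[k] Om k 0 X Y :=
  inl 0 X Y ∘ₗ (strandOne Y X).toLinearMap

theorem mul_of {n m : ℕ} (h : 0 + n = m) {X Y Z : D} (f : Y ⟶ Z) (x : Om k n X Y) :
    mul h X Y Z (of Y Z f) x = (by omega : n = m) ▸ head n X Y Z (f ⊗ₜ x) := by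
  obtain rfl : n = m := by omega
  simp [mul, of, lmul]

theorem zero_mul_of {n : ℕ} {X Y Z : D} (f : Y ⟶ Z) (x : Om k n X Y) :
    mul (zero_add n) X Y Z (of Y Z f) x = head n X Y Z (f ⊗ₜ x) := mul_of _ _ _

/-- Forms are generated from morphisms by d and by left multiplication with morphisms, since
f⁰df¹…dfⁿ = f⁰·d(f¹df²…dfⁿ). Every property of products proved below is propagated along these two
operations on one factor. -/
theorem induction {motive : ∀ (n : ℕ) (X Y : D), Om k n X Y → Prop}
    (zero : ∀ n X Y, motive n X Y 0)
    (add : ∀ n X Y x y, motive n X Y x → motive n X Y y → motive n X Y (x + y))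
    (of : ∀ X Y f, motive 0 X Y (of X Y f))
    (d : ∀ n X Y x, motive n X Y x → motive (n + 1) X Y (d rfl X Y x))
    (head : ∀ n X Y Z f x, motive n X Y x → motive n X Z (head n X Y Z (f ⊗ₜ x)))
    {n : ℕ} {X Y : D} (x : Om k n X Y) : motive n X Y x := by
  have key : ∀ (n : ℕ) (X Y : D) (a : strand k n Y X), motive n X Y (inl n X Y a) := by
    intro n
    induction n with
    | zero =>
      intro X Y a
      exact of X Y ((strandOne Y X).symm a)
    | succ n ih =>
      intro X Y a
      induction a using strand_cons_induction with
      | zero => rw [map_zero]; exact zero _ _ _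
      | add a b ha hb => rw [map_add]; exact add _ _ _ _ _ ha hb
      | cons Z f a =>
        have := head _ _ _ Y f _ (d _ _ _ _ (ih X Z a))
        rwa [d_inl, head_dform] at this
  cases n with
  | zero =>
    obtain ⟨a, rfl⟩ := exists_eq_inl x
    exact key _ _ _ _
  | succ n =>
    obtain ⟨a, b, rfl⟩ := exists_eq_inl_add_dform x
    exact add _ _ _ _ _ (key _ _ _ _) (d _ _ _ _ (key n X Y b))

/-- True by construction: `dmul` is the commutator `bracket` of d with `lmul`. -/
theorem mul_dform {i j m n : ℕ} (hm : i + j = m) (hn : m + 1 = n) (h : i + 1 + j = n)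
    (h' : i + (j + 1) = n) {X Y Z : D} (a : strand k i Z Y) (y : Om k j X Y) :
    mul h X Y Z (dform i Y Z a) y = d hn X Z (mul hm X Y Z (inl i Y Z a) y) -
      (-1 : k) ^ i • mul h' X Y Z (inl i Y Z a) (d rfl X Y y) := by
  subst hm
  simp only [mul, coprod_inl]
  refine (LinearMap.congr_fun (coprod_inr (n := i + 1) (lmul (i + 1) h X Y Z)
    (dmul (i + 1) h X Y Z) a) y).trans ?_
  simp only [dmul, bracket]
  rfl

theorem mul_inl_cons {i j n : ℕ} (h : i + 1 + j = n) {X W Y Z : D} (f : Y ⟶ Z)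
    (a : strand k i Y W) (y : Om k j X W) :
    mul h X W Z (inl (i + 1) W Z (strandCons i Z Y W (f ⊗ₜ a))) y =
      head n X Y Z (f ⊗ₜ mul h X W Y (dform i W Y a) y) := by
  have e : mul h X W Y (dform i W Y a) y = bracket (fun h => lmul i h X W Y) h a y :=
    LinearMap.congr_fun (coprod_inr (n := i + 1) (lmul (i + 1) h X W Y)
      (dmul (i + 1) h X W Y) a) y
  rw [e]
  simp only [mul, coprod_inl, lmul, strandLift_cons]
  rfl

/-- The graded Leibniz rule, solved for the first term. -/
theorem d_mul {i i' j j' m n : ℕ} (hi : i + 1 = i') (hj : j + 1 = j') (hm : i + j = m)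
    (hn : m + 1 = n) (h : i' + j = n) (h' : i + j' = n) {X Y Z : D} (x : Om k i Y Z)
    (y : Om k j X Y) :
    mul h X Y Z (d hi Y Z x) y = d hn X Z (mul hm X Y Z x y) -
      (-1 : k) ^ i • mul h' X Y Z x (d hj X Y y) := by
  subst hi hj hm
  cases i with
  | zero =>
    obtain ⟨a, rfl⟩ := exists_eq_inl x
    rw [d_inl, mul_dform rfl hn]
  | succ i =>
    obtain ⟨a, b, rfl⟩ := exists_eq_inl_add_dform x
    rw [map_add, d_inl, d_dform, add_zero, mul_dform rfl hn h h', map_add, map_add, LinearMap.add_apply,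
      LinearMap.add_apply, map_add, smul_add, add_sub_add_comm, left_eq_add]
    -- For the remaining part x = db the left side vanishes, so d(db·y) has to equal (−1)^(i+1)
    -- db·dy. Both are computed from db·y = d(by) − (−1)ⁱ b·dy using d² = 0.
    rw [mul_dform (m := i + j) rfl (by omega) rfl (by omega),
      mul_dform (m := i + 1 + j) (by omega) hn h' (by omega), d_d, map_zero, smul_zero, sub_zero,
      map_sub, d_d, map_smul, zero_sub, pow_succ]
    simp

/-- Associativity when the leftmost factor is a morphism. It holds by construction if x is a word
dg¹…, and if x starts with a morphism g it reduces to f(gz) = (gf)z, where gf is the composite in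
`D`. -/
theorem head_mul {i j n : ℕ} (h : i + j = n) {X W Y Z : D} (f : Y ⟶ Z) (x : Om k i W Y)
    (y : Om k j X W) : mul h X W Z (head i W Y Z (f ⊗ₜ x)) y =
      head n X Y Z (f ⊗ₜ mul h X W Y x y) := by
  have key : ∀ a, mul h X W Z (head i W Y Z (f ⊗ₜ inl i W Y a)) y =
      head n X Y Z (f ⊗ₜ mul h X W Y (inl i W Y a) y) := by
    intro a
    cases i with
    | zero =>
      obtain rfl : j = n := by omega
      obtain ⟨g, rfl⟩ := (strandOne Y W).surjective a
      rw [head_inl, strandComp_one]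
      exact (zero_mul_of _ _).trans ((head_head _ _ _).symm.trans (congrArg
        (fun z => head j X Y Z (f ⊗ₜ z)) (zero_mul_of g y).symm))
    | succ l =>
      induction a using strand_cons_induction with
      | zero => simp
      | add a b ha hb =>
        simp only [TensorProduct.tmul_add, map_add, LinearMap.add_apply, ha, hb]
      | cons V g a => rw [head_inl, strandComp_cons, mul_inl_cons, mul_inl_cons, head_head]
  cases i with
  | zero =>
    obtain ⟨a, rfl⟩ := exists_eq_inl x
    exact key a
  | succ i =>
    obtain ⟨a, b, rfl⟩ := exists_eq_inl_add_dform x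
    rw [TensorProduct.tmul_add, map_add, map_add, map_add, LinearMap.add_apply, LinearMap.add_apply,
      TensorProduct.tmul_add, map_add, key, head_dform, mul_inl_cons]

/-- The forms p that associate with all g and f are stable under left multiplication by morphisms,
by `head_mul`. They are stable under d because the Leibniz rule expresses (dp)g f and (dp)(g f)
through products of p with g, dg, f and df, to which the hypothesis on p applies. Hence the
hypothesis is kept for all g and f of all degrees. -/
theorem mul_assoc {i j l a b n : ℕ} (ha : i + j = a) (hb : j + l = b) (h₁ : a + l = n)
    (h₂ : i + b = n) {W X Y Z : D} (p : Om k i Y Z) (g : Om k j X Y) (f : Om k l W X) :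
    mul h₁ W X Z (mul ha X Y Z p g) f = mul h₂ W Y Z p (mul hb W X Y g f) := by
  induction p using Om.induction generalizing j l a b n with
  | zero => simp
  | add i Y Z p q hp hq => simp only [map_add, LinearMap.add_apply, hp ha hb h₁ h₂, hq ha hb h₁ h₂]
  | of Y Z p =>
    obtain rfl : j = a := by omega
    obtain rfl : b = n := by omega
    rw [zero_mul_of, zero_mul_of, head_mul]
  | head i U Y Z q p hp => rw [head_mul, head_mul, head_mul, hp ha hb h₁ h₂]
  | d i Y Z p hp =>
    rw [d_mul (m := i + j) rfl rfl rfl (by omega) ha (by omega) p g, map_sub, map_smul,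
      LinearMap.sub_apply, LinearMap.smul_apply,
      d_mul (m := i + j + l) (n := n) _ rfl rfl (by omega) h₁ (by omega),
      d_mul (m := i + j + l) (n := n) rfl rfl (by omega) (by omega) h₂ (by omega),
      hp (a := i + j) (b := b) (n := i + j + l) rfl hb rfl (by omega),
      hp (a := i + j) (l := l + 1) (b := b + 1) (n := n) rfl (by omega) (by omega) (by omega),
      hp (j := j + 1) (a := a) (b := b + 1) (n := n) (by omega) (by omega) h₁ (by omega),
      d_mul (m := b) (n := b + 1) rfl rfl hb rfl (by omega) (by omega) g f]
    simp only [map_sub, map_smul, smul_sub, smul_smul, pow_add]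
    abel

variable [HCategory k H D]

/-- The diagonal action on the second component. -/
noncomputable def preAct : ∀ (n : ℕ) (X Y : D), H →ₐ[k] Module.End k (preStrand k n X Y)
  | 0, _, _ => (Algebra.ofId k _).comp (Bialgebra.counitAlgHom k H)
  | n + 1, X, Y => strandAct n X Y

/-- The diagonal action of `H` on forms. -/
noncomputable def act (n : ℕ) (X Y : D) : H →ₐ[k] Module.End k (Om k n X Y) :=
  (LinearMap.prodMapAlgHom k (strand k n Y X) (preStrand k n Y X)).comp
    ((strandAct n Y X).prod (preAct n Y X))

theorem act_inl {n : ℕ} {X Y : D} (h : H) (a : strand k n Y X) :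
    act n X Y h (inl n X Y a) = inl n X Y (strandAct n Y X h a) :=
  Prod.ext rfl (map_zero (preAct (k := k) n Y X h))

theorem act_dform {n : ℕ} {X Y : D} (h : H) (a : strand k n Y X) :
    act (n + 1) X Y h (dform n X Y a) = dform n X Y (strandAct n Y X h a) :=
  Prod.ext (map_zero (strandAct (k := k) (n + 1) Y X h)) rfl

theorem act_of {X Y : D} (h : H) (f : X ⟶ Y) :
    act 0 X Y h (of (k := k) X Y f) = of X Y (HCategory.act (k := k) X Y h f) :=
  act_inl _ _

theorem act_d {i n : ℕ} (hn : i + 1 = n) {X Y : D} (h : H) (x : Om k i X Y) :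
    act n X Y h (d hn X Y x) = d hn X Y (act i X Y h x) := by
  subst hn
  cases i with
  | zero =>
    obtain ⟨a, rfl⟩ := exists_eq_inl x
    rw [act_inl, d_inl, act_dform, d_inl]
  | succ i =>
    obtain ⟨a, b, rfl⟩ := exists_eq_inl_add_dform x
    rw [map_add, map_add, map_add, map_add, act_inl, d_inl, act_dform, d_inl, act_dform, d_dform,
      d_dform, map_zero]

theorem strandAct_strandComp {n : ℕ} {X Z Y : D} (h : H) (t : (Z ⟶ X) ⊗[k] strand k n Z Y) :
    strandAct n X Y h (strandComp n X Z Y t) =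
      strandComp n X Z Y (diagAct (HCategory.act Z X) (strandAct n Z Y) h t) := by
  cases n with
  | zero =>
    have e : ∀ t : (Z ⟶ X) ⊗[k] (Y ⟶ Z), strandComp 0 X Z Y t = compMap k Y Z X t := by
      intro t
      induction t with
      | zero => exact (map_zero (strandComp 0 X Z Y)).trans (map_zero _).symm
      | add s t hs ht =>
        exact (map_add (strandComp 0 X Z Y) s t).trans
          ((congrArg₂ (· + ·) hs ht).trans (map_add _ _ _).symm)
      | tmul f g => rfl
    exact (congrArg (HCategory.act (k := k) Y X h) (e t)).trans
      ((HCategory.act_comp Y Z X h t).trans (e _).symm)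
  | succ n =>
    induction t with
    | zero => simp only [map_zero]
    | add s t hs ht => simp only [map_add, hs, ht]
    | tmul f a =>
      induction a using strand_cons_induction with
      | zero => simp only [TensorProduct.tmul_zero, map_zero]
      | add a b ha hb => simp only [TensorProduct.tmul_add, map_add, ha, hb]
      | cons W g a =>
        have e : ∀ s : (Z ⟶ X) ⊗[k] ((W ⟶ Z) ⊗[k] strand k n W Y),
            strandComp (n + 1) X Z Y ((strandCons n Z W Y).lTensor (Z ⟶ X) s) =
            strandCons n X W Y ((compMap k W Z X).rTensor (strand k n W Y)
              ((TensorProduct.assoc k _ _ _).symm s)) := by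
          intro s
          induction s with
          | zero => simp
          | add s t hs ht => simp only [map_add, hs, ht]
          | tmul f t =>
            induction t with
            | zero => simp
            | add s t hs ht => simp only [TensorProduct.tmul_add, map_add, hs, ht]
            | tmul g a => exact strandComp_cons f g a
        rw [← diagAct_map_right_of (b := diagAct (HCategory.act W Z) (strandAct n W Y))
          (hy := fun h => (strandAct_cons h _).symm), e, ← diagAct_assoc_symm, strandComp_cons,
          strandAct_cons]
        congr 1
        exact (diagAct_map _ _ _ _ (compMap k W Z X) LinearMap.id
          (fun h x => (HCategory.act_comp _ _ _ h x).symm) (fun _ _ => rfl) h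
          ((f ⊗ₜ g) ⊗ₜ a)).symm

theorem act_head {n : ℕ} {X Y Z : D} (h : H) (t : (Y ⟶ Z) ⊗[k] Om k n X Y) :
    act n X Z h (head n X Y Z t) =
      head n X Y Z (diagAct (HCategory.act Y Z) (act n X Y) h t) := by
  have key : ∀ (f : Y ⟶ Z) (a : strand k n Y X), act n X Z h (head n X Y Z (f ⊗ₜ inl n X Y a)) =
      head n X Y Z (diagAct (HCategory.act Y Z) (act n X Y) h (f ⊗ₜ inl n X Y a)) := by
    intro f a
    have e : head (k := k) n X Y Z ∘ₗ (inl n X Y).lTensor (Y ⟶ Z) = inl n X Z ∘ₗ strandComp n Z Y X :=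
      TensorProduct.ext' fun f a => head_inl f a
    rw [← diagAct_map_right_of (b := strandAct n Y X) (hy := fun h => (act_inl (k := k) h _).symm),
      head_inl, act_inl, strandAct_strandComp]
    exact (LinearMap.congr_fun e _).symm
  induction t with
  | zero => simp only [map_zero]
  | add s t hs ht => simp only [map_add, hs, ht]
  | tmul f x =>
    cases n with
    | zero =>
      obtain ⟨a, rfl⟩ := exists_eq_inl x
      exact key f a
    | succ n =>
      obtain ⟨a, b, rfl⟩ := exists_eq_inl_add_dform x
      rw [TensorProduct.tmul_add, map_add, map_add, map_add, map_add, key]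
      congr 1
      have e : head (k := k) (n + 1) X Y Z ∘ₗ (dform n X Y).lTensor (Y ⟶ Z) =
          inl (n + 1) X Z ∘ₗ strandCons n Z Y X :=
        TensorProduct.ext' fun f a => head_dform f a
      rw [← diagAct_map_right_of (b := strandAct n Y X) (hy := fun h => (act_dform (k := k) h _).symm),
        head_dform, act_inl, strandAct_cons]
      exact (LinearMap.congr_fun e _).symm

/-- The same propagation as for associativity: a morphism on the left is handled by `act_head`,
composition of morphisms by `head_mul` with coassociativity, and d by the Leibniz rule together with
the equivariance of d. -/
theorem act_mul {i j n : ℕ} (hn : i + j = n) {X Y Z : D} (h : H) (x : Om k i Y Z)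
    (y : Om k j X Y) : act n X Z h (mul hn X Y Z x y) =
      TensorProduct.lift (mul hn X Y Z) (diagAct (act i Y Z) (act j X Y) h (x ⊗ₜ y)) := by
  induction x using Om.induction generalizing j n h with
  | zero => simp
  | add i Y Z x x' hx hx' =>
    simp only [map_add, LinearMap.add_apply, TensorProduct.add_tmul, hx hn h y, hx' hn h y]
  | of Y Z f =>
    obtain rfl : j = n := by omega
    have e : TensorProduct.lift (mul (k := k) hn X Y Z) ∘ₗ TensorProduct.map (of Y Z) LinearMap.id =
        head j X Y Z := TensorProduct.ext' fun f x => zero_mul_of f x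
    have e2 := diagAct_map (HCategory.act (k := k) Y Z) (act j X Y) (act 0 Y Z) (act j X Y)
      (of Y Z) LinearMap.id (fun h f => (act_of (k := k) h f).symm) (fun _ _ => rfl) h (f ⊗ₜ y)
    rw [TensorProduct.map_tmul, LinearMap.id_apply] at e2
    rw [zero_mul_of, act_head, ← e2, ← e]
    rfl
  | head i U Y Z f x hx =>
    have e1 := diagAct_map_right_of (HCategory.act (k := k) Y Z)
      (diagAct (act i U Y) (act j X U)) (act n X Y) (TensorProduct.lift (mul hn X U Y)) (x ⊗ₜ y)
      (fun h => (hx hn h y).symm) h f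
    have e2 := diagAct_map (diagAct (HCategory.act (k := k) Y Z) (act i U Y)) (act j X U)
      (act i U Z) (act j X U) (head i U Y Z) LinearMap.id (fun h t => (act_head h t).symm)
      (fun _ _ => rfl) h ((f ⊗ₜ x) ⊗ₜ y)
    have e3 : ∀ t, TensorProduct.lift (mul hn X U Z)
        (TensorProduct.map (head i U Y Z) LinearMap.id t) =
        head n X Y Z ((TensorProduct.lift (mul hn X U Y)).lTensor (Y ⟶ Z)
          (TensorProduct.assoc k _ _ _ t)) := by
      intro t
      refine LinearMap.congr_fun (f := TensorProduct.lift (mul hn X U Z) ∘ₗ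
        TensorProduct.map (head i U Y Z) LinearMap.id) (g := head n X Y Z ∘ₗ
        (TensorProduct.lift (mul hn X U Y)).lTensor (Y ⟶ Z) ∘ₗ
        (TensorProduct.assoc k _ _ _).toLinearMap) ?_ t
      refine TensorProduct.ext_threefold fun f x y => ?_
      exact head_mul hn f x y
    rw [TensorProduct.map_tmul, LinearMap.id_apply] at e2
    rw [head_mul, act_head, ← e2, e3, diagAct_assoc]
    exact congrArg _ e1.symm
  | d i Y Z x hx =>
    obtain rfl : n = i + j + 1 := by omega
    have e : ∀ t : Om k i Y Z ⊗[k] Om k j X Y, TensorProduct.lift (mul hn X Y Z)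
        (TensorProduct.map (d rfl Y Z) LinearMap.id t) =
        d rfl X Z (TensorProduct.lift (mul rfl X Y Z) t) -
        (-1 : k) ^ i • TensorProduct.lift (mul (by omega) X Y Z)
          (TensorProduct.map LinearMap.id (d rfl X Y) t) := by
      intro t
      induction t with
      | zero => simp
      | add s t hs ht =>
        simp only [map_add, hs, ht, smul_add]
        abel
      | tmul x y => exact d_mul rfl rfl rfl rfl hn _ x y
    have e2 := diagAct_map (act (k := k) i Y Z) (act j X Y) (act (i + 1) Y Z) (act j X Y)
      (d rfl Y Z) LinearMap.id (fun h x => (act_d rfl h x).symm) (fun _ _ => rfl) h (x ⊗ₜ y)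
    have e3 := diagAct_map (act (k := k) i Y Z) (act j X Y) (act i Y Z) (act (j + 1) X Y)
      LinearMap.id (d rfl X Y) (fun _ _ => rfl) (fun h x => (act_d rfl h x).symm) h (x ⊗ₜ y)
    rw [TensorProduct.map_tmul, LinearMap.id_apply] at e2 e3
    rw [← e2, e, e3, d_mul (m := i + j) rfl rfl rfl rfl hn (by omega), map_sub, map_smul, act_d,
      hx, hx]

variable (k H D) in
/-- The DGH-semicategory of universal differential forms over an `H`-category. -/
noncomputable def semicat : DGHSemicat.{u, u} k H where
  Ob := D
  Hom n X Y := Om k n X Y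
  comp h X Y Z := TensorProduct.lift (mul h X Y Z)
  assoc {_ _ _ _ _ _} ha hb h₁ h₂ {_ _ _ _} p g f := mul_assoc ha hb h₁ h₂ p g f
  d h X Y := d h X Y
  d_d {_ _ _} h h' {_ _} f := d_d h h' f
  leibniz {_ _ _ _ _ _} h hi hj hn h₁ h₂ {X Y Z} g f := by
    have e := d_mul hi hj h hn h₁ h₂ g f
    simp only [TensorProduct.lift.tmul]
    rw [e, sub_add_cancel]
  act n X Y := act n X Y
  act_comp {_ _ _} h X Y Z a t := by
    induction t with
    | zero => simp only [map_zero]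
    | add s t hs ht => simp only [map_add, hs, ht]
    | tmul x y => exact act_mul h a x y
  act_d {_ _} h _ _ a f := act_d h a f

variable (k H D) in
/-- The inclusion of an `H`-category in its universal differential forms. -/
noncomputable def incl : HSemifunctor (k := k) (H := H) D (semicat k H D) where
  obj X := X
  map X Y := of X Y
  map_comp {X Y Z} g f := by
    have e : of X Z (f ≫ g) = mul (k := k) (add_zero 0) X Y Z (of Y Z g) (of X Y f) := by
      refine ((zero_mul_of g (of X Y f)).trans ?_).symm
      exact head_inl _ _
    exact e
  map_act h f := (act_of h f).symm

/-- Words of the inclusion are the forms of the first kind. Through this identification the formulas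
for words of an arbitrary semifunctor become formulas for forms. -/
theorem incl_word {n : ℕ} {X Y : D} (a : strand k n X Y) :
    (incl k H D).word n X Y a = inl n Y X a := by
  induction n generalizing X with
  | zero => rfl
  | succ n ih =>
    induction a using strand_cons_induction with
    | zero => simp only [map_zero]; rfl
    | add a b ha hb => rw [map_add, map_add, ha, hb]; rfl
    | cons Z f a =>
      rw [HSemifunctor.word_cons, ← HSemifunctor.del_word_rfl, ih]
      exact (zero_mul_of f _).trans (head_dform f a)

theorem incl_dword {n : ℕ} {X Y : D} (a : strand k n X Y) :
    (incl k H D).dword n X Y a = dform n Y X a := by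
  rw [← HSemifunctor.del_word_rfl, incl_word]
  rfl

end Om

end Universal

end HopfCyclic

namespace HopfCyclic

/-! ### Maps of DGH-semicategories and the extension of a semifunctor to forms. -/

section Maps

universe w v w' v'

variable {k H : Type*} [Field k] [Ring H] [HopfAlgebra k H]

/-- A semifunctor of DGH-semicategories: `H`-linear maps on morphisms that commute with
composition and with the differentials. -/
structure DGHMap (S : DGHSemicat.{w, v} k H) (S' : DGHSemicat.{w', v'} k H) where
  obj : S.Ob → S'.Ob
  map : ∀ (n : ℕ) (X Y : S.Ob), S.Hom n X Y →ₗ[k] S'.Hom n (obj X) (obj Y)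
  map_mul : ∀ {i j n : ℕ} (h : i + j = n) {X Y Z : S.Ob} (g : S.Hom i Y Z) (f : S.Hom j X Y),
    map n X Z (S.mul h g f) = S'.mul h (map i Y Z g) (map j X Y f)
  map_del : ∀ {i n : ℕ} (h : i + 1 = n) {X Y : S.Ob} (f : S.Hom i X Y),
    map n X Y (S.del h f) = S'.del h (map i X Y f)
  map_act : ∀ {n : ℕ} {X Y : S.Ob} (a : H) (f : S.Hom n X Y),
    map n X Y (S.act n X Y a f) = S'.act n _ _ a (map n X Y f)

variable {D : Type u} [SmallCategory D] [Preadditive D] [Linear k D] [HCategory k H D]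
  {S : DGHSemicat.{w, v} k H} {S' : DGHSemicat.{w', v'} k H}

/-- The composition of a semifunctor from an `H`-category with a map of DGH-semicategories. -/
noncomputable def HSemifunctor.push (ρ : HSemifunctor D S) (F : DGHMap S S') :
    HSemifunctor D S' where
  obj X := F.obj (ρ.obj X)
  map X Y := F.map 0 _ _ ∘ₗ ρ.map X Y
  map_comp g f := (congrArg _ (ρ.map_comp g f)).trans (F.map_mul _ _ _)
  map_act h f := (congrArg _ (ρ.map_act h f)).trans (F.map_act _ _)

theorem HSemifunctor.push_dword (ρ : HSemifunctor D S) (F : DGHMap S S')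
    {n : ℕ} {X Y : D} (a : strand k n X Y) :
    (ρ.push F).dword n X Y a = F.map (n + 1) _ _ (ρ.dword n X Y a) := by
  induction n generalizing X with
  | zero =>
    obtain ⟨f, rfl⟩ := (strandOne X Y).surjective a
    rw [HSemifunctor.dword_one, HSemifunctor.dword_one, F.map_del]
    rfl
  | succ n ih =>
    induction a using strand_cons_induction with
    | zero => simp only [map_zero]; rfl
    | add a b ha hb => simp only [map_add, ha, hb]; rfl
    | cons Z f a =>
      rw [HSemifunctor.dword_cons, HSemifunctor.dword_cons, F.map_mul, F.map_del, ih]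
      rfl

theorem HSemifunctor.push_word (ρ : HSemifunctor D S) (F : DGHMap S S')
    {n : ℕ} {X Y : D} (a : strand k n X Y) :
    (ρ.push F).word n X Y a = F.map n _ _ (ρ.word n X Y a) := by
  cases n with
  | zero =>
    obtain ⟨f, rfl⟩ := (strandOne X Y).surjective a
    rfl
  | succ n =>
    induction a using strand_cons_induction with
    | zero => simp only [map_zero]; rfl
    | add a b ha hb => simp only [map_add, ha, hb]; rfl
    | cons Z f a =>
      rw [HSemifunctor.word_cons, HSemifunctor.word_cons, F.map_mul, HSemifunctor.push_dword]
      rfl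

namespace Om

variable (ρ : HSemifunctor D S)

/-- `g¹ ⊗ ... ⊗ gⁿ ↦ d(ρ g¹) ... d(ρ gⁿ)`. -/
noncomputable def preWord : ∀ (n : ℕ) (X Y : D),
    preStrand k n X Y →ₗ[k] S.Hom n (ρ.obj Y) (ρ.obj X)
  | 0, _, _ => 0
  | n + 1, X, Y => ρ.dword n X Y

/-- The extension of `ρ` to forms, as a family of linear maps. -/
noncomputable def liftMap (n : ℕ) (X Y : D) : Om k n X Y →ₗ[k] S.Hom n (ρ.obj X) (ρ.obj Y) :=
  coprod (ρ.word n Y X) (preWord ρ n Y X)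

@[simp] theorem liftMap_inl {n : ℕ} {X Y : D} (a : strand k n Y X) :
    liftMap ρ n X Y (inl n X Y a) = ρ.word n Y X a := coprod_inl _ _ _

@[simp] theorem liftMap_dform {n : ℕ} {X Y : D} (a : strand k n Y X) :
    liftMap ρ (n + 1) X Y (dform n X Y a) = ρ.dword n Y X a := coprod_inr (n := n + 1) _ _ _

theorem liftMap_of {X Y : D} (f : X ⟶ Y) : liftMap ρ 0 X Y (of X Y f) = ρ.map X Y f :=
  liftMap_inl ρ _

theorem liftMap_d {i n : ℕ} (h : i + 1 = n) {X Y : D} (x : Om k i X Y) :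
    liftMap ρ n X Y (d h X Y x) = S.del h (liftMap ρ i X Y x) := by
  subst h
  cases i with
  | zero =>
    obtain ⟨a, rfl⟩ := exists_eq_inl x
    rw [d_inl, liftMap_dform, liftMap_inl, HSemifunctor.del_word_rfl]
  | succ i =>
    obtain ⟨a, b, rfl⟩ := exists_eq_inl_add_dform x
    rw [map_add, d_inl, d_dform, add_zero, map_add, liftMap_dform, liftMap_dform, liftMap_inl,
      map_add, HSemifunctor.del_word_rfl, HSemifunctor.del_dword, add_zero]

theorem liftMap_head {n : ℕ} {X Y Z : D} (f : Y ⟶ Z) (x : Om k n X Y) :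
    liftMap ρ n X Z (head n X Y Z (f ⊗ₜ x)) =
      S.mul (zero_add n) (ρ.map Y Z f) (liftMap ρ n X Y x) := by
  cases n with
  | zero =>
    obtain ⟨a, rfl⟩ := exists_eq_inl x
    rw [head_inl, liftMap_inl, liftMap_inl, HSemifunctor.word_strandComp]
  | succ n =>
    obtain ⟨a, b, rfl⟩ := exists_eq_inl_add_dform x
    rw [TensorProduct.tmul_add, map_add, map_add, map_add, map_add, head_inl, head_dform,
      liftMap_inl, liftMap_inl, liftMap_inl, liftMap_dform, HSemifunctor.word_strandComp,
      HSemifunctor.word_cons]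

/-- The product of forms was determined by the Leibniz rule and by associativity with morphisms, and
both hold in `S`. Induction on the left factor therefore transports the product. -/
theorem liftMap_mul {i j n : ℕ} (h : i + j = n) {X Y Z : D} (x : Om k i Y Z) (y : Om k j X Y) :
    liftMap ρ n X Z (mul h X Y Z x y) = S.mul h (liftMap ρ i Y Z x) (liftMap ρ j X Y y) := by
  induction x using Om.induction generalizing j n with
  | zero => simp
  | add i Y Z x x' hx hx' => simp only [map_add, LinearMap.add_apply, hx, hx']
  | of Y Z f =>
    obtain rfl : j = n := by omega
    rw [zero_mul_of, liftMap_head, liftMap_of]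
  | head i U Y Z f x hx =>
    rw [head_mul, liftMap_head, hx, liftMap_head, DGHSemicat.mul_assoc]
  | d i Y Z x hx =>
    rw [d_mul (m := i + j) rfl rfl rfl (by omega) h (by omega), map_sub, map_smul, liftMap_d, hx,
      hx, liftMap_d, liftMap_d,
      DGHSemicat.del_mul (n := i + j) (n' := n) rfl rfl rfl (by omega) h (by omega),
      add_sub_cancel_right]

theorem liftMap_act {n : ℕ} {X Y : D} (a : H) (x : Om k n X Y) :
    liftMap ρ n X Y (act n X Y a x) = S.act n _ _ a (liftMap ρ n X Y x) := by
  cases n with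
  | zero =>
    obtain ⟨b, rfl⟩ := exists_eq_inl x
    rw [act_inl, liftMap_inl, liftMap_inl, HSemifunctor.word_act]
  | succ n =>
    obtain ⟨b, c, rfl⟩ := exists_eq_inl_add_dform x
    simp only [map_add, act_inl, act_dform, liftMap_inl, liftMap_dform, HSemifunctor.word_act,
      HSemifunctor.dword_act]

/-- The extension of `ρ` to forms. -/
noncomputable def lift : DGHMap (semicat k H D) S where
  obj := ρ.obj
  map n X Y := liftMap ρ n X Y
  map_mul {_ _ _} h {_ _ _} g f := liftMap_mul ρ h g f
  map_del {_ _} h {_ _} f := liftMap_d ρ h f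
  map_act {_ _ _} a f := liftMap_act ρ a f

end Om

end Maps

/-! ### Twisted products in a DGH-semicategory. -/

section Twisted

universe w v w' v'

variable {k H M : Type*} [Field k] [Ring H] [HopfAlgebra k H]
  [AddCommGroup M] [Module k M] (𝓜 : SAYDModule k H M)
  {S : DGHSemicat.{w, v} k H} {S' : DGHSemicat.{w', v'} k H}

theorem apply_spread {V : Type*} [AddCommGroup V] [Module k V] (T : M ⊗[k] V →ₗ[k] k)
    (u : H →ₗ[k] V) (m : M) :
    T (spread 𝓜 u m) = TensorProduct.lift ((TensorProduct.curry T).flip ∘ₗ u) (𝓜.coact m) := by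
  rw [spread_apply]
  induction 𝓜.coact m with
  | zero => simp
  | add x y hx hy => simp only [map_add, hx, hy]
  | tmul x y => simp

theorem twistedRact_map {A B : Type*} [AddCommGroup A] [Module k A] [AddCommGroup B] [Module k B]
    (a : H →ₐ[k] Module.End k A) (b : H →ₐ[k] Module.End k B) (f : A →ₗ[k] B)
    (hf : ∀ h x, f (a h x) = b h (f x)) (h : H) (x : M ⊗[k] A) :
    f.lTensor M (twistedRact 𝓜 a h x) = twistedRact 𝓜 b h (f.lTensor M x) := by
  simp only [twistedRact, LinearMap.comp_apply]
  induction comul (R := k) h with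
  | zero => simp
  | add s t hs ht => simp only [map_add, LinearMap.add_apply, hs, ht]
  | tmul s t =>
    induction x with
    | zero => simp
    | add x y hx hy => simp only [map_add, hx, hy]
    | tmul m y => simp [hf]

variable [BijectiveAntipode k H]

/-- `m ↦ m₍₀₎ ⊗ (S⁻¹(m₍₋₁₎) g) x`. -/
noncomputable def tw {i j n : ℕ} (h : i + j = n) {X Y : S.Ob} :
    S.Hom i X Y →ₗ[k] S.Hom j Y X →ₗ[k] M →ₗ[k] M ⊗[k] S.Hom n Y Y :=
  LinearMap.mk₂ k (fun g x => spread 𝓜 ((S.mul h).flip x ∘ₗ orbit (S.act i X Y) g))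
    (fun g g' x => by rw [map_add, LinearMap.comp_add, map_add])
    (fun c g x => by rw [map_smul, LinearMap.comp_smul, map_smul])
    (fun g x x' => by rw [map_add, LinearMap.add_comp, map_add])
    (fun c g x => by rw [map_smul, LinearMap.smul_comp, map_smul])

theorem tw_apply {i j n : ℕ} (h : i + j = n) {X Y : S.Ob} (g : S.Hom i X Y) (x : S.Hom j Y X) :
    tw 𝓜 h g x = spread 𝓜 ((S.mul h).flip x ∘ₗ orbit (S.act i X Y) g) := rfl

theorem coTwist_comp {i j n : ℕ} (h : i + j = n) {X Y : S.Ob} (g : S.Hom i X Y)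
    (x : S.Hom j Y X) (m : M) :
    (S.comp h Y X Y ∘ₗ (TensorProduct.mk k (S.Hom i X Y) (S.Hom j Y X)).flip x).lTensor M
      (coTwist 𝓜 (S.act i X Y) (m ⊗ₜ g)) = tw 𝓜 h g x m := by
  rw [coTwist_tmul, lTensor_spread]
  rfl

/-- The Leibniz rule survives the twist because d commutes with the action of `H`. -/
theorem lTensor_del_tw {i i' j j' n n' : ℕ} (h : i + j = n) (hi : i + 1 = i') (hj : j + 1 = j')
    (hn : n + 1 = n') (h₁ : i' + j = n') (h₂ : i + j' = n') {X Y : S.Ob} (g : S.Hom i X Y)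
    (x : S.Hom j Y X) (m : M) :
    (S.del hn).lTensor M (tw 𝓜 h g x m) =
      tw 𝓜 h₁ (S.del hi g) x m + (-1 : k) ^ i • tw 𝓜 h₂ g (S.del hj x) m := by
  simp only [tw_apply, lTensor_spread]
  rw [← LinearMap.smul_apply, ← map_smul, ← LinearMap.add_apply, ← map_add]
  congr 2
  ext a
  simp only [LinearMap.comp_apply, LinearMap.add_apply, LinearMap.smul_apply, LinearMap.flip_apply,
    orbit_apply, DGHSemicat.act_del]
  exact DGHSemicat.del_mul h hi hj hn h₁ h₂ _ _

theorem lTensor_map_tw (F : DGHMap S S') {i j n : ℕ} (h : i + j = n) {X Y : S.Ob}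
    (g : S.Hom i X Y) (x : S.Hom j Y X) (m : M) :
    (F.map n Y Y).lTensor M (tw 𝓜 h g x m) =
      tw 𝓜 h (F.map i X Y g) (F.map j Y X x) m := by
  simp only [tw_apply, lTensor_spread]
  congr 2
  ext a
  simp only [LinearMap.comp_apply, LinearMap.flip_apply, orbit_apply, F.map_mul, F.map_act]

/-- Twisting by a product is twisting by the factors one after the other. -/
theorem tw_mul [IsCocomm k H] {i₁ i₂ i j j' n : ℕ} (hi : i₁ + i₂ = i) (h : i + j = n)
    (hj : i₂ + j = j') (h' : i₁ + j' = n) {X Y Z : S.Ob} (g₁ : S.Hom i₁ Y Z) (g₂ : S.Hom i₂ X Y)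
    (x : S.Hom j Z X) (m : M) :
    TensorProduct.lift (tw 𝓜 h' g₁ ∘ₗ (S.mul hj).flip x ∘ₗ orbit (S.act i₂ X Y) g₂)
      (𝓜.coact m) = tw 𝓜 h (S.mul hi g₁ g₂) x m := by
  -- `w a b` is (S⁻¹(b)g₁)((S⁻¹(a)g₂)x): the outer entry of the iterated coaction twists g₂, the
  -- inner one g₁. After `lift_spread` both come from one comultiplication, and the swapped form of
  -- the diagonal action of S⁻¹ on g₁ ⊗ g₂ matches this order.
  let w : H →ₗ[k] H →ₗ[k] S.Hom n Z Z :=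
    ((S.mul h' (X := Z) (Y := Y) (Z := Z)).flip.compl₁₂
      ((S.mul hj (X := Z)).flip x ∘ₗ orbit (S.act i₂ X Y) g₂) (orbit (S.act i₁ Y Z) g₁))
  have e : tw 𝓜 h' g₁ ∘ₗ (S.mul hj).flip x ∘ₗ orbit (S.act i₂ X Y) g₂ = spread 𝓜 ∘ₗ w := by
    ext1 a
    simp only [LinearMap.comp_apply, tw_apply]
    rfl
  rw [e, lift_spread, tw_apply]
  congr 2
  ext a
  simp only [LinearMap.comp_apply, LinearMap.flip_apply, orbit_apply]
  rw [← DGHSemicat.comp_tmul hi, S.act_comp, diagAct_antipodeInv_swap]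
  induction comul (R := k) a with
  | zero => simp
  | add s t hs ht => simp only [map_add, LinearMap.add_apply, hs, ht]
  | tmul s t =>
    simp only [TensorProduct.lift.tmul, TensorProduct.comm_tmul, TensorProduct.map_tmul, w,
      DGHSemicat.comp_tmul]
    exact (DGHSemicat.mul_assoc _ _ _ _ _ _ _).symm

end Twisted

end HopfCyclic

namespace HopfCyclic

/-! ### Cochains as functionals on universal forms. -/

section FormTrace

universe w v

variable {k H M : Type*} [Field k] [Ring H] [HopfAlgebra k H] [AddCommGroup M] [Module k M]
  (𝓜 : SAYDModule k H M)
  {D : Type u} [SmallCategory D] [Preadditive D] [Linear k D]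

/-- The functional `m ⊗ (f⁰ df¹ ... dfⁿ + dg¹ ... dgⁿ) ↦ φ(m ⊗ f⁰ ⊗ ... ⊗ fⁿ)`. -/
noncomputable def formTrace {n : ℕ} (φ : Cochain 𝓜 D n) (X : D) : M ⊗[k] Om k n X X →ₗ[k] k :=
  φ ∘ₗ (CN.of n X ∘ₗ Om.fst n X X).lTensor M

variable {𝓜}

theorem formTrace_tmul {n : ℕ} (φ : Cochain 𝓜 D n) {X : D} (m : M) (x : Om k n X X) :
    formTrace 𝓜 φ X (m ⊗ₜ x) = φ (m ⊗ₜ CN.of n X (Om.fst n X X x)) := rfl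

theorem formTrace_inl {n : ℕ} (φ : Cochain 𝓜 D n) {X : D} (m : M) (a : strand k n X X) :
    formTrace 𝓜 φ X (m ⊗ₜ Om.inl n X X a) = φ (m ⊗ₜ CN.of n X a) := rfl

theorem formTrace_d {i n : ℕ} (φ : Cochain 𝓜 D n) (h : i + 1 = n) {X : D} (m : M)
    (x : Om k i X X) : formTrace 𝓜 φ X (m ⊗ₜ Om.d h X X x) = 0 := by
  subst h
  rw [formTrace_tmul]
  have e : Om.fst (i + 1) X X (Om.d rfl X X x) = 0 := rfl
  rw [e, map_zero, TensorProduct.tmul_zero, map_zero]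

theorem tensorCN_induction {n : ℕ} {motive : M ⊗[k] CN k D n → Prop} (x : M ⊗[k] CN k D n)
    (zero : motive 0) (add : ∀ a b, motive a → motive b → motive (a + b))
    (of : ∀ (m : M) (X : D) (a : strand k n X X), motive (m ⊗ₜ CN.of n X a)) : motive x := by
  induction x with
  | zero => exact zero
  | add x y hx hy => exact add _ _ hx hy
  | tmul m x =>
    induction x using CN.induction with
    | zero => rw [TensorProduct.tmul_zero]; exact zero
    | add x y hx hy => rw [TensorProduct.tmul_add]; exact add _ _ hx hy
    | of X a => exact of m X a

theorem cochain_ext {n : ℕ} {φ ψ : Cochain 𝓜 D n}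
    (h : ∀ (m : M) (X : D) (a : strand k n X X), φ (m ⊗ₜ CN.of n X a) = ψ (m ⊗ₜ CN.of n X a)) :
    φ = ψ := by
  refine LinearMap.ext fun x => ?_
  induction x using tensorCN_induction with
  | zero => simp
  | add x y hx hy => simp only [map_add, hx, hy]
  | of m X a => exact h m X a

theorem cochain_ext_snoc {n : ℕ} {φ ψ : Cochain 𝓜 D (n + 1)}
    (h : ∀ (m : M) (X Z : D) (a : strand k n X Z) (f : X ⟶ Z),
      φ (m ⊗ₜ CN.of (n + 1) X (strandSnoc n X Z X (a ⊗ₜ f))) =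
        ψ (m ⊗ₜ CN.of (n + 1) X (strandSnoc n X Z X (a ⊗ₜ f)))) : φ = ψ := by
  refine cochain_ext fun m X a => ?_
  induction a using strand_snoc_induction with
  | zero => simp
  | add a b ha hb => simp only [map_add, TensorProduct.tmul_add, ha, hb]
  | snoc Z a f => exact h m X Z a f

variable [HCategory k H D]

theorem mem_invariantCochains_iff {n : ℕ} (φ : Cochain 𝓜 D n) :
    φ ∈ invariantCochains 𝓜 D n ↔ ∀ (X : D) (h : H) (x : M ⊗[k] Om k n X X),
      formTrace 𝓜 φ X (twistedRact 𝓜 (Om.act n X X) h x) =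
        counit (R := k) h * formTrace 𝓜 φ X x := by
  have e : ∀ (X : D) (h : H) (x : M ⊗[k] Om k n X X),
      (CN.of n X ∘ₗ Om.fst n X X).lTensor M (twistedRact 𝓜 (Om.act n X X) h x) =
      twistedRact 𝓜 (CN.act n) h ((CN.of n X ∘ₗ Om.fst n X X).lTensor M x) := fun X =>
    twistedRact_map 𝓜 _ _ _ fun h x => (CN.act_of h _).symm
  constructor
  · intro hφ X h x
    simp only [formTrace, LinearMap.comp_apply]
    rw [e]
    exact hφ h _
  · intro hφ h x
    induction x using tensorCN_induction with
    | zero => simp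
    | add x y hx hy => simp only [map_add, hx, hy, mul_add]
    | of m X a =>
      have := hφ X h (m ⊗ₜ Om.inl n X X a)
      simp only [formTrace, LinearMap.comp_apply] at this
      rw [e] at this
      exact this

/-- Multiplying f⁰df¹…dfⁿ by f on the right produces all faces of f⁰ ⊗ … ⊗ fⁿ ⊗ f except the cyclic
one. Up to sign this is the part of bφ that does not involve the coaction. -/
theorem formTrace_inl_mul_of {n : ℕ} (φ : Cochain 𝓜 D n) {X Z : D} (m : M) (a : strand k n X Z)
    (f : X ⟶ Z) :
    formTrace 𝓜 φ X (m ⊗ₜ Om.mul (add_zero n) X Z X (Om.inl n Z X a) (Om.of X Z f)) =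
      ∑ i : Fin (n + 1), (-1 : k) ^ (n + (i : ℕ)) *
        φ (m ⊗ₜ CN.of n X (strandFace n i X X (strandSnoc n X Z X (a ⊗ₜ f)))) := by
  have e := (Om.incl k H D).word_mul_map a f
  rw [Om.incl_word] at e
  refine (congrArg (fun z => formTrace 𝓜 φ X (m ⊗ₜ z)) e).trans ?_
  simp only [Om.incl_word]
  have e2 : ∀ t : Finset (Fin (n + 1)), formTrace 𝓜 φ X (m ⊗ₜ ∑ i ∈ t, (-1 : k) ^ (n + (i : ℕ)) •
      Om.inl n X X (strandFace n i X X (strandSnoc n X Z X (a ⊗ₜ f)))) =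
      ∑ i ∈ t, (-1 : k) ^ (n + (i : ℕ)) *
        φ (m ⊗ₜ CN.of n X (strandFace n i X X (strandSnoc n X Z X (a ⊗ₜ f)))) := by
    intro t
    simp only [TensorProduct.tmul_sum, TensorProduct.tmul_smul, map_sum, map_smul, smul_eq_mul,
      formTrace_inl]
  exact e2 _

/-- In `dword_mul_map` the words of faces are exact, hence invisible to the functional; only the
word dg¹…dgⁿ⁺¹ with its first d removed and df added at the end contributes. -/
theorem formTrace_dform_mul_of {n : ℕ} (φ : Cochain 𝓜 D (n + 1)) {X Z : D} (m : M)
    (a : strand k n X Z) (f : X ⟶ Z) :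
    formTrace 𝓜 φ X
        (m ⊗ₜ Om.mul (add_zero (n + 1)) X Z X (Om.dform n Z X a) (Om.of X Z f)) =
      -((-1 : k) ^ n * φ (m ⊗ₜ CN.of (n + 1) X (strandSnoc n X Z X (a ⊗ₜ f)))) := by
  have e := (Om.incl k H D).dword_mul_map a f
  rw [Om.incl_dword] at e
  simp only [Om.incl_word, Om.incl_dword] at e
  refine (congrArg (fun z => formTrace 𝓜 φ X (m ⊗ₜ z)) e).trans ?_
  have e2 : ∀ b c : Om k (n + 1) X X, formTrace 𝓜 φ X (m ⊗ₜ b) = 0 →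
      formTrace 𝓜 φ X (m ⊗ₜ (b - (-1 : k) ^ n • c)) =
      -((-1 : k) ^ n * formTrace 𝓜 φ X (m ⊗ₜ c)) := by
    intro b c hb
    rw [TensorProduct.tmul_sub, map_sub, hb, zero_sub, TensorProduct.tmul_smul, map_smul,
      smul_eq_mul]
  refine e2 _ _ ?_
  have e3 : ∀ t : Finset (Fin (n + 1)), formTrace 𝓜 φ X (m ⊗ₜ ∑ i ∈ t, (-1 : k) ^ (n + (i : ℕ)) •
      Om.dform n X X (strandFace n i X X (strandSnoc n X Z X (a ⊗ₜ f)))) = 0 := by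
    intro t
    simp only [TensorProduct.tmul_sum, TensorProduct.tmul_smul, map_sum, map_smul, smul_eq_mul]
    exact Finset.sum_eq_zero fun i _ => mul_eq_zero_of_right _ (formTrace_d φ rfl m (Om.inl n X X _))
  exact e3 _

variable [BijectiveAntipode k H]

theorem cyclicOp_snoc {n : ℕ} {X Z : D} (m : M) (a : strand k n X Z) (f : X ⟶ Z) :
    cyclicOp 𝓜 D (n + 1) (m ⊗ₜ CN.of (n + 1) X (strandSnoc n X Z X (a ⊗ₜ f))) =
      spread 𝓜 (CN.of (n + 1) Z ∘ₗ strandCons n Z X Z ∘ₗ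
        (TensorProduct.mk k (X ⟶ Z) (strand k n X Z)).flip a ∘ₗ
        orbit (HCategory.act (k := k) X Z) f) m := by
  rw [cyclicOp, LinearMap.comp_apply, LinearMap.lTensor_tmul, CN.rotate_snoc, coTwist_tmul]
  congr 2
  ext h
  simp only [orbit_apply, CN.actHead_of, strandActHead_cons]
  rfl

theorem cyclicOp_one {X : D} (m : M) (f : X ⟶ X) :
    cyclicOp 𝓜 D 0 (m ⊗ₜ CN.of 0 X (strandOne X X f)) =
      spread 𝓜 (CN.of 0 X ∘ₗ (strandOne X X).toLinearMap ∘ₗ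
        orbit (HCategory.act (k := k) X X) f) m := by
  rw [cyclicOp, LinearMap.comp_apply, LinearMap.lTensor_tmul]
  have e : CN.rotate 0 (CN.of 0 X (strandOne (k := k) X X f)) = CN.of 0 X (strandOne X X f) := rfl
  rw [e, coTwist_tmul]
  congr 2
  ext h
  simp only [orbit_apply, CN.actHead_of]
  rfl

theorem CN.face_of {n : ℕ} (i : Fin (n + 1)) {X : D} (a : strand k (n + 1) X X) :
    CN.face n i (CN.of (n + 1) X a) = CN.of n X (strandFace n i X X a) := by
  simp [CN.face]

/-- The last face rotates f, twisted by S⁻¹(m₍₋₁₎), to the front and then composes it with the first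
factor of a. Isolating it puts bφ in the shape of a commutator with f. -/
theorem hochschild_snoc {n : ℕ} (φ : Cochain 𝓜 D n) {X Z : D} (m : M) (a : strand k n X Z)
    (f : X ⟶ Z) :
    hochschild 𝓜 D n φ (m ⊗ₜ CN.of (n + 1) X (strandSnoc n X Z X (a ⊗ₜ f))) =
      ∑ i : Fin (n + 1), (-1 : k) ^ (i : ℕ) *
        φ (m ⊗ₜ CN.of n X (strandFace n i X X (strandSnoc n X Z X (a ⊗ₜ f)))) +
      (-1 : k) ^ (n + 1) * φ (spread 𝓜 (CN.of n Z ∘ₗ strandComp n Z X Z ∘ₗ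
        (TensorProduct.mk k (X ⟶ Z) (strand k n X Z)).flip a ∘ₗ
        orbit (HCategory.act (k := k) X Z) f) m) := by
  simp only [hochschild, LinearMap.sum_apply, LinearMap.smul_apply, LinearMap.lcomp_apply,
    smul_eq_mul, faceOp]
  rw [Fin.sum_univ_castSucc]
  simp only [Fin.lastCases_castSucc, Fin.lastCases_last, LinearMap.lTensor_tmul, CN.face_of,
    Fin.val_castSucc, Fin.val_last, LinearMap.comp_apply]
  congr 3
  rw [cyclicOp_snoc, lTensor_spread]
  congr 2
  ext h
  simp only [LinearMap.comp_apply, CN.face_of, LinearMap.flip_apply, TensorProduct.mk_apply,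
    HSemifunctor.strandFace_zero_cons]

variable (𝓜) in
/-- `m ↦ m₍₀₎ ⊗ (S⁻¹(m₍₋₁₎) g) x` for forms `g` and `x`. -/
noncomputable def Om.twist {i j n : ℕ} (h : i + j = n) (X Y : D) :
    Om k i X Y →ₗ[k] Om k j Y X →ₗ[k] M →ₗ[k] M ⊗[k] Om k n Y Y :=
  tw (S := Om.semicat k H D) 𝓜 h

theorem Om.twist_apply {i j n : ℕ} (h : i + j = n) {X Y : D} (g : Om k i X Y) (x : Om k j Y X) :
    Om.twist 𝓜 h X Y g x = spread 𝓜 ((Om.mul h Y X Y).flip x ∘ₗ orbit (Om.act i X Y) g) := rfl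

theorem formTrace_twist_inl {n : ℕ} (φ : Cochain 𝓜 D n) {X Z : D} (m : M) (a : strand k n X Z)
    (f : X ⟶ Z) :
    formTrace 𝓜 φ Z
        (Om.twist 𝓜 (zero_add n) X Z (Om.of X Z f) (Om.inl n Z X a) m) =
      φ (spread 𝓜 (CN.of n Z ∘ₗ strandComp n Z X Z ∘ₗ
        (TensorProduct.mk k (X ⟶ Z) (strand k n X Z)).flip a ∘ₗ
        orbit (HCategory.act (k := k) X Z) f) m) := by
  rw [Om.twist_apply, formTrace, LinearMap.comp_apply]
  refine congrArg φ ((lTensor_spread 𝓜 _ _ m).trans ?_)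
  congr 2
  ext h
  simp only [LinearMap.comp_apply, orbit_apply, LinearMap.flip_apply, TensorProduct.mk_apply,
    Om.act_of, Om.zero_mul_of, Om.head_inl, Om.fst_inl]

theorem formTrace_twist_dform {n : ℕ} (φ : Cochain 𝓜 D (n + 1)) {X Z : D} (m : M)
    (a : strand k n X Z) (f : X ⟶ Z) :
    formTrace 𝓜 φ Z
        (Om.twist 𝓜 (zero_add (n + 1)) X Z (Om.of X Z f) (Om.dform n Z X a) m) =
      φ (cyclicOp 𝓜 D (n + 1) (m ⊗ₜ CN.of (n + 1) X (strandSnoc n X Z X (a ⊗ₜ f)))) := by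
  rw [Om.twist_apply, formTrace, LinearMap.comp_apply, cyclicOp_snoc]
  refine congrArg φ ((lTensor_spread 𝓜 _ _ m).trans ?_)
  congr 2
  ext h
  simp only [LinearMap.comp_apply, orbit_apply, LinearMap.flip_apply, TensorProduct.mk_apply,
    Om.act_of, Om.zero_mul_of, Om.head_dform, Om.fst_inl]

/-- The failure of the trace property on `f⁰ df¹ ... dfⁿ` and `f` is measured by `b φ`. -/
theorem formTrace_commutator_inl {n : ℕ} (φ : Cochain 𝓜 D n) {X Z : D} (m : M)
    (a : strand k n X Z) (f : X ⟶ Z) :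
    formTrace 𝓜 φ X (m ⊗ₜ Om.mul (add_zero n) X Z X (Om.inl n Z X a) (Om.of X Z f)) -
      formTrace 𝓜 φ Z
        (Om.twist 𝓜 (zero_add n) X Z (Om.of X Z f) (Om.inl n Z X a) m) =
      (-1) ^ n * hochschild 𝓜 D n φ (m ⊗ₜ CN.of (n + 1) X (strandSnoc n X Z X (a ⊗ₜ f))) := by
  rw [formTrace_inl_mul_of, formTrace_twist_inl, hochschild_snoc, mul_add, Finset.mul_sum,
    sub_eq_add_neg]
  congr 1
  · simp only [pow_add, mul_assoc]
  · rw [← mul_assoc, ← pow_add, Odd.neg_one_pow ⟨n, by ring⟩, neg_one_mul]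

/-- The failure of the trace property on `dg¹ ... dgⁿ⁺¹` and `f` is measured by `φ - λ φ`. -/
theorem formTrace_commutator_dform {n : ℕ} (φ : Cochain 𝓜 D (n + 1)) {X Z : D} (m : M)
    (a : strand k n X Z) (f : X ⟶ Z) :
    formTrace 𝓜 φ X
        (m ⊗ₜ Om.mul (add_zero (n + 1)) X Z X (Om.dform n Z X a) (Om.of X Z f)) -
      formTrace 𝓜 φ Z
        (Om.twist 𝓜 (zero_add (n + 1)) X Z (Om.of X Z f) (Om.dform n Z X a) m) =
      (-1) ^ (n + 1) * (φ - cyclicSigned 𝓜 D (n + 1) φ)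
        (m ⊗ₜ CN.of (n + 1) X (strandSnoc n X Z X (a ⊗ₜ f))) := by
  rw [formTrace_dform_mul_of, formTrace_twist_dform, LinearMap.sub_apply, cyclicSigned,
    LinearMap.smul_apply, mul_sub, LinearMap.smul_apply, smul_eq_mul, ← mul_assoc, ← pow_add,
    Even.neg_one_pow ⟨n + 1, rfl⟩, LinearMap.lcomp_apply]
  ring

theorem mem_cyclicCochains_iff {n : ℕ} (φ : Cochain 𝓜 D n) : φ ∈ cyclicCochains 𝓜 D n ↔
    φ ∈ invariantCochains 𝓜 D n ∧ cyclicSigned 𝓜 D n φ = φ := by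
  rw [cyclicCochains, Submodule.mem_inf, LinearMap.mem_ker, LinearMap.sub_apply,
    LinearMap.id_apply, sub_eq_zero, eq_comm (a := φ)]

theorem cyclicSigned_succ_iff {n : ℕ} (φ : Cochain 𝓜 D (n + 1)) :
    cyclicSigned 𝓜 D (n + 1) φ = φ ↔ ∀ (X Z : D) (m : M) (a : strand k n X Z) (f : X ⟶ Z),
      formTrace 𝓜 φ X
        (m ⊗ₜ Om.mul (add_zero (n + 1)) X Z X (Om.dform n Z X a) (Om.of X Z f)) =
      formTrace 𝓜 φ Z
        (Om.twist 𝓜 (zero_add (n + 1)) X Z (Om.of X Z f) (Om.dform n Z X a) m) := by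
  constructor
  · intro h X Z m a f
    rw [← sub_eq_zero, formTrace_commutator_dform, h, sub_self, LinearMap.zero_apply, mul_zero]
  · intro h
    refine (sub_eq_zero.mp (cochain_ext_snoc fun m X Z a f => ?_)).symm
    have e := formTrace_commutator_dform φ m a f
    rw [h, sub_self] at e
    rw [LinearMap.zero_apply]
    exact (mul_eq_zero.mp e.symm).resolve_left (by simp)

/-- Degree zero is separate because there are no words dg¹…dgⁿ that could detect cyclicity: the
rotation only twists the single factor by the coaction. -/
theorem cyclicSigned_zero_iff (φ : Cochain 𝓜 D 0) :
    cyclicSigned 𝓜 D 0 φ = φ ↔ ∀ (X : D) (m : M) (f : X ⟶ X),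
      φ (spread 𝓜 (CN.of 0 X ∘ₗ (strandOne X X).toLinearMap ∘ₗ
        orbit (HCategory.act (k := k) X X) f) m) = φ (m ⊗ₜ CN.of 0 X (strandOne X X f)) := by
  have e : ∀ (X : D) (m : M) (f : X ⟶ X), cyclicSigned 𝓜 D 0 φ (m ⊗ₜ CN.of 0 X (strandOne X X f)) =
      φ (spread 𝓜 (CN.of 0 X ∘ₗ (strandOne X X).toLinearMap ∘ₗ
        orbit (HCategory.act (k := k) X X) f) m) := by
    intro X m f
    rw [cyclicSigned, pow_zero, one_smul, LinearMap.lcomp_apply, cyclicOp_one]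
  constructor
  · intro h X m f
    rw [← e, h]
  · intro h
    refine cochain_ext fun m X a => ?_
    obtain ⟨f, rfl⟩ := (strandOne X X).surjective a
    rw [e, h]

theorem hochschild_eq_zero_iff {n : ℕ} (φ : Cochain 𝓜 D n) :
    hochschild 𝓜 D n φ = 0 ↔ ∀ (X Z : D) (m : M) (a : strand k n X Z) (f : X ⟶ Z),
      formTrace 𝓜 φ X (m ⊗ₜ Om.mul (add_zero n) X Z X (Om.inl n Z X a) (Om.of X Z f)) =
      formTrace 𝓜 φ Z
        (Om.twist 𝓜 (zero_add n) X Z (Om.of X Z f) (Om.inl n Z X a) m) := by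
  constructor
  · intro h X Z m a f
    rw [← sub_eq_zero, formTrace_commutator_inl, h, LinearMap.zero_apply, mul_zero]
  · intro h
    refine cochain_ext_snoc fun m X Z a f => ?_
    have e := formTrace_commutator_inl φ m a f
    rw [h, sub_self] at e
    rw [LinearMap.zero_apply]
    exact (mul_eq_zero.mp e.symm).resolve_left (by simp)

theorem mem_cocycles_iff {n : ℕ} (φ : Cochain 𝓜 D n) : φ ∈ cocycles 𝓜 D n ↔
    φ ∈ invariantCochains 𝓜 D n ∧ cyclicSigned 𝓜 D n φ = φ ∧ hochschild 𝓜 D n φ = 0 := by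
  rw [cocycles, Submodule.mem_inf, LinearMap.mem_ker, mem_cyclicCochains_iff, and_assoc]

/-- For a cyclic cocycle `φ`, the associated functional on forms commutes with morphisms. -/
theorem formTrace_commutator {n : ℕ} {φ : Cochain 𝓜 D n} (hφ : φ ∈ cocycles 𝓜 D n) {X Z : D}
    (m : M) (x : Om k n Z X) (f : X ⟶ Z) :
    formTrace 𝓜 φ X (m ⊗ₜ Om.mul (add_zero n) X Z X x (Om.of X Z f)) =
      formTrace 𝓜 φ Z (Om.twist 𝓜 (zero_add n) X Z (Om.of X Z f) x m) := by
  obtain ⟨-, h2, h3⟩ := (mem_cocycles_iff φ).mp hφ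
  rw [hochschild_eq_zero_iff] at h3
  cases n with
  | zero =>
    obtain ⟨a, rfl⟩ := Om.exists_eq_inl x
    exact h3 X Z m a f
  | succ n =>
    rw [cyclicSigned_succ_iff] at h2
    obtain ⟨a, b, rfl⟩ := Om.exists_eq_inl_add_dform x
    refine Eq.trans ?_ ((congrArg₂ (· + ·) (h3 X Z m a f) (h2 X Z m b f)).trans ?_)
    · rw [← map_add, ← TensorProduct.tmul_add]
      rw [map_add, LinearMap.add_apply]
    · rw [← map_add, ← LinearMap.add_apply]
      rw [map_add]

end FormTrace

end HopfCyclic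

namespace HopfCyclic

/-! ### Cyclic cocycles, closed graded traces and characters. -/

section Characters

universe w v w' v'

variable {k H M : Type*} [Field k] [Ring H] [HopfAlgebra k H] [AddCommGroup M] [Module k M]
  {𝓜 : SAYDModule k H M} [BijectiveAntipode k H]

section General

variable {S : DGHSemicat.{w, v} k H} {S' : DGHSemicat.{w', v'} k H} {n : ℕ}
  {T : ∀ X : S.Ob, M ⊗[k] S.Hom n X X →ₗ[k] k}

theorem IsClosedGradedTrace.mul_swap (hT : IsClosedGradedTrace 𝓜 S n T) {i j : ℕ} (h : j + i = n)
    (h' : i + j = n) {X Y : S.Ob} (m : M) (g : S.Hom i X Y) (x : S.Hom j Y X) :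
    T X (m ⊗ₜ S.mul h x g) = (-1 : k) ^ (i * j) * T Y (tw 𝓜 h' g x m) := by
  rw [← coTwist_comp]
  exact hT.graded h h' X Y m g x

theorem IsClosedGradedTrace.of_mul_swap
    (invariant : ∀ (X : S.Ob) (h : H) (x : M ⊗[k] S.Hom n X X),
      T X (twistedRact 𝓜 (S.act n X X) h x) = counit (R := k) h * T X x)
    (closed : ∀ {i : ℕ} (h : i + 1 = n) (X : S.Ob) (m : M) (f : S.Hom i X X),
      T X (m ⊗ₜ S.d h X X f) = 0)
    (mul_swap : ∀ {i j : ℕ} (h : j + i = n) (h' : i + j = n) (X Y : S.Ob) (m : M)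
      (g : S.Hom i X Y) (x : S.Hom j Y X),
      T X (m ⊗ₜ S.mul h x g) = (-1 : k) ^ (i * j) * T Y (tw 𝓜 h' g x m)) :
    IsClosedGradedTrace 𝓜 S n T where
  invariant := invariant
  closed {_} h X m f := closed h X m f
  graded {_ _} h h' X Y m g x := by
    rw [coTwist_comp]
    exact mul_swap h h' X Y m g x

/-- The pullback of a closed graded trace along a map of DGH-semicategories. -/
theorem IsClosedGradedTrace.comp {T : ∀ X : S'.Ob, M ⊗[k] S'.Hom n X X →ₗ[k] k}
    (hT : IsClosedGradedTrace 𝓜 S' n T) (F : DGHMap S S') :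
    IsClosedGradedTrace 𝓜 S n fun X => T (F.obj X) ∘ₗ (F.map n X X).lTensor M := by
  refine .of_mul_swap (fun X h x => ?_) (fun {i} h X m f => ?_)
    fun {i j} h h' X Y m g x => ?_
  · rw [LinearMap.comp_apply, twistedRact_map 𝓜 _ (S'.act n _ _) _ (fun h x => F.map_act h x),
      hT.invariant]
    rfl
  · exact (congrArg (fun z => T (F.obj X) (m ⊗ₜ z)) (F.map_del h f)).trans (hT.closed h _ m _)
  · rw [LinearMap.comp_apply, LinearMap.comp_apply, lTensor_map_tw, LinearMap.lTensor_tmul,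
      F.map_mul, hT.mul_swap h h']

end General

variable {D : Type u} [SmallCategory D] [Preadditive D] [Linear k D] [HCategory k H D]

theorem Om.twist_mul [IsCocomm k H] {i₁ i₂ i j j' n : ℕ} (hi : i₁ + i₂ = i) (h : i + j = n)
    (hj : i₂ + j = j') (h' : i₁ + j' = n) {X Y Z : D} (g₁ : Om k i₁ Y Z) (g₂ : Om k i₂ X Y)
    (x : Om k j Z X) (m : M) :
    TensorProduct.lift (Om.twist 𝓜 h' Y Z g₁ ∘ₗ (Om.mul hj Z X Y).flip x ∘ₗ
      orbit (Om.act i₂ X Y) g₂) (𝓜.coact m) = Om.twist 𝓜 h X Z (Om.mul hi X Y Z g₁ g₂) x m :=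
  tw_mul (S := Om.semicat k H D) 𝓜 hi h hj h' g₁ g₂ x m

theorem Om.lTensor_d_twist {i i' j j' n n' : ℕ} (h : i + j = n) (hi : i + 1 = i') (hj : j + 1 = j')
    (hn : n + 1 = n') (h₁ : i' + j = n') (h₂ : i + j' = n') {X Y : D} (g : Om k i X Y)
    (x : Om k j Y X) (m : M) :
    (Om.d hn Y Y).lTensor M (Om.twist 𝓜 h X Y g x m) =
      Om.twist 𝓜 h₁ X Y (Om.d hi X Y g) x m +
        (-1 : k) ^ i • Om.twist 𝓜 h₂ X Y g (Om.d hj Y X x) m :=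
  lTensor_del_tw (S := Om.semicat k H D) 𝓜 h hi hj hn h₁ h₂ g x m

theorem formTrace_lTensor_d {i n : ℕ} (φ : Cochain 𝓜 D n) (h : i + 1 = n) {X : D}
    (x : M ⊗[k] Om k i X X) : formTrace 𝓜 φ X ((Om.d h X X).lTensor M x) = 0 := by
  induction x with
  | zero => simp
  | add x y hx hy => simp only [map_add, hx, hy, add_zero]
  | tmul m f => exact formTrace_d φ h m f

/-- The forms g that can be moved around the trace past every x include the morphisms, by
`formTrace_commutator`. They are stable under d because the functional kills exact forms, and under
left multiplication by a morphism f because x(fg) = (xf)g allows g and then f to be moved, the two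
twists combining by `Om.twist_mul`. -/
theorem formTrace_mul_swap [IsCocomm k H] {n : ℕ} {φ : Cochain 𝓜 D n} (hφ : φ ∈ cocycles 𝓜 D n)
    {i j : ℕ} (h : j + i = n) (h' : i + j = n) {X Y : D} (m : M) (g : Om k i X Y)
    (x : Om k j Y X) :
    formTrace 𝓜 φ X (m ⊗ₜ Om.mul h X Y X x g) =
      (-1 : k) ^ (i * j) * formTrace 𝓜 φ Y (Om.twist 𝓜 h' X Y g x m) := by
  induction g using Om.induction generalizing j m with
  | zero => simp
  | add i X Y g g' hg hg' =>
    simp only [map_add, TensorProduct.tmul_add, LinearMap.add_apply, hg h h', hg' h h', mul_add]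
  | of X Y f =>
    obtain rfl : j = n := h
    rw [zero_mul, pow_zero, one_mul, formTrace_commutator hφ]
  | d i X Y g hg =>
    subst h'
    -- Integration by parts on both sides: the functional vanishes on d(xg) and on the differential
    -- of the twisted product of g and x. The Leibniz rule then expresses the claim for dg and x
    -- through the known one for g and dx.
    have e1 : formTrace 𝓜 φ X (m ⊗ₜ Om.d (n := i + 1 + j) (by omega) X X
        (Om.mul (n := i + j) (by omega) X Y X x g)) = 0 := formTrace_d φ _ m _
    have e2 := formTrace_lTensor_d φ (n := i + 1 + j) (by omega)
      (Om.twist 𝓜 (n := i + j) rfl X Y g x m)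
    rw [Om.lTensor_d_twist (𝓜 := 𝓜) rfl rfl rfl _ rfl (by omega), map_add, map_smul,
      smul_eq_mul] at e2
    have e3 := Om.d_mul (m := i + j) (n := i + 1 + j) rfl rfl (by omega) (by omega) (by omega) h x g
    have e4 := hg (j := j + 1) (by omega) (by omega) m (Om.d rfl Y X x)
    rw [e3, TensorProduct.tmul_sub, map_sub, e1, zero_sub, TensorProduct.tmul_smul, map_smul,
      smul_eq_mul] at e4
    have s1 : (-1 : k) ^ j * (-1) ^ j = 1 := by rw [← mul_pow]; simp
    have s2 : (-1 : k) ^ i * (-1) ^ i = 1 := by rw [← mul_pow]; simp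
    have s3 : (-1 : k) ^ (i * (j + 1)) = (-1) ^ (i * j) * (-1) ^ i := by ring
    have s4 : (-1 : k) ^ ((i + 1) * j) = (-1) ^ (i * j) * (-1) ^ j := by ring
    rw [s3] at e4
    rw [s4]
    linear_combination (-1 : k) ^ j * (-e4) - (formTrace 𝓜 φ X (m ⊗ₜ Om.mul h X Y X x (Om.d rfl X Y g))) * s1 +
      (-1 : k) ^ j * (-1) ^ (i * j) * (-e2)
  | head i X Y Z f g hg =>
    -- Moving g first leaves the twisted g times xf. Reassociated, this ends in f, which is moved
    -- next with the coaction of m₍₀₎. The morphism f has degree zero, so the sign stays that of g.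
    have e1 : Om.mul h X Z X x (Om.head i X Y Z (f ⊗ₜ g)) =
        Om.mul h X Y X (Om.mul (add_zero j) Y Z X x (Om.of Y Z f)) g := by
      rw [← Om.zero_mul_of, Om.mul_assoc]
    rw [e1, hg h h', ← Om.zero_mul_of, ← Om.twist_mul _ h' h' (zero_add n), Om.twist_apply,
      apply_spread]
    congr 1
    generalize 𝓜.coact m = z
    induction z with
    | zero => simp
    | add z z' hz hz' => simp only [map_add, hz, hz']
    | tmul a m =>
      simp only [TensorProduct.lift.tmul, LinearMap.comp_apply, LinearMap.flip_apply,
        TensorProduct.curry_apply]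
      rw [← Om.mul_assoc h' _ (add_zero n), formTrace_commutator hφ]

/-- A cyclic cocycle defines a closed graded trace on universal forms. -/
theorem formTrace_isClosedGradedTrace [IsCocomm k H] {n : ℕ} {φ : Cochain 𝓜 D n}
    (hφ : φ ∈ cocycles 𝓜 D n) :
    IsClosedGradedTrace 𝓜 (Om.semicat k H D) n fun X : D => formTrace 𝓜 φ X :=
  .of_mul_swap ((mem_invariantCochains_iff φ).mp ((mem_cocycles_iff φ).mp hφ).1)
    (fun {_} h X m f => formTrace_d φ h m f)
    fun {_ _} h h' _ _ m g x => formTrace_mul_swap hφ h h' m g x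

/-- A cochain of degree zero whose functional commutes with morphisms is cyclic. -/
theorem cyclicSigned_zero_of_commutator (φ : Cochain 𝓜 D 0)
    (hφ : ∀ (X : D) (m : M) (f : X ⟶ X),
      formTrace 𝓜 φ X (m ⊗ₜ Om.mul (add_zero 0) X X X (Om.of X X (𝟙 X)) (Om.of X X f)) =
      formTrace 𝓜 φ X
        (Om.twist 𝓜 (zero_add 0) X X (Om.of X X f) (Om.of X X (𝟙 X)) m)) :
    cyclicSigned 𝓜 D 0 φ = φ := by
  refine (cyclicSigned_zero_iff φ).mpr fun X m f => ?_
  have e := hφ X m f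
  -- The commutator is used with the identity as other factor: f composed with id on one side, and
  -- the twisted f composed with id on the other, which is the rotation in degree zero.
  have e0 := formTrace_twist_inl φ m (strandOne X X (𝟙 X)) f
  have e1 : Om.mul (k := k) (add_zero 0) X X X (Om.of X X (𝟙 X))
      (Om.of X X f) = Om.inl 0 X X (strandOne X X f) := by
    refine (Om.zero_mul_of (𝟙 X) _).trans ((Om.head_inl _ _).trans ?_)
    exact congrArg (Om.inl 0 X X) ((Om.strandComp_one _ _).trans
      (congrArg _ (Category.comp_id f)))
  rw [e1, formTrace_inl] at e
  rw [e]
  refine Eq.trans ?_ e0.symm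
  congr 3
  ext h
  simp only [LinearMap.comp_apply, LinearMap.flip_apply, TensorProduct.mk_apply,
    Om.strandComp_one, Category.id_comp, LinearEquiv.coe_coe]

/-- Apart from invariance, only the trace property against morphisms of `D` enters: tested on words
of the first kind it is bφ = 0, on words of the second kind it is cyclicity. -/
theorem mem_cocycles_of_isClosedGradedTrace {n : ℕ} {φ : Cochain 𝓜 D n}
    (hφ : IsClosedGradedTrace 𝓜 (Om.semicat k H D) n fun X : D => formTrace 𝓜 φ X) :
    φ ∈ cocycles 𝓜 D n := by
  have comm : ∀ {X Z : D} (m : M) (x : Om k n Z X) (f : X ⟶ Z),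
      formTrace 𝓜 φ X (m ⊗ₜ Om.mul (add_zero n) X Z X x (Om.of X Z f)) =
      formTrace 𝓜 φ Z (Om.twist 𝓜 (zero_add n) X Z (Om.of X Z f) x m) := by
    intro X Z m x f
    refine (hφ.mul_swap (add_zero n) (zero_add n) m (Om.of X Z f) x).trans ?_
    rw [zero_mul, pow_zero, one_mul]
    rfl
  refine (mem_cocycles_iff φ).mpr ⟨(mem_invariantCochains_iff φ).mpr hφ.invariant, ?_,
    (hochschild_eq_zero_iff φ).mpr fun X Z m a f => comm m _ f⟩
  cases n with
  | zero => exact cyclicSigned_zero_of_commutator φ fun X m f => comm m _ f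
  | succ n => exact (cyclicSigned_succ_iff φ).mpr fun X Z m a f => comm m _ f

theorem CycleOver.character_of {n : ℕ} (C : CycleOver.{u, w, v} D 𝓜 n) (m : M) {X : D}
    (a : strand k n X X) :
    C.character (m ⊗ₜ CN.of n X a) = C.T (C.ρ.obj X) (m ⊗ₜ C.ρ.word n X X a) := by
  simp [CycleOver.character]

/-- On words of the first kind this is the definition of the character. On words dg¹…dgⁿ both sides
vanish, the right one because the image is exact and T is closed. -/
theorem formTrace_character {n : ℕ} (C : CycleOver.{u, w, v} D 𝓜 n) (X : D) :
    formTrace 𝓜 C.character X = C.T (C.ρ.obj X) ∘ₗ (Om.liftMap C.ρ n X X).lTensor M := by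
  have e : ∀ (m : M) (a : strand k n X X), formTrace 𝓜 C.character X (m ⊗ₜ Om.inl n X X a) =
      C.T (C.ρ.obj X) (m ⊗ₜ Om.liftMap C.ρ n X X (Om.inl n X X a)) := by
    intro m a
    rw [formTrace_inl, C.character_of, Om.liftMap_inl]
  ext m x
  change formTrace 𝓜 C.character X (m ⊗ₜ x) =
      C.T (C.ρ.obj X) (m ⊗ₜ Om.liftMap C.ρ n X X x)
  cases n with
  | zero =>
    obtain ⟨a, rfl⟩ := Om.exists_eq_inl x
    exact e m a
  | succ n =>
    obtain ⟨a, b, rfl⟩ := Om.exists_eq_inl_add_dform x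
    have e2 : formTrace 𝓜 C.character X (m ⊗ₜ Om.dform n X X b) = 0 :=
      formTrace_d _ rfl m (Om.inl n X X b)
    rw [map_add, TensorProduct.tmul_add, TensorProduct.tmul_add, map_add, map_add, e, e2,
      Om.liftMap_dform, ← HSemifunctor.del_word_rfl, C.isTrace.closed rfl]

/-- The trace of the cycle pulls back along `Om.lift` to a closed graded trace on forms, and this
pullback is the functional of the character. -/
theorem CycleOver.character_mem {n : ℕ} (C : CycleOver.{u, w, v} D 𝓜 n) :
    C.character ∈ cocycles 𝓜 D n := by
  refine mem_cocycles_of_isClosedGradedTrace ?_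
  have e : (fun X : D => formTrace 𝓜 C.character X) =
      fun X : D => C.T (C.ρ.obj X) ∘ₗ (Om.liftMap C.ρ n X X).lTensor M :=
    funext fun X => formTrace_character C X
  rw [e]
  exact C.isTrace.comp (Om.lift C.ρ)

/-- The universal cycle with a given cyclic cocycle as its character. -/
noncomputable def universalCycle [IsCocomm k H] {n : ℕ} (φ : cocycles 𝓜 D n) :
    CycleOver.{u, u, u} D 𝓜 n where
  S := Om.semicat k H D
  T := fun X : D => formTrace 𝓜 φ.1 X
  isTrace := formTrace_isClosedGradedTrace φ.2
  ρ := Om.incl k H D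

theorem universalCycle_character [IsCocomm k H] {n : ℕ} (φ : cocycles 𝓜 D n) :
    (universalCycle φ).character = φ := by
  refine cochain_ext fun m X a => ?_
  rw [CycleOver.character_of]
  exact congrArg (fun z => formTrace 𝓜 φ.1 X (m ⊗ₜ z)) (Om.incl_word (H := H) a)

end Characters

end HopfCyclic

namespace HopfCyclic

/-! ### The closed graded trace T # T'. -/

section TraceTensor

universe w v w' v' w₁ v₁ w₁' v₁'

variable {k H M M' : Type*} [Field k] [Ring H] [HopfAlgebra k H]
  [AddCommGroup M] [Module k M] [AddCommGroup M'] [Module k M']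

/-- The family of functionals on all degrees which is `T` in degree `p` and zero elsewhere. -/
noncomputable def extendTrace {S : DGHSemicat.{w, v} k H} {p : ℕ}
    (T : ∀ X : S.Ob, M ⊗[k] S.Hom p X X →ₗ[k] k) (n : ℕ) (X : S.Ob) :
    M ⊗[k] S.Hom n X X →ₗ[k] k :=
  if h : p = n then h ▸ T X else 0

theorem extendTrace_self {S : DGHSemicat.{w, v} k H} {p : ℕ}
    (T : ∀ X : S.Ob, M ⊗[k] S.Hom p X X →ₗ[k] k) : extendTrace T p = T := by
  funext X
  simp [extendTrace]

theorem extendTrace_of_ne {S : DGHSemicat.{w, v} k H} {p n : ℕ}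
    (T : ∀ X : S.Ob, M ⊗[k] S.Hom p X X →ₗ[k] k) (h : p ≠ n) (X : S.Ob) :
    extendTrace T n X = 0 := by
  simp [extendTrace, h]

theorem extendTrace_invariant {𝓜 : SAYDModule k H M} {S : DGHSemicat.{w, v} k H} {p : ℕ}
    {T : ∀ X : S.Ob, M ⊗[k] S.Hom p X X →ₗ[k] k}
    (hT : ∀ (X : S.Ob) (h : H) (x : M ⊗[k] S.Hom p X X),
      T X (twistedRact 𝓜 (S.act p X X) h x) = counit (R := k) h * T X x)
    (n : ℕ) (X : S.Ob) (h : H) (x : M ⊗[k] S.Hom n X X) :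
    extendTrace T n X (twistedRact 𝓜 (S.act n X X) h x) =
      counit (R := k) h * extendTrace T n X x := by
  by_cases hn : p = n
  · subst hn
    rw [extendTrace_self, hT]
  · simp [extendTrace_of_ne T hn]

theorem extendTrace_closed {S : DGHSemicat.{w, v} k H} {p : ℕ}
    {T : ∀ X : S.Ob, M ⊗[k] S.Hom p X X →ₗ[k] k}
    (hT : ∀ {i : ℕ} (h : i + 1 = p) (X : S.Ob) (m : M) (f : S.Hom i X X),
      T X (m ⊗ₜ S.d h X X f) = 0)
    {i n : ℕ} (h : i + 1 = n) (X : S.Ob) (m : M) (f : S.Hom i X X) :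
    extendTrace T n X (m ⊗ₜ S.d h X X f) = 0 := by
  by_cases hn : p = n
  · subst hn
    rw [extendTrace_self, hT]
  · simp [extendTrace_of_ne T hn]

/-- Zero is a closed graded trace in every dimension. The trace property of T # T' can then be
checked on all bidegrees at once, without singling out (p, q). -/
theorem isClosedGradedTrace_extendTrace [BijectiveAntipode k H] {𝓜 : SAYDModule k H M}
    {S : DGHSemicat.{w, v} k H} {p : ℕ} {T : ∀ X : S.Ob, M ⊗[k] S.Hom p X X →ₗ[k] k}
    (hT : IsClosedGradedTrace 𝓜 S p T) (n : ℕ) :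
    IsClosedGradedTrace 𝓜 S n (extendTrace T n) := by
  by_cases h : p = n
  · subst h
    rwa [extendTrace_self]
  · refine ⟨fun X h' x => ?_, fun {_} h' X m f => ?_, fun {_ _} _ _ X Y m g g' => ?_⟩ <;>
      simp [extendTrace_of_ne T h]

theorem extendTrace_comp {S : DGHSemicat.{w, v} k H} {S' : DGHSemicat.{w', v'} k H} {p : ℕ}
    (T : ∀ X : S'.Ob, M ⊗[k] S'.Hom p X X →ₗ[k] k) (F : DGHMap S S') (n : ℕ) (X : S.Ob) :
    extendTrace (fun X => T (F.obj X) ∘ₗ (F.map p X X).lTensor M) n X =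
      extendTrace T n (F.obj X) ∘ₗ (F.map n X X).lTensor M := by
  by_cases h : p = n
  · subst h
    rw [extendTrace_self, extendTrace_self]
  · rw [extendTrace_of_ne _ h, extendTrace_of_ne _ h, LinearMap.zero_comp]

/-- The functional `m ⊗ m' ↦ α(m) β(m')`. -/
noncomputable def evalPair (α : M →ₗ[k] k) (β : M' →ₗ[k] k) : M ⊗[k] M' →ₗ[k] k :=
  LinearMap.mul' k k ∘ₗ TensorProduct.map α β

@[simp] theorem evalPair_tmul (α : M →ₗ[k] k) (β : M' →ₗ[k] k) (m : M) (m' : M') :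
    evalPair α β (m ⊗ₜ m') = α m * β m' := rfl

theorem evalPair_zero_left (β : M' →ₗ[k] k) : evalPair (0 : M →ₗ[k] k) β = 0 := by
  ext; simp

theorem evalPair_zero_right (α : M →ₗ[k] k) : evalPair α (0 : M' →ₗ[k] k) = 0 := by
  ext; simp

namespace DGHSemicat

section TensorHom

variable [IsCocomm k H] {S : DGHSemicat.{w, v} k H} {S' : DGHSemicat.{w', v'} k H}

/-- A pair of objects as an object of `S ⊗ S'`. -/
abbrev tob (X : S.Ob) (X' : S'.Ob) : (S.tensor S').Ob := (X, X')

/-- The inclusion of `Homⁱ ⊗ Homʲ` in the morphisms of `S ⊗ S'`. -/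
noncomputable def tin {i j n : ℕ} (h : i + j = n) (X Y : (S.tensor S').Ob) :
    S.Hom i X.1 Y.1 ⊗[k] S'.Hom j X.2 Y.2 →ₗ[k] (S.tensor S').Hom n X Y :=
  incl h X Y

/-- The linear map out of the morphisms of `S ⊗ S'` with given components. -/
noncomputable def tdesc {P : Type*} [AddCommGroup P] [Module k P] {n : ℕ}
    {X Y : (S.tensor S').Ob}
    (F : ∀ i j, i + j = n → S.Hom i X.1 Y.1 ⊗[k] S'.Hom j X.2 Y.2 →ₗ[k] P) :
    (S.tensor S').Hom n X Y →ₗ[k] P :=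
  tlift (S := S) (S' := S') F

@[simp] theorem tdesc_tin {P : Type*} [AddCommGroup P] [Module k P] {i j n : ℕ}
    {X Y : (S.tensor S').Ob}
    (F : ∀ i j, i + j = n → S.Hom i X.1 Y.1 ⊗[k] S'.Hom j X.2 Y.2 →ₗ[k] P)
    (h : i + j = n) (x : S.Hom i X.1 Y.1 ⊗[k] S'.Hom j X.2 Y.2) :
    tdesc F (tin h X Y x) = F i j h x := tlift_incl F h x

theorem tensor_induction {n : ℕ} {X Y : (S.tensor S').Ob}
    {motive : (S.tensor S').Hom n X Y → Prop} (x : (S.tensor S').Hom n X Y) (zero : motive 0)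
    (add : ∀ x y, motive x → motive y → motive (x + y))
    (tin_tmul : ∀ (i j : ℕ) (h : i + j = n) (f : S.Hom i X.1 Y.1) (f' : S'.Hom j X.2 Y.2),
      motive (tin h X Y (f ⊗ₜ f'))) : motive x :=
  THom.induction (S := S) (S' := S') x zero add tin_tmul

theorem tin_mul {i i' j j' m l n a b : ℕ} (hi : i + i' = m) (hj : j + j' = l) (h : m + l = n)
    (ha : i + j = a) (hb : i' + j' = b) (hn : a + b = n) {X Y Z : (S.tensor S').Ob}
    (g : S.Hom i Y.1 Z.1) (g' : S'.Hom i' Y.2 Z.2) (f : S.Hom j X.1 Y.1) (f' : S'.Hom j' X.2 Y.2) :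
    (S.tensor S').mul h (tin hi Y Z (g ⊗ₜ g')) (tin hj X Y (f ⊗ₜ f')) =
      (-1 : k) ^ (i' * j) • tin hn X Z (S.mul ha g f ⊗ₜ S'.mul hb g' f') :=
  tcomp_incl hi hj h ha hb hn g g' f f'

theorem tin_del {i j m n a b : ℕ} (hm : i + j = m) (h : m + 1 = n) (ha : i + 1 = a)
    (hb : j + 1 = b) (h₁ : a + j = n) (h₂ : i + b = n) {X Y : (S.tensor S').Ob}
    (f : S.Hom i X.1 Y.1) (f' : S'.Hom j X.2 Y.2) :
    (S.tensor S').d h X Y (tin hm X Y (f ⊗ₜ f')) = tin h₁ X Y (S.del ha f ⊗ₜ f') +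
      (-1 : k) ^ i • tin h₂ X Y (f ⊗ₜ S'.del hb f') :=
  tdiff_incl hm h ha hb h₁ h₂ f f'

theorem tin_act {i j n : ℕ} (h : i + j = n) (X Y : (S.tensor S').Ob) (a : H)
    (x : S.Hom i X.1 Y.1 ⊗[k] S'.Hom j X.2 Y.2) :
    (S.tensor S').act n X Y a (tin h X Y x) =
      tin h X Y (diagAct (S.act i X.1 Y.1) (S'.act j X.2 Y.2) a x) :=
  tact_incl h X Y a x

end TensorHom

end DGHSemicat

variable [IsCocomm k H] {𝓜 : SAYDModule k H M} {𝓜' : SAYDModule k H M'}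
  {S : DGHSemicat.{w, v} k H} {S' : DGHSemicat.{w', v'} k H} {p q : ℕ}
  (T : ∀ X : S.Ob, M ⊗[k] S.Hom p X X →ₗ[k] k) (T' : ∀ X : S'.Ob, M' ⊗[k] S'.Hom q X X →ₗ[k] k)

theorem tproj_incl {i j n : ℕ} (h : i + j = n) {X Y : S.Ob × S'.Ob}
    (t : S.Hom i X.1 Y.1 ⊗[k] S'.Hom j X.2 Y.2) :
    DGHSemicat.tproj h X Y (DGHSemicat.incl h X Y t) = t :=
  DirectSum.component.lof_self k (ι := Finset.HasAntidiagonal.antidiagonal n)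
    (M := fun ij => S.Hom ij.1.1 X.1 Y.1 ⊗[k] S'.Hom ij.1.2 X.2 Y.2)
    ⟨(i, j), Finset.HasAntidiagonal.mem_antidiagonal.mpr h⟩ t

theorem tproj_incl_of_ne {i j i' j' n : ℕ} (h : i + j = n) (h' : i' + j' = n) (hi : i ≠ i')
    {X Y : S.Ob × S'.Ob} (t : S.Hom i' X.1 Y.1 ⊗[k] S'.Hom j' X.2 Y.2) :
    DGHSemicat.tproj h X Y (DGHSemicat.incl h' X Y t) = 0 := by
  refine (DirectSum.component.of k (ι := Finset.HasAntidiagonal.antidiagonal n)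
    (M := fun ij => S.Hom ij.1.1 X.1 Y.1 ⊗[k] S'.Hom ij.1.2 X.2 Y.2)
    ⟨(i, j), Finset.HasAntidiagonal.mem_antidiagonal.mpr h⟩
    ⟨(i', j'), Finset.HasAntidiagonal.mem_antidiagonal.mpr h'⟩ t).trans ?_
  rw [dif_neg]
  intro e
  exact hi (congrArg (fun z => z.1.1) e).symm

/-- Since i + j = p + q, the component (i, j) differs from (p, q) as soon as i ≠ p, and then the
extended trace on the first factor is zero. -/
theorem traceTensor_lTensor_tin {i j : ℕ} (h : i + j = p + q) (X : (S.tensor S').Ob)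
    (y : Cotensor 𝓜 𝓜' ⊗[k] (S.Hom i X.1 X.1 ⊗[k] S'.Hom j X.2 X.2)) :
    traceTensor 𝓜 𝓜' T T' X ((DGHSemicat.tin h X X).lTensor _ y) =
      LinearMap.mul' k k (TensorProduct.map (extendTrace T i X.1) (extendTrace T' j X.2)
        (cotensorMiddle 𝓜 𝓜' _ _ y)) := by
  by_cases hi : p = i
  · subst hi
    obtain rfl : q = j := by omega
    rw [extendTrace_self, extendTrace_self]
    induction y with
    | zero => simp only [map_zero]
    | add x y hx hy => simp only [map_add, hx, hy]
    | tmul z t =>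
      simp only [traceTensor, cotensorMiddle, LinearMap.comp_apply]
      congr 3
      exact congrArg (fun t => (z : M ⊗[k] M') ⊗ₜ[k] t) (tproj_incl _ t)
  · rw [extendTrace_of_ne _ hi, TensorProduct.map_zero_left, LinearMap.zero_apply, map_zero]
    induction y with
    | zero => simp only [map_zero]
    | add x y hx hy => simp only [map_add, hx, hy, add_zero]
    | tmul z t =>
      simp only [traceTensor, LinearMap.comp_apply]
      have e := congrArg (fun t => (z : M ⊗[k] M') ⊗ₜ[k] t)
        (tproj_incl_of_ne (S := S) (S' := S') (i := p) (j := q) rfl h hi t)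
      refine (congrArg _ (congrArg _ (congrArg _ e))).trans ?_
      simp only [TensorProduct.tmul_zero, map_zero]

theorem traceTensor_tin {i j : ℕ} (h : i + j = p + q) (X : (S.tensor S').Ob)
    (z : Cotensor 𝓜 𝓜') (f : S.Hom i X.1 X.1) (f' : S'.Hom j X.2 X.2) :
    traceTensor 𝓜 𝓜' T T' X (z ⊗ₜ DGHSemicat.tin h X X (f ⊗ₜ f')) =
      evalPair ((TensorProduct.curry (extendTrace T i X.1)).flip f)
        ((TensorProduct.curry (extendTrace T' j X.2)).flip f') z := by
  refine (traceTensor_lTensor_tin T T' h X (z ⊗ₜ (f ⊗ₜ f'))).trans ?_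
  simp only [cotensorMiddle, LinearMap.comp_apply, LinearMap.rTensor_tmul, LinearEquiv.coe_coe,
    Submodule.subtype_apply]
  induction (z : M ⊗[k] M') with
  | zero => simp
  | add x y hx hy => simp only [map_add, TensorProduct.add_tmul, hx, hy]
  | tmul m m' => simp

/-- Here the cotensor condition pays off: by `cotensorMiddle_coTwist` the twist of g ⊗ g' splits
into a twist of g by M and one of g' by M'. The sign is the Koszul sign of composing g ⊗ g' with x ⊗
x'. -/
theorem traceTensor_tw [BijectiveAntipode k H] (hsub : CotensorIsSubmodule 𝓜 𝓜')
    {i i' j j' l m a b : ℕ} (hi : i + i' = l)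
    (hj : j + j' = m) (h : l + m = p + q) (ha : i + j = a) (hb : i' + j' = b)
    {X Y : (S.tensor S').Ob} (z : Cotensor 𝓜 𝓜') (g : S.Hom i X.1 Y.1) (g' : S'.Hom i' X.2 Y.2)
    (x : S.Hom j Y.1 X.1) (x' : S'.Hom j' Y.2 X.2) :
    traceTensor 𝓜 𝓜' T T' Y (tw (S := S.tensor S') (𝓜.cotensor 𝓜' hsub) h
        (DGHSemicat.tin hi X Y (g ⊗ₜ g')) (DGHSemicat.tin hj Y X (x ⊗ₜ x')) z) =
      (-1 : k) ^ (i' * j) * evalPair (extendTrace T a Y.1 ∘ₗ tw 𝓜 ha g x)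
        (extendTrace T' b Y.2 ∘ₗ tw 𝓜' hb g' x') z := by
  have hab : a + b = p + q := by omega
  have e0 : tw (S := S.tensor S') (𝓜.cotensor 𝓜' hsub) h
      (DGHSemicat.tin hi X Y (g ⊗ₜ g')) (DGHSemicat.tin hj Y X (x ⊗ₜ x')) z =
      (-1 : k) ^ (i' * j) • (DGHSemicat.tin hab Y Y).lTensor _
        ((TensorProduct.map ((S.mul ha).flip x) ((S'.mul hb).flip x')).lTensor _
        (coTwist (𝓜.cotensor 𝓜' hsub) (diagAct (S.act i X.1 Y.1) (S'.act i' X.2 Y.2))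
          (z ⊗ₜ (g ⊗ₜ g')))) := by
    rw [coTwist_tmul, lTensor_spread, lTensor_spread, tw_apply, ← LinearMap.smul_apply, ← map_smul]
    congr 2
    ext c
    have e1 : ∀ t : S.Hom i X.1 Y.1 ⊗[k] S'.Hom i' X.2 Y.2,
        (S.tensor S').mul h (DGHSemicat.tin hi X Y t) (DGHSemicat.tin hj Y X (x ⊗ₜ x')) =
        (-1 : k) ^ (i' * j) • DGHSemicat.tin hab Y Y
          (TensorProduct.map ((S.mul ha).flip x) ((S'.mul hb).flip x') t) := by
      intro t
      induction t with
      | zero => simp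
      | add s t hs ht => simp only [map_add, LinearMap.add_apply, hs, ht, smul_add]
      | tmul g g' => exact DGHSemicat.tin_mul hi hj h ha hb hab g g' x x'
    simp only [LinearMap.comp_apply, LinearMap.flip_apply, orbit_apply, LinearMap.smul_apply,
      DGHSemicat.tin_act]
    exact e1 _
  have e3 : ∀ y : Cotensor 𝓜 𝓜' ⊗[k] (S.Hom i X.1 Y.1 ⊗[k] S'.Hom i' X.2 Y.2),
      cotensorMiddle 𝓜 𝓜' _ _
        ((TensorProduct.map ((S.mul ha).flip x) ((S'.mul hb).flip x')).lTensor _ y) =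
      TensorProduct.map (((S.mul ha).flip x).lTensor M) (((S'.mul hb).flip x').lTensor M')
        (cotensorMiddle 𝓜 𝓜' _ _ y) := by
    intro y
    induction y with
    | zero => simp
    | add s t hs ht => simp only [map_add, hs, ht]
    | tmul z t =>
      simp only [cotensorMiddle, LinearMap.comp_apply, LinearMap.rTensor_tmul, LinearEquiv.coe_coe,
        LinearMap.lTensor_tmul, Submodule.subtype_apply]
      induction t with
      | zero => simp
      | add s t hs ht => simp only [map_add, TensorProduct.tmul_add, hs, ht]
      | tmul g g' =>
        induction (z : M ⊗[k] M') with
        | zero => simp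
        | add s t hs ht => simp only [map_add, TensorProduct.add_tmul, hs, ht]
        | tmul m m' => simp
  rw [e0, map_smul, smul_eq_mul, traceTensor_lTensor_tin, e3, cotensorMiddle_coTwist]
  congr 1
  simp only [cotensorMiddle, LinearMap.comp_apply, LinearMap.rTensor_tmul, LinearEquiv.coe_coe,
    Submodule.subtype_apply]
  induction (z : M ⊗[k] M') with
  | zero => simp
  | add s t hs ht => simp only [map_add, TensorProduct.add_tmul, hs, ht]
  | tmul m m' =>
    simp only [TensorProduct.tensorTensorTensorComm_tmul, TensorProduct.map_tmul,
      LinearMap.mul'_apply, evalPair_tmul, LinearMap.comp_apply, ← coTwist_comp]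
    rfl

/-- By `cotensorMiddle_twistedRact` the element h acts as h₁ on the first pair and as h₂ on the
second. Invariance of T and T' gives ε(h₁)ε(h₂), which is ε(h). -/
theorem traceTensor_invariant (hsub : CotensorIsSubmodule 𝓜 𝓜')
    {T : ∀ X : S.Ob, M ⊗[k] S.Hom p X X →ₗ[k] k} {T' : ∀ X : S'.Ob, M' ⊗[k] S'.Hom q X X →ₗ[k] k}
    (hT : ∀ (X : S.Ob) (h : H) (x : M ⊗[k] S.Hom p X X),
      T X (twistedRact 𝓜 (S.act p X X) h x) = counit (R := k) h * T X x)
    (hT' : ∀ (X : S'.Ob) (h : H) (x : M' ⊗[k] S'.Hom q X X),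
      T' X (twistedRact 𝓜' (S'.act q X X) h x) = counit (R := k) h * T' X x)
    (X : (S.tensor S').Ob) (h : H) (x : Cotensor 𝓜 𝓜' ⊗[k] (S.tensor S').Hom (p + q) X X) :
    traceTensor 𝓜 𝓜' T T' X
        (twistedRact (𝓜.cotensor 𝓜' hsub) ((S.tensor S').act (p + q) X X) h x) =
      counit (R := k) h * traceTensor 𝓜 𝓜' T T' X x := by
  induction x with
  | zero => simp only [map_zero, mul_zero]
  | add x y hx hy => simp only [map_add, mul_add, hx, hy]
  | tmul z t =>
    induction t using DGHSemicat.tensor_induction with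
    | zero => simp only [TensorProduct.tmul_zero, map_zero, mul_zero]
    | add x y hx hy => simp only [TensorProduct.tmul_add, map_add, mul_add, hx, hy]
    | tin_tmul i j hij f f' =>
      have e1 := twistedRact_map (𝓜.cotensor 𝓜' hsub)
        (diagAct (S.act i X.1 X.1) (S'.act j X.2 X.2)) ((S.tensor S').act (p + q) X X)
        (DGHSemicat.tin hij X X) (fun h x => (DGHSemicat.tin_act hij X X h x).symm) h
        (z ⊗ₜ (f ⊗ₜ f'))
      refine (congrArg _ e1.symm).trans ((traceTensor_lTensor_tin T T' hij X _).trans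
        (Eq.trans ?_ (congrArg (fun t => counit (R := k) h * t)
        (traceTensor_lTensor_tin T T' hij X (z ⊗ₜ (f ⊗ₜ f'))).symm)))
      rw [cotensorMiddle_twistedRact]
      generalize cotensorMiddle 𝓜 𝓜' _ _ (z ⊗ₜ[k] (f ⊗ₜ[k] f')) = y
      have e2 : ∀ u : H ⊗[k] H, LinearMap.mul' k k (TensorProduct.map (extendTrace T i X.1)
          (extendTrace T' j X.2) (pairAct (twistedRact 𝓜 (S.act i X.1 X.1))
            (twistedRact 𝓜' (S'.act j X.2 X.2)) u y)) =
          counit (R := k) (TensorProduct.lid k H (counit.rTensor H u)) *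
            LinearMap.mul' k k (TensorProduct.map (extendTrace T i X.1)
              (extendTrace T' j X.2) y) := by
        intro u
        induction u with
        | zero => simp
        | add s t hs ht => simp only [map_add, LinearMap.add_apply, add_mul, hs, ht]
        | tmul s t =>
          induction y with
          | zero => simp
          | add x y hx hy => simp only [map_add, mul_add, hx, hy]
          | tmul x y =>
            simp only [pairAct_tmul, TensorProduct.map_tmul, LinearMap.mul'_apply,
              extendTrace_invariant hT, extendTrace_invariant hT', LinearMap.rTensor_tmul, TensorProduct.lid_tmul,
              map_smul, smul_eq_mul]
            ring
      rw [e2, rTensor_counit_comul]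
      simp

/-- The differential of f ⊗ f' is a sum of two tensors, each with one exact factor, and T or T'
vanishes on that factor. -/
theorem traceTensor_closed {T : ∀ X : S.Ob, M ⊗[k] S.Hom p X X →ₗ[k] k}
    {T' : ∀ X : S'.Ob, M' ⊗[k] S'.Hom q X X →ₗ[k] k}
    (hT : ∀ {i : ℕ} (h : i + 1 = p) (X : S.Ob) (m : M) (f : S.Hom i X X),
      T X (m ⊗ₜ S.d h X X f) = 0)
    (hT' : ∀ {i : ℕ} (h : i + 1 = q) (X : S'.Ob) (m : M') (f : S'.Hom i X X),
      T' X (m ⊗ₜ S'.d h X X f) = 0)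
    {n : ℕ} (h : n + 1 = p + q) (X : (S.tensor S').Ob) (z : Cotensor 𝓜 𝓜')
    (f : (S.tensor S').Hom n X X) :
    traceTensor 𝓜 𝓜' T T' X (z ⊗ₜ (S.tensor S').d h X X f) = 0 := by
  induction f using DGHSemicat.tensor_induction with
  | zero => simp only [TensorProduct.tmul_zero, map_zero]
  | add x y hx hy => simp only [TensorProduct.tmul_add, map_add, hx, hy, add_zero]
  | tin_tmul i j hij f f' =>
    have e1 := DGHSemicat.tin_del hij h rfl rfl (by omega) (by omega) f f'
    refine (congrArg (fun t => traceTensor 𝓜 𝓜' T T' X (z ⊗ₜ t)) e1).trans ?_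
    rw [TensorProduct.tmul_add, map_add, TensorProduct.tmul_smul, map_smul, traceTensor_tin,
      traceTensor_tin]
    have z1 : (TensorProduct.curry (extendTrace T (i + 1) X.1)).flip
        (S.d rfl X.1 X.1 f) = 0 :=
      LinearMap.ext fun m => extendTrace_closed hT rfl X.1 m f
    have z2 : (TensorProduct.curry (extendTrace T' (j + 1) X.2)).flip
        (S'.d rfl X.2 X.2 f') = 0 :=
      LinearMap.ext fun m => extendTrace_closed hT' rfl X.2 m f'
    rw [z1, z2, evalPair_zero_left, evalPair_zero_right]
    simp

/-- The tensor product of closed graded traces is a closed graded trace. -/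
theorem traceTensor_isClosedGradedTrace [BijectiveAntipode k H]
    (hsub : CotensorIsSubmodule 𝓜 𝓜') {T : ∀ X : S.Ob, M ⊗[k] S.Hom p X X →ₗ[k] k}
    {T' : ∀ X : S'.Ob, M' ⊗[k] S'.Hom q X X →ₗ[k] k} (hT : IsClosedGradedTrace 𝓜 S p T)
    (hT' : IsClosedGradedTrace 𝓜' S' q T') :
    IsClosedGradedTrace (𝓜.cotensor 𝓜' hsub) (S.tensor S') (p + q) (traceTensor 𝓜 𝓜' T T') := by
  refine .of_mul_swap (traceTensor_invariant hsub hT.invariant hT'.invariant)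
    (fun {_} h X z f => traceTensor_closed hT.closed hT'.closed h X z f) fun {l m} h h' X Y z g x => ?_
  induction g using DGHSemicat.tensor_induction with
  | zero => simp
  | add g g' hg hg' =>
    simp only [map_add, TensorProduct.tmul_add, LinearMap.add_apply, hg, hg', mul_add]
  | tin_tmul i i' hi g g' =>
    induction x using DGHSemicat.tensor_induction with
    | zero => simp
    | add x x' hx hx' =>
      simp only [map_add, TensorProduct.tmul_add, LinearMap.add_apply, hx, hx', mul_add]
    | tin_tmul j j' hj x x' =>
      have e1 := DGHSemicat.tin_mul hj hi h rfl rfl (by omega) x x' g g'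
      refine (congrArg (fun t => traceTensor 𝓜 𝓜' T T' X (z ⊗ₜ t)) e1).trans ?_
      rw [TensorProduct.tmul_smul, map_smul, traceTensor_tin, smul_eq_mul,
        traceTensor_tw T T' hsub hi hj h' (Nat.add_comm i j) (Nat.add_comm i' j')]
      have z1 : (TensorProduct.curry (extendTrace T (j + i) X.1)).flip (S.mul rfl x g) =
          (-1 : k) ^ (i * j) •
            (extendTrace T (j + i) Y.1 ∘ₗ tw 𝓜 (Nat.add_comm i j) g x) :=
        LinearMap.ext fun m => (isClosedGradedTrace_extendTrace hT (j + i)).mul_swap _ _ m g x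
      have z2 : (TensorProduct.curry (extendTrace T' (j' + i') X.2)).flip (S'.mul rfl x' g') =
          (-1 : k) ^ (i' * j') •
            (extendTrace T' (j' + i') Y.2 ∘ₗ tw 𝓜' (Nat.add_comm i' j') g' x') :=
        LinearMap.ext fun m =>
          (isClosedGradedTrace_extendTrace hT' (j' + i')).mul_swap _ _ m g' x'
      rw [z1, z2, evalPair, evalPair, TensorProduct.map_smul_left, TensorProduct.map_smul_right]
      simp only [LinearMap.comp_apply, LinearMap.smul_apply, map_smul, smul_eq_mul]
      rw [← mul_assoc, ← mul_assoc, ← mul_assoc, ← hi, ← hj]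
      congr 1
      -- On the left the exponents are j'i from composing in S ⊗ S' and ij, i'j' from the two
      -- traces. On the right they are (i + i')(j + j') and i'j from the twisted composition, so i'j
      -- occurs twice and cancels.
      have s : (-1 : k) ^ (i' * j) * (-1) ^ (i' * j) = 1 := by rw [← mul_pow]; simp
      have s' : (-1 : k) ^ ((i + i') * (j + j')) =
        (-1) ^ (i * j) * (-1) ^ (i * j') * (-1) ^ (i' * j) * (-1) ^ (i' * j') := by ring
      rw [s', mul_comm j' i]
      linear_combination (-(-1 : k) ^ (i * j) * (-1) ^ (i * j') * (-1) ^ (i' * j')) * s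

end TraceTensor

end HopfCyclic

namespace HopfCyclic

/-! ### Functoriality of the product and the bilinear map on cocycles. -/

section Product

universe w v w' v' w₁ v₁ w₁' v₁'

variable {k H M M' : Type*} [Field k] [Ring H] [HopfAlgebra k H] [IsCocomm k H]
  [AddCommGroup M] [Module k M] [AddCommGroup M'] [Module k M']

section Maps

variable {S : DGHSemicat.{w, v} k H} {S' : DGHSemicat.{w', v'} k H}
  {R : DGHSemicat.{w₁, v₁} k H} {R' : DGHSemicat.{w₁', v₁'} k H}

/-- The map `f ⊗ f' ↦ F f ⊗ F' f'` on the morphisms of `S ⊗ S'`. -/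
noncomputable def DGHMap.tensorMap (F : DGHMap S R) (F' : DGHMap S' R') (n : ℕ)
    (X Y : (S.tensor S').Ob) : (S.tensor S').Hom n X Y →ₗ[k]
      (R.tensor R').Hom n (DGHSemicat.tob (F.obj X.1) (F'.obj X.2)) (DGHSemicat.tob (F.obj Y.1) (F'.obj Y.2)) :=
  DGHSemicat.tdesc fun i j h => DGHSemicat.tin h (DGHSemicat.tob (F.obj X.1) (F'.obj X.2)) (DGHSemicat.tob (F.obj Y.1) (F'.obj Y.2)) ∘ₗ
    TensorProduct.map (F.map i X.1 Y.1) (F'.map j X.2 Y.2)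

theorem DGHMap.tensorMap_tin (F : DGHMap S R) (F' : DGHMap S' R') {i j n : ℕ} (h : i + j = n)
    {X Y : (S.tensor S').Ob} (t : S.Hom i X.1 Y.1 ⊗[k] S'.Hom j X.2 Y.2) :
    F.tensorMap F' n X Y (DGHSemicat.tin h X Y t) =
      DGHSemicat.tin h (DGHSemicat.tob (F.obj X.1) (F'.obj X.2)) (DGHSemicat.tob (F.obj Y.1) (F'.obj Y.2))
        (TensorProduct.map (F.map i X.1 Y.1) (F'.map j X.2 Y.2) t) := by
  simp [tensorMap]

/-- The tensor product of maps of DGH-semicategories. -/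
noncomputable def DGHMap.tensor (F : DGHMap S R) (F' : DGHMap S' R') :
    DGHMap (S.tensor S') (R.tensor R') where
  obj X := (DGHSemicat.tob (F.obj X.1) (F'.obj X.2))
  map n X Y := F.tensorMap F' n X Y
  map_mul {l m n} h {X Y Z} g f := by
    induction g using DGHSemicat.tensor_induction with
    | zero => simp only [map_zero, LinearMap.zero_apply]
    | add x y hx hy => simp only [map_add, LinearMap.add_apply, hx, hy]
    | tin_tmul i i' hi g g' =>
      induction f using DGHSemicat.tensor_induction with
      | zero => simp only [map_zero]
      | add x y hx hy => simp only [map_add, hx, hy]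
      | tin_tmul j j' hj f f' =>
        rw [DGHSemicat.tin_mul hi hj h rfl rfl (by omega), map_smul, tensorMap_tin, tensorMap_tin,
          tensorMap_tin, TensorProduct.map_tmul, TensorProduct.map_tmul, TensorProduct.map_tmul,
          F.map_mul, F'.map_mul]
        exact (DGHSemicat.tin_mul (X := DGHSemicat.tob (F.obj X.1) (F'.obj X.2))
          (Y := DGHSemicat.tob (F.obj Y.1) (F'.obj Y.2))
          (Z := DGHSemicat.tob (F.obj Z.1) (F'.obj Z.2)) hi hj h rfl rfl (by omega)
          (F.map i Y.1 Z.1 g) (F'.map i' Y.2 Z.2 g') (F.map j X.1 Y.1 f)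
          (F'.map j' X.2 Y.2 f')).symm
  map_del {m n} h {X Y} f := by
    induction f using DGHSemicat.tensor_induction with
    | zero => simp only [map_zero]
    | add x y hx hy => simp only [map_add, hx, hy]
    | tin_tmul i j hij f f' =>
      rw [DGHSemicat.tin_del hij h rfl rfl (by omega) (by omega), map_add, map_smul, tensorMap_tin,
        tensorMap_tin, tensorMap_tin, TensorProduct.map_tmul, TensorProduct.map_tmul,
        TensorProduct.map_tmul, F.map_del, F'.map_del]
      exact (DGHSemicat.tin_del (X := DGHSemicat.tob (F.obj X.1) (F'.obj X.2))
        (Y := DGHSemicat.tob (F.obj Y.1) (F'.obj Y.2)) hij h rfl rfl (by omega) (by omega)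
        (F.map i X.1 Y.1 f) (F'.map j X.2 Y.2 f')).symm
  map_act {n X Y} a f := by
    induction f using DGHSemicat.tensor_induction with
    | zero => simp only [map_zero]
    | add x y hx hy => simp only [map_add, hx, hy]
    | tin_tmul i j hij f f' =>
      rw [DGHSemicat.tin_act, tensorMap_tin, tensorMap_tin, diagAct_map _ _ _ _ _ _
        (fun a f => F.map_act a f) (fun a f => F'.map_act a f)]
      exact (DGHSemicat.tin_act _ _ _ _ _).symm

/-- The tensor product of functionals is compatible with maps of DGH-semicategories. -/
theorem traceTensor_tensorMap {𝓜 : SAYDModule k H M} {𝓜' : SAYDModule k H M'} {p q : ℕ}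
    (T : ∀ X : R.Ob, M ⊗[k] R.Hom p X X →ₗ[k] k) (T' : ∀ X : R'.Ob, M' ⊗[k] R'.Hom q X X →ₗ[k] k)
    (F : DGHMap S R) (F' : DGHMap S' R') (X : (S.tensor S').Ob) (z : Cotensor 𝓜 𝓜')
    (x : (S.tensor S').Hom (p + q) X X) :
    traceTensor 𝓜 𝓜' T T' ((F.tensor F').obj X) (z ⊗ₜ (F.tensor F').map (p + q) X X x) =
      traceTensor 𝓜 𝓜' (fun X => T (F.obj X) ∘ₗ (F.map p X X).lTensor M)
        (fun X => T' (F'.obj X) ∘ₗ (F'.map q X X).lTensor M') X (z ⊗ₜ x) := by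
  induction x using DGHSemicat.tensor_induction with
  | zero => simp only [map_zero, TensorProduct.tmul_zero]
  | add x y hx hy => simp only [map_add, TensorProduct.tmul_add, hx, hy]
  | tin_tmul i j h f f' =>
    have e := F.tensorMap_tin F' h (X := X) (Y := X) (f ⊗ₜ f')
    refine (congrArg (fun t => traceTensor 𝓜 𝓜' T T' ((F.tensor F').obj X) (z ⊗ₜ t)) e).trans ?_
    rw [TensorProduct.map_tmul, traceTensor_tin]
    refine (traceTensor_tin T T' h (DGHSemicat.tob (F.obj X.1) (F'.obj X.2)) z
      (F.map i X.1 X.1 f) (F'.map j X.2 X.2 f')).trans ?_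
    simp only [extendTrace_comp]
    rfl

variable {D : Type u} [SmallCategory D] [Preadditive D] [Linear k D] [HCategory k H D]
  {D' : Type u'} [SmallCategory D'] [Preadditive D'] [Linear k D'] [HCategory k H D']

/-- The maps of the two semifunctors live over different object maps, hence the heterogeneous
equality. In both applications the object maps agree by definition and it reduces to an ordinary
one. -/
theorem HSemifunctor.ext_of_obj_eq {τ τ' : HSemifunctor D S} (h : τ.obj = τ'.obj)
    (h' : HEq τ.map τ'.map) : τ = τ' := by
  obtain ⟨o, m, _, _⟩ := τ
  obtain ⟨o', m', _, _⟩ := τ'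
  cases h
  cases h'
  rfl

theorem HSemifunctor.tensor_push (ρ : HSemifunctor D S) (ρ' : HSemifunctor D' S')
    (F : DGHMap S R) (F' : DGHMap S' R') :
    (ρ.tensor ρ').push (F.tensor F') = (ρ.push F).tensor (ρ'.push F') := by
  have e : ∀ X Y : TensorCat k D D', ((ρ.tensor ρ').push (F.tensor F')).map X Y =
      ((ρ.push F).tensor (ρ'.push F')).map X Y := by
    intro X Y
    refine LinearMap.ext fun f => ?_
    refine (F.tensorMap_tin F' (add_zero 0) (X := DGHSemicat.tob (ρ.obj X.fst) (ρ'.obj X.snd))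
      (Y := DGHSemicat.tob (ρ.obj Y.fst) (ρ'.obj Y.snd)) _).trans ?_
    refine congrArg (DGHSemicat.tin (add_zero 0) _ _) ?_
    exact (LinearMap.congr_fun (TensorProduct.map_comp _ _ _ _) f).symm
  have e' : ((ρ.tensor ρ').push (F.tensor F')).map = ((ρ.push F).tensor (ρ'.push F')).map :=
    funext fun X => funext fun Y => e X Y
  exact HSemifunctor.ext_of_obj_eq rfl (heq_of_eq e')

/-- The factorizations of `ρ` and `ρ'` are given as equations so that they can be substituted, which
avoids transporting morphisms along equalities of objects. -/
theorem traceTensor_word_of_push {𝓜 : SAYDModule k H M} {𝓜' : SAYDModule k H M'} {p q : ℕ}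
    {ρ₀ : HSemifunctor D S} {ρ₀' : HSemifunctor D' S'} (F : DGHMap S R) (F' : DGHMap S' R')
    {ρ : HSemifunctor D R} {ρ' : HSemifunctor D' R'} (h : ρ₀.push F = ρ) (h' : ρ₀'.push F' = ρ')
    (T : ∀ X : R.Ob, M ⊗[k] R.Hom p X X →ₗ[k] k) (T' : ∀ X : R'.Ob, M' ⊗[k] R'.Hom q X X →ₗ[k] k)
    (X : TensorCat k D D') (z : Cotensor 𝓜 𝓜') (a : strand k (p + q) X X) :
    traceTensor 𝓜 𝓜' T T' ((ρ.tensor ρ').obj X) (z ⊗ₜ (ρ.tensor ρ').word (p + q) X X a) =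
      traceTensor 𝓜 𝓜' (fun X => T (F.obj X) ∘ₗ (F.map p X X).lTensor M)
        (fun X => T' (F'.obj X) ∘ₗ (F'.map q X X).lTensor M') ((ρ₀.tensor ρ₀').obj X)
          (z ⊗ₜ (ρ₀.tensor ρ₀').word (p + q) X X a) := by
  subst h h'
  rw [← HSemifunctor.tensor_push, HSemifunctor.push_word]
  exact traceTensor_tensorMap T T' F F' _ z _

/-- Every semifunctor factors through the universal forms, so every cycle can be compared with one
carried by them. -/
theorem Om.incl_push_lift (ρ : HSemifunctor D S) : (incl k H D).push (lift ρ) = ρ :=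
  HSemifunctor.ext_of_obj_eq rfl (heq_of_eq (funext fun _ => funext fun _ =>
    LinearMap.ext fun f => liftMap_of ρ f))

end Maps

variable {𝓜 : SAYDModule k H M} {𝓜' : SAYDModule k H M'}

theorem traceTensor_add_left {S : DGHSemicat.{w, v} k H} {S' : DGHSemicat.{w', v'} k H} {p q : ℕ}
    (T U : ∀ X : S.Ob, M ⊗[k] S.Hom p X X →ₗ[k] k) (T' : ∀ X : S'.Ob, M' ⊗[k] S'.Hom q X X →ₗ[k] k)
    (X : (S.tensor S').Ob) : traceTensor 𝓜 𝓜' (fun X => T X + U X) T' X =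
      traceTensor 𝓜 𝓜' T T' X + traceTensor 𝓜 𝓜' U T' X := by
  simp only [traceTensor, TensorProduct.map_add_left, LinearMap.comp_add, LinearMap.add_comp]

theorem traceTensor_add_right {S : DGHSemicat.{w, v} k H} {S' : DGHSemicat.{w', v'} k H} {p q : ℕ}
    (T : ∀ X : S.Ob, M ⊗[k] S.Hom p X X →ₗ[k] k)
    (T' U' : ∀ X : S'.Ob, M' ⊗[k] S'.Hom q X X →ₗ[k] k)
    (X : (S.tensor S').Ob) : traceTensor 𝓜 𝓜' T (fun X => T' X + U' X) X =
      traceTensor 𝓜 𝓜' T T' X + traceTensor 𝓜 𝓜' T U' X := by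
  simp only [traceTensor, TensorProduct.map_add_right, LinearMap.comp_add, LinearMap.add_comp]

theorem traceTensor_smul_left {S : DGHSemicat.{w, v} k H} {S' : DGHSemicat.{w', v'} k H} {p q : ℕ}
    (c : k) (T : ∀ X : S.Ob, M ⊗[k] S.Hom p X X →ₗ[k] k)
    (T' : ∀ X : S'.Ob, M' ⊗[k] S'.Hom q X X →ₗ[k] k)
    (X : (S.tensor S').Ob) : traceTensor 𝓜 𝓜' (fun X => c • T X) T' X =
      c • traceTensor 𝓜 𝓜' T T' X := by
  simp only [traceTensor, TensorProduct.map_smul_left, LinearMap.comp_smul, LinearMap.smul_comp]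

theorem traceTensor_smul_right {S : DGHSemicat.{w, v} k H} {S' : DGHSemicat.{w', v'} k H}
    {p q : ℕ} (c : k) (T : ∀ X : S.Ob, M ⊗[k] S.Hom p X X →ₗ[k] k)
    (T' : ∀ X : S'.Ob, M' ⊗[k] S'.Hom q X X →ₗ[k] k)
    (X : (S.tensor S').Ob) : traceTensor 𝓜 𝓜' T (fun X => c • T' X) X =
      c • traceTensor 𝓜 𝓜' T T' X := by
  simp only [traceTensor, TensorProduct.map_smul_right, LinearMap.comp_smul, LinearMap.smul_comp]

variable [BijectiveAntipode k H] (hsub : CotensorIsSubmodule 𝓜 𝓜')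
  {D : Type u} [SmallCategory D] [Preadditive D] [Linear k D] [HCategory k H D]
  {D' : Type u'} [SmallCategory D'] [Preadditive D'] [Linear k D'] [HCategory k H D'] {p q : ℕ}

/-- The tensor product of two cycles. -/
noncomputable def CycleOver.prod (C : CycleOver.{u, w, v} D 𝓜 p)
    (C' : CycleOver.{u', w', v'} D' 𝓜' q) :
    CycleOver.{max u u', max w w', max v v'} (TensorCat k D D') (𝓜.cotensor 𝓜' hsub) (p + q) :=
  C.tensor hsub C' (traceTensor_isClosedGradedTrace hsub C.isTrace C'.isTrace)

/-- Pull T # T' back along the tensor product of the two maps from universal forms. The result is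
built from the pulled back traces, and by `formTrace_character` those depend only on the characters.
-/
theorem character_prod (C : CycleOver.{u, w, v} D 𝓜 p) (C' : CycleOver.{u', w', v'} D' 𝓜' q)
    {φ : cocycles 𝓜 D p} {φ' : cocycles 𝓜' D' q} (hC : C.character = φ) (hC' : C'.character = φ') :
    (C.prod hsub C').character =
      ((universalCycle φ).prod hsub (universalCycle φ')).character := by
  refine cochain_ext fun z X a => ?_
  rw [CycleOver.character_of, CycleOver.character_of]
  refine (traceTensor_word_of_push (Om.lift C.ρ) (Om.lift C'.ρ) (Om.incl_push_lift C.ρ)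
    (Om.incl_push_lift C'.ρ) C.T C'.T X z a).trans ?_
  have e : (fun X : D => C.T (C.ρ.obj X) ∘ₗ (Om.liftMap C.ρ p X X).lTensor M) =
      fun X => formTrace 𝓜 φ.1 X := funext fun X => by rw [← hC, formTrace_character]
  have e' : (fun X : D' => C'.T (C'.ρ.obj X) ∘ₗ (Om.liftMap C'.ρ q X X).lTensor M') =
      fun X => formTrace 𝓜' φ'.1 X := funext fun X => by rw [← hC', formTrace_character]
  exact congrArg₂ (fun T T' => traceTensor (S := Om.semicat k H D) (S' := Om.semicat k H D')
    𝓜 𝓜' T T' (((Om.incl k H D).tensor (Om.incl k H D')).obj X)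
    (z ⊗ₜ ((Om.incl k H D).tensor (Om.incl k H D')).word (p + q) X X a)) e e'

/-- The tensor product of the functionals on forms defined by two cochains. -/
noncomputable def prodTrace (φ : Cochain 𝓜 D p) (φ' : Cochain 𝓜' D' q)
    (X : ((Om.semicat k H D).tensor (Om.semicat k H D')).Ob) :
    Cotensor 𝓜 𝓜' ⊗[k] ((Om.semicat k H D).tensor (Om.semicat k H D')).Hom (p + q) X X →ₗ[k] k :=
  traceTensor (S := Om.semicat k H D) (S' := Om.semicat k H D') 𝓜 𝓜'
    (fun X : D => formTrace 𝓜 φ X) (fun X : D' => formTrace 𝓜' φ' X) X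

theorem prodTrace_add_left (φ ψ : Cochain 𝓜 D p) (φ' : Cochain 𝓜' D' q) :
    prodTrace (φ + ψ) φ' = prodTrace φ φ' + prodTrace ψ φ' :=
  funext fun X => traceTensor_add_left (S := Om.semicat k H D) (S' := Om.semicat k H D')
    (fun X : D => formTrace 𝓜 φ X) (fun X : D => formTrace 𝓜 ψ X)
    (fun X : D' => formTrace 𝓜' φ' X) X

theorem prodTrace_smul_left (c : k) (φ : Cochain 𝓜 D p) (φ' : Cochain 𝓜' D' q) :
    prodTrace (c • φ) φ' = c • prodTrace φ φ' :=
  funext fun X => traceTensor_smul_left (S := Om.semicat k H D) (S' := Om.semicat k H D') c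
    (fun X : D => formTrace 𝓜 φ X) (fun X : D' => formTrace 𝓜' φ' X) X

theorem prodTrace_add_right (φ : Cochain 𝓜 D p) (φ' ψ' : Cochain 𝓜' D' q) :
    prodTrace φ (φ' + ψ') = prodTrace φ φ' + prodTrace φ ψ' :=
  funext fun X => traceTensor_add_right (S := Om.semicat k H D) (S' := Om.semicat k H D')
    (fun X : D => formTrace 𝓜 φ X) (fun X : D' => formTrace 𝓜' φ' X)
    (fun X : D' => formTrace 𝓜' ψ' X) X

theorem prodTrace_smul_right (c : k) (φ : Cochain 𝓜 D p) (φ' : Cochain 𝓜' D' q) :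
    prodTrace φ (c • φ') = c • prodTrace φ φ' :=
  funext fun X => traceTensor_smul_right (S := Om.semicat k H D) (S' := Om.semicat k H D') c
    (fun X : D => formTrace 𝓜 φ X) (fun X : D' => formTrace 𝓜' φ' X) X

variable (k H D D') in
/-- The inclusion of `D ⊗ D'` in the tensor product of the forms. -/
noncomputable abbrev prodIncl : HSemifunctor (k := k) (H := H) (TensorCat k D D')
    ((Om.semicat k H D).tensor (Om.semicat k H D')) :=
  (Om.incl k H D).tensor (Om.incl k H D')

theorem character_prod_of (φ : cocycles 𝓜 D p) (φ' : cocycles 𝓜' D' q) (z : Cotensor 𝓜 𝓜')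
    {X : TensorCat k D D'} (a : strand k (p + q) X X) :
    ((universalCycle φ).prod hsub (universalCycle φ')).character (z ⊗ₜ CN.of (p + q) X a) =
      prodTrace φ.1 φ'.1 ((prodIncl k H D D').obj X)
        (z ⊗ₜ (prodIncl k H D D').word (p + q) X X a) :=
  CycleOver.character_of _ _ _

variable (D D' p q) in
/-- The product of cyclic cocycles. -/
noncomputable def cocycleProduct : cocycles 𝓜 D p →ₗ[k] cocycles 𝓜' D' q →ₗ[k]
    cocycles (𝓜.cotensor 𝓜' hsub) (TensorCat k D D') (p + q) :=
  -- The semicategory and the semifunctor of the product of universal cycles do not depend on φ and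
  -- φ'; only the trace does, and it is bilinear in them.
  LinearMap.mk₂ k (fun φ φ' => ⟨((universalCycle φ).prod hsub (universalCycle φ')).character,
      CycleOver.character_mem _⟩)
    (fun φ ψ φ' => Subtype.ext (cochain_ext fun z X a => by
      simp only [Submodule.coe_add, LinearMap.add_apply, character_prod_of, prodTrace_add_left,
        Pi.add_apply]))
    (fun c φ φ' => Subtype.ext (cochain_ext fun z X a => by
      simp only [Submodule.coe_smul, LinearMap.smul_apply, character_prod_of, prodTrace_smul_left,
        Pi.smul_apply]))
    (fun φ φ' ψ' => Subtype.ext (cochain_ext fun z X a => by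
      simp only [Submodule.coe_add, LinearMap.add_apply, character_prod_of, prodTrace_add_right,
        Pi.add_apply]))
    (fun c φ φ' => Subtype.ext (cochain_ext fun z X a => by
      simp only [Submodule.coe_smul, LinearMap.smul_apply, character_prod_of, prodTrace_smul_right,
        Pi.smul_apply]))

end Product

end HopfCyclic

namespace HopfCyclic

/-! ### The degree one map attached to a derivation. -/

section Homotopy

universe w v

theorem diagAct_map_of {k H A A' B B' : Type*} [Field k] [Ring H] [HopfAlgebra k H]
    [AddCommGroup A] [Module k A] [AddCommGroup A'] [Module k A']
    [AddCommGroup B] [Module k B] [AddCommGroup B'] [Module k B']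
    (a : H →ₐ[k] Module.End k A) (a' : H →ₐ[k] Module.End k A')
    (b : H →ₐ[k] Module.End k B) (b' : H →ₐ[k] Module.End k B')
    (f : A →ₗ[k] A') (g : B →ₗ[k] B') (x : A) (y : B) (hx : ∀ h, f (a h x) = a' h (f x))
    (hy : ∀ h, g (b h y) = b' h (g y)) (h : H) :
    TensorProduct.map f g (diagAct a b h (x ⊗ₜ y)) = diagAct a' b' h (f x ⊗ₜ g y) := by
  rw [diagAct_apply, diagAct_apply]
  induction comul (R := k) h with
  | zero => simp
  | add s t hs ht => simp only [map_add, LinearMap.add_apply, hs, ht]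
  | tmul s t => simp [hx, hy]

variable {k H : Type*} [Field k] [Ring H] [HopfAlgebra k H]

section Snoc

variable {D : Type u} [SmallCategory D] [Preadditive D] [Linear k D]

/-- The linear map out of `strand k (n + 1) X Y` with given values on the tensors
`(f⁰ ⊗ ... ⊗ fⁿ) ⊗ fⁿ⁺¹`. -/
noncomputable def strandSnocLift {V : Type*} [AddCommGroup V] [Module k V] {n : ℕ} {X Y : D}
    (L : ∀ Z, strand k n X Z →ₗ[k] (Y ⟶ Z) →ₗ[k] V) : strand k (n + 1) X Y →ₗ[k] V := by
  classical
  exact (DirectSum.toModule k D V fun Z => TensorProduct.lift (L Z)) ∘ₗ strandUnsnoc n X Y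

@[simp] theorem strandSnocLift_snoc {V : Type*} [AddCommGroup V] [Module k V] {n : ℕ} {X Y Z : D}
    (L : ∀ Z, strand k n X Z →ₗ[k] (Y ⟶ Z) →ₗ[k] V) (a : strand k n X Z) (f : Y ⟶ Z) :
    strandSnocLift L (strandSnoc n X Z Y (a ⊗ₜ f)) = L Z a f := by
  classical
  simp only [strandSnocLift, LinearMap.comp_apply]
  rw [strandUnsnoc_snoc]
  exact DirectSum.toModule_lof _ _ _

theorem Om.inl_snoc (H : Type*) [Ring H] [HopfAlgebra k H] [HCategory k H D] {n : ℕ} {X Z Y : D} (a : strand k n X Z) (f : Y ⟶ Z) :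
    Om.inl (n + 1) Y X (strandSnoc n X Z Y (a ⊗ₜ f)) =
      Om.mul rfl Y Z X (Om.inl n Z X a) (Om.d (zero_add 1) Y Z (Om.of Y Z f)) := by
  have e := (Om.incl k H D).word_snoc a f
  simp only [Om.incl_word] at e
  exact e

theorem Om.dform_snoc (H : Type*) [Ring H] [HopfAlgebra k H] [HCategory k H D] {n : ℕ} {X Z Y : D} (a : strand k n X Z) (f : Y ⟶ Z) :
    Om.dform (n + 1) Y X (strandSnoc n X Z Y (a ⊗ₜ f)) =
      Om.mul rfl Y Z X (Om.dform n Z X a) (Om.d (zero_add 1) Y Z (Om.of Y Z f)) := by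
  have e := (Om.incl k H D).dword_snoc a f
  simp only [Om.incl_dword] at e
  exact e

/-- Forms are also generated from the f and the df by right multiplication with differentials of
morphisms. This matches the recursion defining `homotopy`, which works from the right end of a word.
-/
theorem Om.induction_right (H : Type*) [Ring H] [HopfAlgebra k H] [HCategory k H D]
    {motive : ∀ (n : ℕ) (X Y : D), Om k n X Y → Prop}
    (zero : ∀ n X Y, motive n X Y 0)
    (add : ∀ n X Y x y, motive n X Y x → motive n X Y y → motive n X Y (x + y))
    (of : ∀ X Y f, motive 0 X Y (Om.of X Y f))
    (d_of : ∀ X Y f, motive 1 X Y (Om.d (zero_add 1) X Y (Om.of X Y f)))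
    (mul_d_of : ∀ n X Y Z x f, motive n Y Z x → motive (n + 1) X Z
      (Om.mul rfl X Y Z x (Om.d (zero_add 1) X Y (Om.of X Y f))))
    {n : ℕ} {X Y : D} (x : Om k n X Y) : motive n X Y x := by
  have hinl : ∀ (n : ℕ) (X Y : D) (a : strand k n Y X), motive n X Y (Om.inl n X Y a) := by
    intro n
    induction n with
    | zero =>
      intro X Y a
      exact of X Y ((strandOne Y X).symm a)
    | succ n ih =>
      intro X Y a
      induction a using strand_snoc_induction with
      | zero => rw [map_zero]; exact zero _ _ _
      | add a b ha hb => rw [map_add]; exact add _ _ _ _ _ ha hb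
      | snoc Z a f =>
        rw [Om.inl_snoc H]
        exact mul_d_of n X Z Y _ f (ih Z Y a)
  have hdform : ∀ (n : ℕ) (X Y : D) (a : strand k n Y X),
      motive (n + 1) X Y (Om.dform n X Y a) := by
    intro n
    induction n with
    | zero =>
      intro X Y a
      exact d_of X Y ((strandOne Y X).symm a)
    | succ n ih =>
      intro X Y a
      induction a using strand_snoc_induction with
      | zero => rw [map_zero]; exact zero _ _ _
      | add a b ha hb => rw [map_add]; exact add _ _ _ _ _ ha hb
      | snoc Z a f =>
        rw [Om.dform_snoc H]
        exact mul_d_of (n + 1) X Z Y _ f (ih Z Y a)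
  cases n with
  | zero =>
    obtain ⟨a, rfl⟩ := Om.exists_eq_inl x
    exact hinl _ _ _ _
  | succ n =>
    obtain ⟨a, b, rfl⟩ := Om.exists_eq_inl_add_dform x
    exact add _ _ _ _ _ (hinl _ _ _ _) (hdform _ _ _ _)

end Snoc

/-- An `H`-linear derivation of degree zero of the underlying graded semicategory of `S`. -/
structure GradedDerivation (S : DGHSemicat.{w, v} k H) where
  map : ∀ (n : ℕ) (X Y : S.Ob), S.Hom n X Y →ₗ[k] S.Hom n X Y
  map_mul : ∀ {i j n : ℕ} (h : i + j = n) {X Y Z : S.Ob} (g : S.Hom i Y Z) (f : S.Hom j X Y),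
    map n X Z (S.mul h g f) = S.mul h (map i Y Z g) f + S.mul h g (map j X Y f)
  map_act : ∀ {n : ℕ} {X Y : S.Ob} (a : H) (f : S.Hom n X Y),
    map n X Y (S.act n X Y a f) = S.act n X Y a (map n X Y f)

variable {D : Type u} [SmallCategory D] [Preadditive D] [Linear k D] [HCategory k H D]
  {S : DGHSemicat.{w, v} k H} (Λ : GradedDerivation S) (ρ : HSemifunctor D S)

namespace GradedDerivation

/-- `f ↦ Λ(d(ρ f))`. -/
noncomputable def del (X Y : D) : (X ⟶ Y) →ₗ[k] S.Hom 1 (ρ.obj X) (ρ.obj Y) :=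
  Λ.map 1 _ _ ∘ₗ S.del (zero_add 1) ∘ₗ ρ.map X Y

theorem del_apply {X Y : D} (f : X ⟶ Y) :
    Λ.del ρ X Y f = Λ.map 1 _ _ (S.del (zero_add 1) (ρ.map X Y f)) := rfl

theorem del_act {X Y : D} (h : H) (f : X ⟶ Y) :
    Λ.del ρ X Y (HCategory.act (k := k) X Y h f) = S.act 1 _ _ h (Λ.del ρ X Y f) := by
  rw [del_apply, ρ.map_act, ← DGHSemicat.act_del, Λ.map_act, del_apply]

/-- Λ∘d∘ρ is a derivation along ρ: in Λ(dg·f) and Λ(g·df) the terms where Λ meets ρ(f) or ρ(g)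
vanish by hypothesis. -/
theorem del_comp (hΛ : ∀ {X Y : D} (f : X ⟶ Y), Λ.map 0 _ _ (ρ.map X Y f) = 0) {X Y Z : D}
    (g : Y ⟶ Z) (f : X ⟶ Y) :
    Λ.del ρ X Z (f ≫ g) = S.mul (add_zero 1) (Λ.del ρ Y Z g) (ρ.map X Y f) +
      S.mul (zero_add 1) (ρ.map Y Z g) (Λ.del ρ X Y f) := by
  simp only [del_apply]
  rw [ρ.map_comp_mul, DGHSemicat.del_mul (add_zero 0) (zero_add 1) (zero_add 1) (zero_add 1)
    (add_zero 1) (zero_add 1), map_add, map_smul, Λ.map_mul, Λ.map_mul, hΛ, hΛ]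
  simp

/-- The differential of `del_comp`. The cross terms Λ(dg)df and dg Λ(df) are the ones that the
coefficients in `homotopy` must balance. -/
theorem del_del_comp (hΛ : ∀ {X Y : D} (f : X ⟶ Y), Λ.map 0 _ _ (ρ.map X Y f) = 0) {X Y Z : D}
    (g : Y ⟶ Z) (f : X ⟶ Y) :
    S.del one_add_one_eq_two (Λ.del ρ X Z (f ≫ g)) =
      S.mul (add_zero 2) (S.del one_add_one_eq_two (Λ.del ρ Y Z g)) (ρ.map X Y f) -
      S.mul one_add_one_eq_two (Λ.del ρ Y Z g) (S.del (zero_add 1) (ρ.map X Y f)) +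
      (S.mul one_add_one_eq_two (S.del (zero_add 1) (ρ.map Y Z g)) (Λ.del ρ X Y f) +
      S.mul (zero_add 2) (ρ.map Y Z g) (S.del one_add_one_eq_two (Λ.del ρ X Y f))) := by
  rw [del_comp Λ ρ hΛ, map_add, DGHSemicat.del_mul (add_zero 1) one_add_one_eq_two (zero_add 1)
    one_add_one_eq_two (add_zero 2) one_add_one_eq_two,
    DGHSemicat.del_mul (zero_add 1) (zero_add 1) one_add_one_eq_two one_add_one_eq_two
    one_add_one_eq_two (zero_add 2)]
  simp [sub_eq_add_neg]

/-- Auxiliary recursion for `homotopy`: strands are mapped to degree `n + e + 1`. -/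
noncomputable def strandHomotopy (e : ℕ)
    (W : ∀ (n : ℕ) (X Y : D), strand k n X Y →ₗ[k] S.Hom (n + e) (ρ.obj Y) (ρ.obj X))
    (B : ∀ X Y : D, (Y ⟶ X) →ₗ[k] S.Hom (e + 1) (ρ.obj Y) (ρ.obj X)) :
    ∀ (n : ℕ) (X Y : D), strand k n X Y →ₗ[k] S.Hom (n + e + 1) (ρ.obj Y) (ρ.obj X)
  | 0, X, Y => by
      rw [zero_add]
      exact B X Y ∘ₗ (strandOne X Y).symm.toLinearMap
  -- A strand with index n stands for a form of degree n + e, where e = 0 for words f⁰df¹…dfⁿ and e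
  -- = 1 for words dg¹…dgⁿ⁺¹. The coefficient is (−1)^deg (deg + 1) for that degree, so a single
  -- recursion covers both kinds of words.
  | n + 1, X, Y => strandSnocLift fun Z =>
      (S.mul (by omega)).compl₁₂ (strandHomotopy e W B n X Z)
        (S.del (zero_add 1) ∘ₗ ρ.map Y Z) -
      ((-1 : k) ^ (n + e) * ((n + e + 1 : ℕ) : k)) • (S.mul (by omega)).compl₁₂ (W n X Z)
        (S.del one_add_one_eq_two ∘ₗ Λ.del ρ Y Z)

/-- `dg¹ ... dgⁿ ↦ K(dg¹ ... dgⁿ)`. -/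
noncomputable def preHomotopy : ∀ (n : ℕ) (X Y : D),
    preStrand k n X Y →ₗ[k] S.Hom (n + 1) (ρ.obj Y) (ρ.obj X)
  | 0, _, _ => 0
  | n + 1, X, Y => Λ.strandHomotopy ρ 1 (fun n X Y => ρ.dword n X Y)
      (fun X Y => -(S.del one_add_one_eq_two ∘ₗ Λ.del ρ Y X)) n X Y

/-- The map `K` of degree one from universal forms to `S` with `K(f) = 0`, `K(df) = -d(Λ(df))` and
`K(x df) = K(x) df - (-1)ⁿ (n + 1) x d(Λ(df))` for `x` of degree `n`. -/
noncomputable def homotopy (n : ℕ) (X Y : D) :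
    Om k n X Y →ₗ[k] S.Hom (n + 1) (ρ.obj X) (ρ.obj Y) :=
  Om.coprod (Λ.strandHomotopy ρ 0 (fun n X Y => ρ.word n X Y) 0 n Y X) (Λ.preHomotopy ρ n Y X)

theorem homotopy_zero {X Y : D} (x : Om k 0 X Y) : Λ.homotopy ρ 0 X Y x = 0 := by
  obtain ⟨a, rfl⟩ := Om.exists_eq_inl x
  rw [homotopy, Om.coprod_inl]
  rfl

theorem homotopy_d_of {X Y : D} (f : X ⟶ Y) :
    Λ.homotopy ρ 1 X Y (Om.d (zero_add 1) X Y (Om.of X Y f)) =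
      -S.del one_add_one_eq_two (Λ.del ρ X Y f) :=
  Om.coprod_dform (n := 0) _ (Λ.preHomotopy ρ 1 Y X) (strandOne Y X f)

theorem homotopy_mul_d_of {n : ℕ} {X Y Z : D} (x : Om k n Y Z) (f : X ⟶ Y) :
    Λ.homotopy ρ (n + 1) X Z (Om.mul rfl X Y Z x (Om.d (zero_add 1) X Y (Om.of X Y f))) =
      S.mul rfl (Λ.homotopy ρ n Y Z x) (S.del (zero_add 1) (ρ.map X Y f)) -
      ((-1 : k) ^ n * ((n + 1 : ℕ) : k)) • S.mul (add_assoc n 1 1).symm (Om.liftMap ρ n Y Z x)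
        (S.del one_add_one_eq_two (Λ.del ρ X Y f)) := by
  have hinl : ∀ a : strand k n Z Y, Λ.homotopy ρ (n + 1) X Z
      (Om.mul rfl X Y Z (Om.inl n Y Z a) (Om.d (zero_add 1) X Y (Om.of X Y f))) =
      S.mul rfl (Λ.homotopy ρ n Y Z (Om.inl n Y Z a)) (S.del (zero_add 1) (ρ.map X Y f)) -
      ((-1 : k) ^ n * ((n + 1 : ℕ) : k)) • S.mul (add_assoc n 1 1).symm
        (Om.liftMap ρ n Y Z (Om.inl n Y Z a))
        (S.del one_add_one_eq_two (Λ.del ρ X Y f)) := by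
    intro a
    rw [← Om.inl_snoc H, homotopy, homotopy, Om.coprod_inl, Om.coprod_inl, Om.liftMap_inl]
    exact strandSnocLift_snoc _ a f
  cases n with
  | zero =>
    obtain ⟨a, rfl⟩ := Om.exists_eq_inl x
    exact hinl a
  | succ n =>
    have hdform : ∀ a : strand k n Z Y, Λ.homotopy ρ (n + 1 + 1) X Z
        (Om.mul rfl X Y Z (Om.dform n Y Z a) (Om.d (zero_add 1) X Y (Om.of X Y f))) =
        S.mul rfl (Λ.homotopy ρ (n + 1) Y Z (Om.dform n Y Z a))
          (S.del (zero_add 1) (ρ.map X Y f)) -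
        ((-1 : k) ^ (n + 1) * ((n + 1 + 1 : ℕ) : k)) • S.mul (add_assoc (n + 1) 1 1).symm
          (Om.liftMap ρ (n + 1) Y Z (Om.dform n Y Z a))
          (S.del one_add_one_eq_two (Λ.del ρ X Y f)) := by
      intro a
      have e : ∀ {m : ℕ} {X Y : D} (b : strand k m Y X),
          Λ.homotopy ρ (m + 1) X Y (Om.dform m X Y b) = Λ.preHomotopy ρ (m + 1) Y X b :=
        fun b => Om.coprod_dform _ _ b
      rw [← Om.dform_snoc H, e, e, Om.liftMap_dform]
      exact strandSnocLift_snoc _ a f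
    obtain ⟨a, b, rfl⟩ := Om.exists_eq_inl_add_dform x
    simp only [map_add, LinearMap.add_apply, hinl, hdform, smul_add]
    abel

/-- The recursion alters only the right end of a word, so it commutes with multiplication on the
left. In the base case f·dg both sides are −f d(Λ(dg)), as the coefficient in degree zero is 1. -/
theorem homotopy_head {n : ℕ} {X Y Z : D} (f : Y ⟶ Z) (x : Om k n X Y) :
    Λ.homotopy ρ n X Z (Om.head n X Y Z (f ⊗ₜ x)) =
      S.mul (zero_add (n + 1)) (ρ.map Y Z f) (Λ.homotopy ρ n X Y x) := by
  induction x using @Om.induction_right k _ D _ _ _ H _ _ _ with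
  | zero => simp
  | add n X Y x y hx hy => simp only [TensorProduct.tmul_add, map_add, hx, hy]
  | of X Y g => rw [homotopy_zero, homotopy_zero, map_zero]
  | d_of X Y g =>
    rw [← Om.zero_mul_of, homotopy_d_of]
    refine (homotopy_mul_d_of Λ ρ _ _).trans ?_
    rw [homotopy_zero, Om.liftMap_of]
    simp
  | mul_d_of n X Y W x g hx =>
    rw [← Om.head_mul, homotopy_mul_d_of, homotopy_mul_d_of, hx, Om.liftMap_head, map_sub, map_smul,
      DGHSemicat.mul_assoc (zero_add (n + 1)) rfl rfl (zero_add (n + 1 + 1)),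
      DGHSemicat.mul_assoc (zero_add n) _ _ (zero_add (n + 1 + 1))]

/-- The defect of right linearity of K is what makes the correction work: under the trace, the term
with coefficient n cancels all but one of n + 1 copies of T(x Λ(df)), and the remaining copy joins
Λ(x)df to form Λ(x df). In the induction step from x to x dg, comparing the terms x Λ(dg) df and x
dg Λ(df) is what fixes the coefficient −(−1)ⁿ(n + 1) in the recursion. -/
theorem homotopy_mul_of (hΛ : ∀ {X Y : D} (f : X ⟶ Y), Λ.map 0 _ _ (ρ.map X Y f) = 0)
    {n : ℕ} {X Y Z : D} (x : Om k n Y Z) (f : X ⟶ Y) :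
    Λ.homotopy ρ n X Z (Om.mul (add_zero n) X Y Z x (Om.of X Y f)) =
      S.mul (add_zero (n + 1)) (Λ.homotopy ρ n Y Z x) (ρ.map X Y f) -
      (-1 : k) ^ n • (S.mul rfl (Λ.map n _ _ (Om.liftMap ρ n Y Z x))
          (S.del (zero_add 1) (ρ.map X Y f)) -
        (n : k) • S.mul rfl (Om.liftMap ρ n Y Z x) (Λ.del ρ X Y f)) := by
  have hd : ∀ {X Y Z : D} (g : Y ⟶ Z) (f : X ⟶ Y),
      Om.mul (add_zero 1) X Y Z (Om.d (k := k) (zero_add 1) Y Z (Om.of Y Z g)) (Om.of X Y f) =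
      Om.d (zero_add 1) X Z (Om.of X Z (f ≫ g)) -
        Om.mul (zero_add 1) X Y Z (Om.of Y Z g) (Om.d (zero_add 1) X Y (Om.of X Y f)) := by
    intro X Y Z g f
    have e : Om.of X Z (f ≫ g) = Om.mul (k := k) (add_zero 0) X Y Z (Om.of Y Z g) (Om.of X Y f) :=
      (Om.incl k H D).map_comp g f
    rw [e, Om.d_mul (m := 0) (zero_add 1) (zero_add 1) (add_zero 0) (zero_add 1) (add_zero 1)
      (zero_add 1), pow_zero, one_smul]
  induction x using @Om.induction_right k _ D _ _ _ H _ _ _ generalizing X with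
  | zero => simp
  | add n Y Z x y hx hy =>
    simp only [map_add, LinearMap.add_apply, hx, hy, smul_add, smul_sub]
    abel
  | of Y Z g =>
    rw [homotopy_zero, homotopy_zero, Om.liftMap_of, hΛ]
    simp
  | d_of Y Z g =>
    rw [hd, map_sub, homotopy_d_of, homotopy_d_of, del_del_comp Λ ρ hΛ]
    have e := homotopy_mul_d_of Λ ρ (Om.of Y Z g) f
    rw [homotopy_zero, Om.liftMap_of] at e
    refine (congrArg (fun z => _ - z) e).trans ?_
    rw [Om.liftMap_d, Om.liftMap_of, ← del_apply]
    simp only [map_zero, map_neg, LinearMap.zero_apply, LinearMap.neg_apply]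
    simp
    abel
  | mul_d_of n Y W Z x g hx =>
    -- Rewriting dg·f as d(gf) − g·df brings x dg·f into words ending in a differential, to which
    -- the recursion for K applies; x g is covered by the induction hypothesis.
    have e1 : Om.mul (add_zero (n + 1)) X Y Z (Om.mul rfl Y W Z x
        (Om.d (zero_add 1) Y W (Om.of Y W g))) (Om.of X Y f) =
        Om.mul rfl X W Z x (Om.d (zero_add 1) X W (Om.of X W (f ≫ g))) -
        Om.mul rfl X Y Z (Om.mul (add_zero n) Y W Z x (Om.of Y W g))
          (Om.d (zero_add 1) X Y (Om.of X Y f)) := by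
      rw [Om.mul_assoc rfl (add_zero 1) _ rfl, hd, map_sub,
        Om.mul_assoc (add_zero n) (zero_add 1) rfl rfl]
    have e2 : Om.liftMap ρ n Y Z (Om.mul (add_zero n) Y W Z x (Om.of Y W g)) =
        S.mul (add_zero n) (Om.liftMap ρ n W Z x) (ρ.map Y W g) := by
      rw [Om.liftMap_mul, Om.liftMap_of]
    have e3 : Om.liftMap ρ (n + 1) Y Z (Om.mul rfl Y W Z x (Om.d (zero_add 1) Y W (Om.of Y W g))) =
        S.mul rfl (Om.liftMap ρ n W Z x) (S.del (zero_add 1) (ρ.map Y W g)) := by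
      rw [Om.liftMap_mul, Om.liftMap_d, Om.liftMap_of]
    rw [e1, map_sub, homotopy_mul_d_of, homotopy_mul_d_of, homotopy_mul_d_of, hx, e2, e3,
      del_del_comp Λ ρ hΛ, Λ.map_mul, ← del_apply, ρ.map_comp_mul,
      DGHSemicat.del_mul (add_zero 0) (zero_add 1) (zero_add 1) (zero_add 1)
        (add_zero 1) (zero_add 1)]
    simp only [map_add, map_sub, map_smul, LinearMap.add_apply, LinearMap.sub_apply,
      LinearMap.smul_apply, pow_zero, one_smul]
    generalize Λ.homotopy ρ n W Z x = Kx
    generalize Om.liftMap ρ n W Z x = px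
    generalize Λ.del ρ Y W g = dg
    generalize Λ.del ρ X Y f = df
    generalize ρ.map Y W g = rg
    generalize ρ.map X Y f = rf
    -- Once all products are associated to the right, the two sides are the same linear combination
    -- of the same elements.
    rw [DGHSemicat.mul_assoc (add_zero (n + 1)) (zero_add 1) rfl rfl Kx rg,
      DGHSemicat.mul_assoc rfl (add_zero 1) (add_zero _) rfl Kx,
      DGHSemicat.mul_assoc rfl one_add_one_eq_two rfl (add_assoc n 1 1).symm px dg,
      DGHSemicat.mul_assoc rfl one_add_one_eq_two rfl (add_assoc n 1 1).symm px _ df,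
      DGHSemicat.mul_assoc (add_zero n) (zero_add 2) (add_assoc n 1 1).symm (add_assoc n 1 1).symm,
      DGHSemicat.mul_assoc (add_assoc n 1 1).symm (add_zero 2) (add_zero _) (add_assoc n 1 1).symm px]
    push_cast
    module

/-- K sends exact forms to exact elements, so that T∘K vanishes on exact forms and comes from a
cochain. On df the primitive is −Λ(df). A primitive y for dx yields y df minus a multiple of x
d(Λ(df)) as primitive for d(x df), because df and d(Λ(df)) are closed. -/
theorem exists_homotopy_d {n : ℕ} {X Y : D} (x : Om k n X Y) :
    ∃ y, Λ.homotopy ρ (n + 1) X Y (Om.d rfl X Y x) = S.del rfl y := by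
  induction x using @Om.induction_right k _ D _ _ _ H _ _ _ with
  | zero => exact ⟨0, by simp⟩
  | add n X Y x y hx hy =>
    obtain ⟨x', hx⟩ := hx
    obtain ⟨y', hy⟩ := hy
    exact ⟨x' + y', by rw [map_add, map_add, hx, hy, map_add]⟩
  | of X Y f => exact ⟨-Λ.del ρ X Y f, by rw [map_neg]; exact homotopy_d_of Λ ρ f⟩
  | d_of X Y f => exact ⟨0, by rw [Om.d_d, map_zero, map_zero]⟩
  | mul_d_of n X Y Z x f hx =>
    obtain ⟨y, hy⟩ := hx
    have e : Om.d (n := n + 1 + 1) rfl X Z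
        (Om.mul rfl X Y Z x (Om.d (zero_add 1) X Y (Om.of X Y f))) =
        Om.mul rfl X Y Z (Om.d rfl Y Z x) (Om.d (zero_add 1) X Y (Om.of X Y f)) := by
      rw [Om.d_mul (m := n + 1) (j' := 2) rfl rfl rfl rfl rfl (by omega), Om.d_d, map_zero, smul_zero,
        sub_zero]
    refine ⟨S.mul rfl y (S.del (zero_add 1) (ρ.map X Y f)) -
      ((-1 : k) ^ (n + 1) * ((n + 1 + 1 : ℕ) : k)) • S.mul (add_assoc n 1 1).symm
        (Om.liftMap ρ n Y Z x) (S.del one_add_one_eq_two (Λ.del ρ X Y f)), ?_⟩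
    rw [e, homotopy_mul_d_of, hy, Om.liftMap_d, map_sub, map_smul,
      DGHSemicat.del_mul (j' := 2) rfl rfl rfl rfl rfl (by omega),
      DGHSemicat.del_mul (j' := 3) (add_assoc n 1 1).symm rfl rfl rfl (by omega) (by omega),
      DGHSemicat.del_del, DGHSemicat.del_del]
    simp

/-- K is assembled from d, Λ, ρ and composition, all compatible with `H`; induction from the right
end reduces to the recursion. -/
theorem homotopy_act {n : ℕ} {X Y : D} (h : H) (x : Om k n X Y) :
    Λ.homotopy ρ n X Y (Om.act n X Y h x) = S.act (n + 1) _ _ h (Λ.homotopy ρ n X Y x) := by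
  induction x using @Om.induction_right k _ D _ _ _ H _ _ _ generalizing h with
  | zero => simp
  | add n X Y x y hx hy => simp only [map_add, hx, hy]
  | of X Y f => rw [homotopy_zero, homotopy_zero, map_zero]
  | d_of X Y f =>
    rw [Om.act_d, Om.act_of, homotopy_d_of, homotopy_d_of, del_act, ← DGHSemicat.act_del]
    exact (map_neg _ _).symm
  | mul_d_of n X Y Z x f hx =>
    have e1 := diagAct_map_of (Om.act n Y Z) (Om.act n Y Z) (HCategory.act (k := k) X Y)
      (Om.act 1 X Y) LinearMap.id (Om.d (zero_add 1) X Y ∘ₗ Om.of X Y) x f (fun _ => rfl)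
      (fun h => by
        rw [LinearMap.comp_apply, LinearMap.comp_apply, Om.act_d, Om.act_of]) h
    have e2 := diagAct_map_of (Om.act n Y Z) (S.act (n + 1) _ _) (HCategory.act (k := k) X Y)
      (S.act 1 _ _) (Λ.homotopy ρ n Y Z) (S.del (zero_add 1) ∘ₗ ρ.map X Y) x f hx
      (fun h => by
        rw [LinearMap.comp_apply, LinearMap.comp_apply, DGHSemicat.act_del, ρ.map_act]) h
    have e3 := diagAct_map_of (Om.act n Y Z) (S.act n _ _) (HCategory.act (k := k) X Y)
      (S.act 2 _ _) (Om.liftMap ρ n Y Z) (S.del one_add_one_eq_two ∘ₗ Λ.del ρ X Y) x f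
      (fun h => Om.liftMap_act ρ h x) (fun h => by
        rw [LinearMap.comp_apply, LinearMap.comp_apply, DGHSemicat.act_del, del_act]) h
    have e4 : Λ.homotopy ρ (n + 1) X Z ∘ₗ TensorProduct.lift (Om.mul rfl X Y Z) ∘ₗ
        TensorProduct.map LinearMap.id (Om.d (zero_add 1) X Y ∘ₗ Om.of X Y) =
        S.comp rfl _ _ _ ∘ₗ TensorProduct.map (Λ.homotopy ρ n Y Z)
          (S.del (zero_add 1) ∘ₗ ρ.map X Y) -
        ((-1 : k) ^ n * ((n + 1 : ℕ) : k)) • S.comp (add_assoc n 1 1).symm _ _ _ ∘ₗ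
          TensorProduct.map (Om.liftMap ρ n Y Z) (S.del one_add_one_eq_two ∘ₗ Λ.del ρ X Y) := by
      ext x f
      exact homotopy_mul_d_of Λ ρ x f
    have e5 := LinearMap.congr_fun e4 (diagAct (Om.act n Y Z) (HCategory.act (k := k) X Y) h
      (x ⊗ₜ f))
    simp only [LinearMap.comp_apply, LinearMap.sub_apply, LinearMap.smul_apply, e1, e2, e3] at e5
    rw [Om.act_mul, homotopy_mul_d_of, map_sub, map_smul, ← DGHSemicat.comp_tmul,
      ← DGHSemicat.comp_tmul, S.act_comp, S.act_comp]
    exact e5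

end GradedDerivation

end Homotopy

end HopfCyclic

namespace HopfCyclic

/-! ### From a commutator formula to a coboundary. -/

section Descent

universe w v

variable {k H M : Type*} [Field k] [Ring H] [HopfAlgebra k H] [AddCommGroup M] [Module k M]
  {𝓜 : SAYDModule k H M}
  {D : Type u} [SmallCategory D] [Preadditive D] [Linear k D]

/-- A family of functionals on `n`-forms that vanish on exact forms comes from a cochain. -/
theorem exists_formTrace_eq {n : ℕ} (T : ∀ X : D, M ⊗[k] Om k n X X →ₗ[k] k)
    (hT : ∀ {i : ℕ} (h : i + 1 = n) (X : D) (m : M) (x : Om k i X X),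
      T X (m ⊗ₜ Om.d h X X x) = 0) :
    ∃ χ : Cochain 𝓜 D n, ∀ X, formTrace 𝓜 χ X = T X := by
  refine ⟨TensorProduct.lift (LinearMap.flip (CN.lift fun X =>
    (TensorProduct.curry (T X ∘ₗ (Om.inl n X X).lTensor M)).flip)), fun X => ?_⟩
  ext m x
  rw [TensorProduct.AlgebraTensorModule.curry_apply, TensorProduct.AlgebraTensorModule.curry_apply,
    LinearMap.restrictScalars_self, LinearMap.restrictScalars_self, TensorProduct.curry_apply,
    TensorProduct.curry_apply]
  cases n with
  | zero =>
    obtain ⟨a, rfl⟩ := Om.exists_eq_inl x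
    rw [formTrace_inl]
    simp
  | succ n =>
    obtain ⟨a, b, rfl⟩ := Om.exists_eq_inl_add_dform x
    rw [TensorProduct.tmul_add, map_add, map_add, formTrace_inl,
      ← Om.d_inl, formTrace_d, hT rfl]
    simp

variable [HCategory k H D] [BijectiveAntipode k H]

/-- The identity e of X is only an idempotent among forms, so e·df need not be df. From e² = e one
gets e·de·e = 0, hence e·de·f = 0. Since fe = f, moving f around the trace identifies the value on
de·f with that on e·de·f, which is zero. As df = de·f + e·df is exact, the value on e·df vanishes
too. This supplies cyclicity in degree zero. -/
theorem formTrace_id_mul_d {φ : Cochain 𝓜 D 1} (hφ : φ ∈ cocycles 𝓜 D 1) {X : D} (m : M)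
    (f : X ⟶ X) :
    formTrace 𝓜 φ X (m ⊗ₜ Om.mul (zero_add 1) X X X (Om.of X X (𝟙 X))
      (Om.d (zero_add 1) X X (Om.of X X f))) = 0 := by
  have hof : ∀ {X Y Z : D} (g : Y ⟶ Z) (f : X ⟶ Y), Om.mul (k := k) (add_zero 0) X Y Z
      (Om.of Y Z g) (Om.of X Y f) = Om.of X Z (f ≫ g) :=
    fun g f => ((Om.incl k H D).map_comp g f).symm
  let e : Om k 0 X X := Om.of X X (𝟙 X)
  let de : Om k 1 X X := Om.d (zero_add 1) X X e
  have he : ∀ g : X ⟶ X, Om.mul (add_zero 0) X X X (Om.of X X g) e = Om.of X X g := fun g => by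
    rw [hof, Category.id_comp]
  have he' : Om.mul (add_zero 0) X X X e (Om.of X X f) = Om.of X X f := by
    rw [hof, Category.comp_id]
  have hdf : Om.d (zero_add 1) X X (Om.of X X f) = Om.mul (add_zero 1) X X X de (Om.of X X f) +
      Om.mul (zero_add 1) X X X e (Om.d (zero_add 1) X X (Om.of X X f)) := by
    rw [Om.d_mul (m := 0) (zero_add 1) (zero_add 1) (add_zero 0) (zero_add 1) (add_zero 1)
      (zero_add 1), he', pow_zero, one_smul, sub_add_cancel]
  have hee : Om.mul (zero_add 1) X X X e (Om.mul (add_zero 1) X X X de e) = 0 := by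
    have h := Om.d_mul (m := 0) (zero_add 1) (zero_add 1) (add_zero 0) (zero_add 1) (add_zero 1)
      (zero_add 1) e e
    rw [he, pow_zero, one_smul] at h
    rw [h, map_sub, ← Om.mul_assoc (add_zero 0) (zero_add 1) (zero_add 1) (zero_add 1), he, sub_self]
  have h1 : Om.mul (add_zero 1) X X X (Om.mul (zero_add 1) X X X e de) (Om.of X X f) = 0 := by
    rw [← he', ← Om.mul_assoc (add_zero 1) (add_zero 0) (add_zero 1) (add_zero 1),
      Om.mul_assoc (zero_add 1) (add_zero 1) (add_zero 1) (zero_add 1), hee, map_zero,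
      LinearMap.zero_apply]
  have h2 : Om.twist 𝓜 (zero_add 1) X X (Om.of X X f) (Om.mul (zero_add 1) X X X e de) m =
      Om.twist 𝓜 (zero_add 1) X X (Om.of X X f) de m := by
    rw [Om.twist_apply, Om.twist_apply]
    congr 2
    ext h
    simp only [LinearMap.comp_apply, LinearMap.flip_apply, orbit_apply, Om.act_of]
    rw [← Om.mul_assoc (add_zero 0) (zero_add 1) (zero_add 1) (zero_add 1), he]
  have h3 : formTrace 𝓜 φ X (m ⊗ₜ Om.mul (add_zero 1) X X X de (Om.of X X f)) = 0 := by
    rw [formTrace_commutator hφ, ← h2, ← formTrace_commutator hφ, h1, TensorProduct.tmul_zero,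
      map_zero]
  have h4 := formTrace_d φ (zero_add 1) m (Om.of X X f)
  rw [hdf, TensorProduct.tmul_add, map_add, h3, zero_add] at h4
  exact h4

/-- Suppose that `p C.T(m ⊗ x) = C.T(m ⊗ Λ x)` for a derivation `Λ` that vanishes on the image of
`D`, and that the commutators of a functional `τ` in degree `n` with morphisms `f` of `D` are given
by `C.T(m ⊗ y Λ(df))`. Then the character of `C` is a coboundary. -/
theorem CycleOver.character_mem_coboundaries {n N : ℕ} (hn : n + 1 = N)
    (C : CycleOver.{u, w, v} D 𝓜 N) (Λ : GradedDerivation C.S)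
    (hΛ : ∀ {X Y : D} (f : X ⟶ Y), Λ.map 0 _ _ (C.ρ.map X Y f) = 0) {p : k} (hp : p ≠ 0)
    (hT : ∀ (X : C.S.Ob) (m : M) (x : C.S.Hom N X X),
      C.T X (m ⊗ₜ Λ.map N X X x) = p * C.T X (m ⊗ₜ x))
    (τ : ∀ X : C.S.Ob, M ⊗[k] C.S.Hom n X X →ₗ[k] k)
    (hτ : ∀ (X : C.S.Ob) (h : H) (x : M ⊗[k] C.S.Hom n X X),
      τ X (twistedRact 𝓜 (C.S.act n X X) h x) = counit (R := k) h * τ X x)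
    (hτd : ∀ {i : ℕ} (h : i + 1 = n) (X : C.S.Ob) (m : M) (x : C.S.Hom i X X),
      τ X (m ⊗ₜ C.S.d h X X x) = 0)
    (hτc : ∀ (X Z : D) (m : M) (f : X ⟶ Z) (y : C.S.Hom n (C.ρ.obj Z) (C.ρ.obj X)),
      τ _ (m ⊗ₜ C.S.mul (add_zero n) y (C.ρ.map X Z f)) -
        τ _ (tw 𝓜 (zero_add n) (C.ρ.map X Z f) y m) =
      (-1) ^ n * C.T _ (m ⊗ₜ C.S.mul hn y (Λ.del C.ρ X Z f))) :
    C.character ∈ coboundaries 𝓜 D N := by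
  subst hn
  -- The functional (n + 1)τ − T∘K on n-forms. The factor n + 1 makes the terms T(x Λ(df)) from τ
  -- and from the defect of K add up to a single one.
  let T' : ∀ X : D, M ⊗[k] Om k n X X →ₗ[k] k := fun X =>
    ((n + 1 : ℕ) : k) • (τ (C.ρ.obj X) ∘ₗ (Om.liftMap C.ρ n X X).lTensor M) -
      C.T (C.ρ.obj X) ∘ₗ (Λ.homotopy C.ρ n X X).lTensor M
  have hT' : ∀ (X : D) (m : M) (x : Om k n X X), T' X (m ⊗ₜ x) =
      ((n + 1 : ℕ) : k) * τ (C.ρ.obj X) (m ⊗ₜ Om.liftMap C.ρ n X X x) -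
        C.T (C.ρ.obj X) (m ⊗ₜ Λ.homotopy C.ρ n X X x) := fun _ _ _ => rfl
  obtain ⟨χ, hχ⟩ := exists_formTrace_eq (𝓜 := 𝓜) T' fun {i} h X m x => by
    subst h
    obtain ⟨y, hy⟩ := Λ.exists_homotopy_d C.ρ x
    rw [hT', Om.liftMap_d, hy, hτd, C.isTrace.closed, mul_zero, sub_zero]
  -- Up to (−1)ⁿ the commutator is (n + 1)T(x Λ(df)) + T(Λ(x)df) − n T(x Λ(df)), which is T(Λ(x df))
  -- = p T(x df). The remaining term K(x)f cancels against f K(x) by the trace property of T.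
  have hcomm : ∀ {X Z : D} (m : M) (x : Om k n Z X) (f : X ⟶ Z),
      formTrace 𝓜 χ X (m ⊗ₜ Om.mul (add_zero n) X Z X x (Om.of X Z f)) -
        formTrace 𝓜 χ Z (Om.twist 𝓜 (zero_add n) X Z (Om.of X Z f) x m) =
      (-1) ^ n * (p * C.T _ (m ⊗ₜ C.S.mul rfl (Om.liftMap C.ρ n Z X x)
        (C.S.del (zero_add 1) (C.ρ.map X Z f)))) := by
    intro X Z m x f
    have e1 : (Om.liftMap C.ρ n Z Z).lTensor M
        (Om.twist 𝓜 (zero_add n) X Z (Om.of X Z f) x m) =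
        tw 𝓜 (zero_add n) (C.ρ.map X Z f) (Om.liftMap C.ρ n Z X x) m := by
      refine (lTensor_map_tw 𝓜 (Om.lift C.ρ) (zero_add n) (X := X) (Y := Z) (Om.of X Z f) x m).trans
        ?_
      rw [← Om.liftMap_of]
      rfl
    have e2 : (Λ.homotopy C.ρ n Z Z).lTensor M
        (Om.twist 𝓜 (zero_add n) X Z (Om.of X Z f) x m) =
        tw 𝓜 (zero_add (n + 1)) (C.ρ.map X Z f) (Λ.homotopy C.ρ n Z X x) m := by
      rw [Om.twist_apply, tw_apply, lTensor_spread]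
      congr 2
      ext h
      simp only [LinearMap.comp_apply, LinearMap.flip_apply, orbit_apply, Om.act_of]
      rw [Om.zero_mul_of, Λ.homotopy_head, C.ρ.map_act]
    have e3 := hτc X Z m f (Om.liftMap C.ρ n Z X x)
    have e4 := C.isTrace.mul_swap (add_zero (n + 1)) (zero_add (n + 1)) m (C.ρ.map X Z f)
      (Λ.homotopy C.ρ n Z X x)
    have e5 := hT _ m (C.S.mul rfl (Om.liftMap C.ρ n Z X x) (C.S.del (zero_add 1) (C.ρ.map X Z f)))
    rw [Λ.map_mul, TensorProduct.tmul_add, map_add, ← Λ.del_apply] at e5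
    rw [zero_mul, pow_zero, one_mul] at e4
    rw [hχ, hχ, hT', Om.liftMap_mul, Om.liftMap_of, Λ.homotopy_mul_of C.ρ hΛ]
    simp only [T', LinearMap.sub_apply, LinearMap.smul_apply, LinearMap.comp_apply, e1, e2,
      TensorProduct.tmul_sub, map_sub, TensorProduct.tmul_smul, map_smul, smul_eq_mul, e4]
    push_cast
    linear_combination ((n : k) + 1) * e3 + (-1) ^ n * e5
  have hinv : χ ∈ invariantCochains 𝓜 D n := by
    refine (mem_invariantCochains_iff χ).mpr fun X h x => ?_
    simp only [hχ, T', LinearMap.sub_apply, LinearMap.smul_apply, LinearMap.comp_apply]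
    rw [twistedRact_map 𝓜 _ (C.S.act n _ _) _ (fun h x => Om.liftMap_act C.ρ h x),
      twistedRact_map 𝓜 _ (C.S.act (n + 1) _ _) _ (fun h x => Λ.homotopy_act C.ρ h x), hτ,
      C.isTrace.invariant]
    simp only [smul_eq_mul]
    ring
  -- Cyclicity means that the commutator vanishes on words dg¹…dgⁿ. There x df is exact, so T kills
  -- it. In degree zero it suffices to take x = id, where `formTrace_id_mul_d` applies to the
  -- character of `C`.
  have hcyc : cyclicSigned 𝓜 D n χ = χ := by
    cases n with
    | zero =>
      refine cyclicSigned_zero_of_commutator χ fun X m f => ?_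
      rw [← sub_eq_zero, hcomm]
      have e := formTrace_id_mul_d C.character_mem m f
      rw [formTrace_character, LinearMap.comp_apply, LinearMap.lTensor_tmul, Om.liftMap_mul,
        Om.liftMap_d, Om.liftMap_of, Om.liftMap_of] at e
      rw [Om.liftMap_of, e, mul_zero, mul_zero]
    | succ n =>
      refine (cyclicSigned_succ_iff χ).mpr fun X Z m a f => ?_
      rw [← sub_eq_zero, hcomm, Om.liftMap_dform, ← C.ρ.dword_snoc, ← C.ρ.del_word_rfl,
        C.isTrace.closed rfl, mul_zero, mul_zero]
  -- On words of the first kind the commutator of χ is (−1)ⁿ bχ, and the formula above says that it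
  -- is (−1)ⁿ p times the character.
  refine ⟨p⁻¹ • χ, Submodule.smul_mem _ _ ((mem_cyclicCochains_iff χ).mpr ⟨hinv, hcyc⟩), ?_⟩
  rw [map_smul]
  refine cochain_ext_snoc fun m X Z a f => ?_
  have e := hcomm m (Om.inl n Z X a) f
  rw [formTrace_commutator_inl, Om.liftMap_inl, ← C.ρ.word_snoc, ← C.character_of] at e
  rw [LinearMap.smul_apply, mul_left_cancel₀ (pow_ne_zero n (neg_ne_zero.mpr one_ne_zero)) e,
    smul_eq_mul, inv_mul_cancel_left₀ hp]

end Descent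

end HopfCyclic

namespace HopfCyclic

/-! ### The bidegree derivation on a tensor product of cycles. -/

section ProductDescent

universe w v w' v'

variable {k H M M' : Type*} [Field k] [Ring H] [HopfAlgebra k H] [IsCocomm k H]
  [AddCommGroup M] [Module k M] [AddCommGroup M'] [Module k M']

theorem evalPair_sub_left (α α' : M →ₗ[k] k) (β : M' →ₗ[k] k) :
    evalPair (α - α') β = evalPair α β - evalPair α' β := by
  ext; simp [sub_mul]

theorem evalPair_sub_right (α : M →ₗ[k] k) (β β' : M' →ₗ[k] k) :
    evalPair α (β - β') = evalPair α β - evalPair α β' := by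
  ext; simp [mul_sub]

theorem evalPair_smul_left (c : k) (α : M →ₗ[k] k) (β : M' →ₗ[k] k) :
    evalPair (c • α) β = c • evalPair α β := by
  ext; simp [mul_assoc]

theorem evalPair_smul_right (c : k) (α : M →ₗ[k] k) (β : M' →ₗ[k] k) :
    evalPair α (c • β) = c • evalPair α β := by
  ext; simp [mul_left_comm]

section Bidegree

variable (S : DGHSemicat.{w, v} k H) (S' : DGHSemicat.{w', v'} k H)

/-- The derivation of `S ⊗ S'` that multiplies the component of degrees `(i, j)` by
`a i + b j`. -/
noncomputable def bidegree (a b : k) : GradedDerivation (S.tensor S') where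
  map n X Y := DGHSemicat.tdesc fun i j h => (a * i + b * j) • DGHSemicat.tin h X Y
  map_mul {l m n} h {X Y Z} g f := by
    induction g using DGHSemicat.tensor_induction with
    | zero => simp only [map_zero, LinearMap.zero_apply, add_zero]
    | add x y hx hy =>
      simp only [map_add, LinearMap.add_apply, hx, hy]
      abel
    | tin_tmul i i' hi g g' =>
      induction f using DGHSemicat.tensor_induction with
      | zero => simp only [map_zero, add_zero]
      | add x y hx hy =>
        simp only [map_add, hx, hy]
        abel
      | tin_tmul j j' hj f f' =>
        rw [DGHSemicat.tin_mul hi hj h rfl rfl (by omega), map_smul, DGHSemicat.tdesc_tin,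
          DGHSemicat.tdesc_tin, DGHSemicat.tdesc_tin, LinearMap.smul_apply, LinearMap.smul_apply,
          LinearMap.smul_apply, map_smul, map_smul, LinearMap.smul_apply,
          DGHSemicat.tin_mul hi hj h rfl rfl (by omega)]
        push_cast
        module
  map_act {n X Y} c f := by
    induction f using DGHSemicat.tensor_induction with
    | zero => simp only [map_zero]
    | add x y hx hy => simp only [map_add, hx, hy]
    | tin_tmul i j hij f f' =>
      rw [DGHSemicat.tin_act, DGHSemicat.tdesc_tin, DGHSemicat.tdesc_tin, LinearMap.smul_apply,
        LinearMap.smul_apply, map_smul, DGHSemicat.tin_act]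

theorem bidegree_tin (a b : k) {i j n : ℕ} (h : i + j = n) {X Y : (S.tensor S').Ob}
    (x : S.Hom i X.1 Y.1 ⊗[k] S'.Hom j X.2 Y.2) :
    (bidegree S S' a b).map n X Y (DGHSemicat.tin h X Y x) =
      (a * i + b * j) • DGHSemicat.tin h X Y x :=
  DGHSemicat.tdesc_tin (fun i j h => (a * i + b * j) • DGHSemicat.tin h X Y) h x

variable {S S'} {D : Type u} [SmallCategory D] [Preadditive D] [Linear k D] [HCategory k H D]
  {D' : Type u'} [SmallCategory D'] [Preadditive D'] [Linear k D'] [HCategory k H D']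
  (ρ : HSemifunctor D S) (ρ' : HSemifunctor D' S')

/-- `ρ ⊗ ρ'` with its values in morphisms between explicit pairs of objects. -/
noncomputable def tensorHom (X Y : D) (X' Y' : D') : (X ⟶ Y) ⊗[k] (X' ⟶ Y') →ₗ[k]
    (S.tensor S').Hom 0 (DGHSemicat.tob (ρ.obj X) (ρ'.obj X'))
      (DGHSemicat.tob (ρ.obj Y) (ρ'.obj Y')) :=
  DGHSemicat.tin (add_zero 0) _ _ ∘ₗ TensorProduct.map (ρ.map X Y) (ρ'.map X' Y')

/-- `f ⊗ f' ↦ a df ⊗ f' + b f ⊗ df'`. -/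
noncomputable def tensorDel (a b : k) (X Y : D) (X' Y' : D') : (X ⟶ Y) ⊗[k] (X' ⟶ Y') →ₗ[k]
    (S.tensor S').Hom 1 (DGHSemicat.tob (ρ.obj X) (ρ'.obj X'))
      (DGHSemicat.tob (ρ.obj Y) (ρ'.obj Y')) :=
  a • DGHSemicat.tin (add_zero 1) (DGHSemicat.tob (ρ.obj X) (ρ'.obj X'))
      (DGHSemicat.tob (ρ.obj Y) (ρ'.obj Y')) ∘ₗ
      TensorProduct.map (S.del (zero_add 1) ∘ₗ ρ.map X Y) (ρ'.map X' Y') +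
    b • DGHSemicat.tin (zero_add 1) (DGHSemicat.tob (ρ.obj X) (ρ'.obj X'))
      (DGHSemicat.tob (ρ.obj Y) (ρ'.obj Y')) ∘ₗ
      TensorProduct.map (ρ.map X Y) (S'.del (zero_add 1) ∘ₗ ρ'.map X' Y')

theorem bidegree_tensorHom (a b : k) {X Y : D} {X' Y' : D'} (f : (X ⟶ Y) ⊗[k] (X' ⟶ Y')) :
    (bidegree S S' a b).map 0 _ _ (tensorHom ρ ρ' X Y X' Y' f) = 0 := by
  rw [tensorHom, LinearMap.comp_apply, bidegree_tin]
  simp only [Nat.cast_zero, mul_zero, add_zero, zero_smul]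

theorem bidegree_del (a b : k) {X Y : D} {X' Y' : D'} (f : (X ⟶ Y) ⊗[k] (X' ⟶ Y')) :
    (bidegree S S' a b).map 1 _ _ ((S.tensor S').del (zero_add 1) (tensorHom ρ ρ' X Y X' Y' f)) =
      tensorDel ρ ρ' a b X Y X' Y' f := by
  induction f with
  | zero => simp only [map_zero]
  | add f g hf hg => simp only [map_add, hf, hg]
  | tmul f f' =>
    have e := DGHSemicat.tin_del (X := DGHSemicat.tob (ρ.obj X) (ρ'.obj X'))
      (Y := DGHSemicat.tob (ρ.obj Y) (ρ'.obj Y')) (add_zero 0) (zero_add 1) (zero_add 1)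
      (zero_add 1) (add_zero 1) (zero_add 1) (ρ.map X Y f) (ρ'.map X' Y' f')
    refine (congrArg ((bidegree S S' a b).map 1 _ _) e).trans ?_
    rw [map_add, map_smul, bidegree_tin, bidegree_tin]
    simp only [tensorDel, LinearMap.add_apply, LinearMap.smul_apply, LinearMap.comp_apply,
      TensorProduct.map_tmul, Nat.cast_zero, Nat.cast_one, mul_one, mul_zero, add_zero, zero_add,
      pow_zero, one_smul]

/-- T # T' sees only the component of bidegree (p, q), on which the derivation is multiplication by
ap + bq. -/
theorem traceTensor_bidegree {𝓜 : SAYDModule k H M} {𝓜' : SAYDModule k H M'} {p q : ℕ}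
    (T : ∀ X : S.Ob, M ⊗[k] S.Hom p X X →ₗ[k] k) (T' : ∀ X : S'.Ob, M' ⊗[k] S'.Hom q X X →ₗ[k] k)
    (a b : k) (X : (S.tensor S').Ob) (z : Cotensor 𝓜 𝓜') (x : (S.tensor S').Hom (p + q) X X) :
    traceTensor 𝓜 𝓜' T T' X (z ⊗ₜ (bidegree S S' a b).map (p + q) X X x) =
      (a * p + b * q) * traceTensor 𝓜 𝓜' T T' X (z ⊗ₜ x) := by
  induction x using DGHSemicat.tensor_induction with
  | zero => simp only [map_zero, TensorProduct.tmul_zero, mul_zero]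
  | add x y hx hy => simp only [map_add, TensorProduct.tmul_add, mul_add, hx, hy]
  | tin_tmul i j h f f' =>
    have e : traceTensor 𝓜 𝓜' T T' X
        (z ⊗ₜ (bidegree S S' a b).map (p + q) X X (DGHSemicat.tin h X X (f ⊗ₜ f'))) =
        (a * i + b * j) * traceTensor 𝓜 𝓜' T T' X (z ⊗ₜ DGHSemicat.tin h X X (f ⊗ₜ f')) := by
      rw [bidegree_tin, TensorProduct.tmul_smul, map_smul, smul_eq_mul]
    refine e.trans ?_
    by_cases hi : p = i
    · subst hi
      obtain rfl : q = j := by omega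
      rfl
    · have e0 : traceTensor 𝓜 𝓜' T T' X (z ⊗ₜ DGHSemicat.tin h X X (f ⊗ₜ f')) = 0 := by
        rw [traceTensor_tin, extendTrace_of_ne _ hi]
        exact LinearMap.congr_fun (evalPair_zero_left _) _
      rw [e0, mul_zero, mul_zero]

end Bidegree

variable [BijectiveAntipode k H] {𝓜 : SAYDModule k H M} {𝓜' : SAYDModule k H M'}
  (hsub : CotensorIsSubmodule 𝓜 𝓜')
  {D : Type u} [SmallCategory D] [Preadditive D] [Linear k D] [HCategory k H D]
  {D' : Type u'} [SmallCategory D'] [Preadditive D'] [Linear k D'] [HCategory k H D']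

/-- The commutator of a tensor product of functionals with a morphism of `D ⊗ D'`. -/
theorem traceTensor_commutator_tin {S : DGHSemicat.{w, v} k H} {S' : DGHSemicat.{w', v'} k H}
    {p q : ℕ} (T : ∀ X : S.Ob, M ⊗[k] S.Hom p X X →ₗ[k] k)
    (T' : ∀ X : S'.Ob, M' ⊗[k] S'.Hom q X X →ₗ[k] k) {X Z : (S.tensor S').Ob} {i j : ℕ}
    (h : i + j = p + q) (z : Cotensor 𝓜 𝓜') (f : S.Hom 0 X.1 Z.1) (f' : S'.Hom 0 X.2 Z.2)
    (x : S.Hom i Z.1 X.1) (x' : S'.Hom j Z.2 X.2) :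
    traceTensor 𝓜 𝓜' T T' X (z ⊗ₜ (S.tensor S').mul (add_zero (p + q))
        (DGHSemicat.tin h Z X (x ⊗ₜ x')) (DGHSemicat.tin (add_zero 0) X Z (f ⊗ₜ f'))) -
      traceTensor 𝓜 𝓜' T T' Z (tw (S := S.tensor S') (𝓜.cotensor 𝓜' hsub) (zero_add (p + q))
        (DGHSemicat.tin (add_zero 0) X Z (f ⊗ₜ f')) (DGHSemicat.tin h Z X (x ⊗ₜ x')) z) =
    evalPair ((TensorProduct.curry (extendTrace T i X.1)).flip (S.mul (add_zero i) x f))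
        ((TensorProduct.curry (extendTrace T' j X.2)).flip (S'.mul (add_zero j) x' f')) z -
      evalPair (extendTrace T i Z.1 ∘ₗ tw 𝓜 (zero_add i) f x)
        (extendTrace T' j Z.2 ∘ₗ tw 𝓜' (zero_add j) f' x') z := by
  rw [traceTensor_tw T T' hsub (add_zero 0) h (zero_add (p + q)) (zero_add i) (zero_add j)]
  have e := DGHSemicat.tin_mul h (add_zero 0) (add_zero (p + q)) (add_zero i) (add_zero j) h
    x x' f f'
  refine (congrArg (fun t => traceTensor 𝓜 𝓜' T T' X (z ⊗ₜ t) - _) e).trans ?_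
  rw [TensorProduct.tmul_smul, map_smul, traceTensor_tin]
  simp

variable {p q : ℕ} (C : CycleOver.{u, w, v} D 𝓜 p) (C' : CycleOver.{u', w', v'} D' 𝓜' q)

/-- A criterion for the product of two characters to be a coboundary, in terms of the commutators
of a functional `τ` with the morphisms `f ⊗ f'`. -/
theorem prod_character_mem_coboundaries {n : ℕ} (hn : n + 1 = p + q) (a b : k)
    (hab : a * p + b * q ≠ 0)
    (τ : ∀ X : (C.S.tensor C'.S).Ob, Cotensor 𝓜 𝓜' ⊗[k] (C.S.tensor C'.S).Hom n X X →ₗ[k] k)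
    (hτ : ∀ (X : (C.S.tensor C'.S).Ob) (h : H) (x : Cotensor 𝓜 𝓜' ⊗[k] (C.S.tensor C'.S).Hom n X X),
      τ X (twistedRact (𝓜.cotensor 𝓜' hsub) ((C.S.tensor C'.S).act n X X) h x) =
        counit (R := k) h * τ X x)
    (hτd : ∀ {i : ℕ} (h : i + 1 = n) (X : (C.S.tensor C'.S).Ob) (z : Cotensor 𝓜 𝓜')
      (x : (C.S.tensor C'.S).Hom i X X), τ X (z ⊗ₜ (C.S.tensor C'.S).d h X X x) = 0)
    (hτc : ∀ (X Z : D) (X' Z' : D') (z : Cotensor 𝓜 𝓜') (f : X ⟶ Z) (f' : X' ⟶ Z') (i j : ℕ)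
      (h : i + j = n) (x : C.S.Hom i (C.ρ.obj Z) (C.ρ.obj X))
      (x' : C'.S.Hom j (C'.ρ.obj Z') (C'.ρ.obj X')),
      τ _ (z ⊗ₜ (C.S.tensor C'.S).mul (add_zero n) (DGHSemicat.tin h _ _ (x ⊗ₜ x'))
          (tensorHom C.ρ C'.ρ X Z X' Z' (f ⊗ₜ f'))) -
        τ _ (tw (S := C.S.tensor C'.S) (𝓜.cotensor 𝓜' hsub) (zero_add n)
          (tensorHom C.ρ C'.ρ X Z X' Z' (f ⊗ₜ f')) (DGHSemicat.tin h _ _ (x ⊗ₜ x')) z) =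
      (-1) ^ n * (a * ((-1) ^ j * evalPair
          ((TensorProduct.curry (extendTrace C.T (i + 1) _)).flip
            (C.S.mul rfl x (C.S.del (zero_add 1) (C.ρ.map X Z f))))
          ((TensorProduct.curry (extendTrace C'.T j _)).flip
            (C'.S.mul (add_zero j) x' (C'.ρ.map X' Z' f'))) z) +
        b * evalPair
          ((TensorProduct.curry (extendTrace C.T i _)).flip
            (C.S.mul (add_zero i) x (C.ρ.map X Z f)))
          ((TensorProduct.curry (extendTrace C'.T (j + 1) _)).flip
            (C'.S.mul rfl x' (C'.S.del (zero_add 1) (C'.ρ.map X' Z' f')))) z)) :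
    (C.prod hsub C').character ∈
      coboundaries (𝓜.cotensor 𝓜' hsub) (TensorCat k D D') (p + q) := by
  -- The hypothesis `hτc` on pure tensors is extended by linearity in both arguments. Its factor
  -- (−1)ʲ is the Koszul sign of moving df past x' of degree j; the term with f ⊗ df' needs none
  -- because f has degree zero.
  have key : ∀ (X Z : D) (X' Z' : D') (z : Cotensor 𝓜 𝓜') (f : (X ⟶ Z) ⊗[k] (X' ⟶ Z'))
      (y : (C.S.tensor C'.S).Hom n (DGHSemicat.tob (C.ρ.obj Z) (C'.ρ.obj Z'))
        (DGHSemicat.tob (C.ρ.obj X) (C'.ρ.obj X'))),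
      τ _ (z ⊗ₜ (C.S.tensor C'.S).mul (add_zero n) y (tensorHom C.ρ C'.ρ X Z X' Z' f)) -
        τ _ (tw (S := C.S.tensor C'.S) (𝓜.cotensor 𝓜' hsub) (zero_add n)
          (tensorHom C.ρ C'.ρ X Z X' Z' f) y z) =
      (-1) ^ n * traceTensor 𝓜 𝓜' C.T C'.T _ (z ⊗ₜ (C.S.tensor C'.S).mul hn y
        (tensorDel C.ρ C'.ρ a b X Z X' Z' f)) := by
    intro X Z X' Z' z f y
    induction f with
    | zero =>
      simp only [map_zero, TensorProduct.tmul_zero, LinearMap.zero_apply, sub_self, mul_zero]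
    | add f g hf hg =>
      simp only [map_add, TensorProduct.tmul_add, LinearMap.add_apply, mul_add, ← hf, ← hg]
      ring
    | tmul f f' =>
      induction y using DGHSemicat.tensor_induction with
      | zero =>
        simp only [map_zero, TensorProduct.tmul_zero, LinearMap.zero_apply, sub_self, mul_zero]
      | add x y hx hy =>
        simp only [map_add, TensorProduct.tmul_add, LinearMap.add_apply, mul_add, ← hx, ← hy]
        ring
      | tin_tmul i j h x x' =>
        refine (hτc X Z X' Z' z f f' i j h x x').trans ?_
        have e1 := DGHSemicat.tin_mul (X := DGHSemicat.tob (C.ρ.obj X) (C'.ρ.obj X'))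
          (Y := DGHSemicat.tob (C.ρ.obj Z) (C'.ρ.obj Z'))
          (Z := DGHSemicat.tob (C.ρ.obj X) (C'.ρ.obj X')) h (add_zero 1) hn rfl
          (add_zero j) (by omega) x x' (C.S.del (zero_add 1) (C.ρ.map X Z f)) (C'.ρ.map X' Z' f')
        have e2 := DGHSemicat.tin_mul (X := DGHSemicat.tob (C.ρ.obj X) (C'.ρ.obj X'))
          (Y := DGHSemicat.tob (C.ρ.obj Z) (C'.ρ.obj Z'))
          (Z := DGHSemicat.tob (C.ρ.obj X) (C'.ρ.obj X')) h (zero_add 1) hn (add_zero i)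
          rfl (by omega) x x' (C.ρ.map X Z f) (C'.S.del (zero_add 1) (C'.ρ.map X' Z' f'))
        simp only [tensorDel, LinearMap.add_apply, LinearMap.smul_apply, LinearMap.comp_apply,
          TensorProduct.map_tmul]
        rw [map_add, map_smul, map_smul, e1, e2, TensorProduct.tmul_add, map_add,
          TensorProduct.tmul_smul, TensorProduct.tmul_smul, map_smul, map_smul,
          TensorProduct.tmul_smul, TensorProduct.tmul_smul, map_smul, map_smul, traceTensor_tin,
          traceTensor_tin]
        simp only [smul_eq_mul, mul_one, mul_zero, pow_zero, one_mul]
  refine (C.prod hsub C').character_mem_coboundaries hn (bidegree C.S C'.S a b)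
    (fun {_ _} f => bidegree_tensorHom C.ρ C'.ρ a b f) hab
    (traceTensor_bidegree C.T C'.T a b) τ hτ (fun {_} h => hτd h) fun X Z z f y => ?_
  have e : (bidegree C.S C'.S a b).del (C.prod hsub C').ρ X Z f =
      tensorDel C.ρ C'.ρ a b X.fst Z.fst X.snd Z.snd f := bidegree_del C.ρ C'.ρ a b f
  refine (key X.fst Z.fst X.snd Z.snd z f y).trans ?_
  rw [← e]
  rfl

end ProductDescent

end HopfCyclic

namespace HopfCyclic

/-! ### The product on cohomology. -/

section CohomologyProduct

universe w v w' v'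

variable {k H M M' : Type*} [Field k] [Ring H] [HopfAlgebra k H]
  [AddCommGroup M] [Module k M] [AddCommGroup M'] [Module k M'] [BijectiveAntipode k H]
  {𝓜 : SAYDModule k H M} {𝓜' : SAYDModule k H M'}
  {D : Type u} [SmallCategory D] [Preadditive D] [Linear k D] [HCategory k H D]
  {D' : Type u'} [SmallCategory D'] [Preadditive D'] [Linear k D'] [HCategory k H D']

/-- For a cyclic cochain `ψ`, the failure of the trace property with respect to morphisms is
measured by `b ψ`. -/
theorem formTrace_commutator_hochschild {n : ℕ} {ψ : Cochain 𝓜 D n} (hψ : cyclicSigned 𝓜 D n ψ = ψ)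
    {X Z : D} (m : M) (x : Om k n Z X) (f : X ⟶ Z) :
    formTrace 𝓜 ψ X (m ⊗ₜ Om.mul (add_zero n) X Z X x (Om.of X Z f)) -
      formTrace 𝓜 ψ Z (Om.twist 𝓜 (zero_add n) X Z (Om.of X Z f) x m) =
    (-1) ^ n * formTrace 𝓜 (hochschild 𝓜 D n ψ) X
      (m ⊗ₜ Om.mul rfl X Z X x (Om.d (zero_add 1) X Z (Om.of X Z f))) := by
  have hinl : ∀ a : strand k n X Z,
      formTrace 𝓜 ψ X (m ⊗ₜ Om.mul (add_zero n) X Z X (Om.inl n Z X a) (Om.of X Z f)) -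
        formTrace 𝓜 ψ Z (Om.twist 𝓜 (zero_add n) X Z (Om.of X Z f) (Om.inl n Z X a) m) =
      (-1) ^ n * formTrace 𝓜 (hochschild 𝓜 D n ψ) X
        (m ⊗ₜ Om.mul rfl X Z X (Om.inl n Z X a) (Om.d (zero_add 1) X Z (Om.of X Z f))) := by
    intro a
    rw [formTrace_commutator_inl, ← Om.inl_snoc H, formTrace_inl]
  cases n with
  | zero =>
    obtain ⟨a, rfl⟩ := Om.exists_eq_inl x
    exact hinl a
  | succ n =>
    obtain ⟨a, b, rfl⟩ := Om.exists_eq_inl_add_dform x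
    -- On words dg¹…dgⁿ both sides vanish: the commutator because ψ is cyclic, and the right side
    -- because dg¹…dgⁿdf is exact.
    have hb := (cyclicSigned_succ_iff ψ).mp hψ X Z m b f
    have hb' : formTrace 𝓜 (hochschild 𝓜 D (n + 1) ψ) X (m ⊗ₜ Om.mul rfl X Z X (Om.dform n Z X b)
        (Om.d (zero_add 1) X Z (Om.of X Z f))) = 0 := by
      rw [← Om.dform_snoc H, ← Om.d_inl, formTrace_d]
    simp only [map_add, LinearMap.add_apply, TensorProduct.tmul_add, mul_add, ← hinl a, hb, hb']
    ring

variable [IsCocomm k H] (hsub : CotensorIsSubmodule 𝓜 𝓜') {p q : ℕ}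

theorem curry_zero_flip {A : Type*} [AddCommGroup A] [Module k A] (x : A) :
    (TensorProduct.curry (0 : M ⊗[k] A →ₗ[k] k)).flip x = 0 := by
  ext; simp

theorem IsClosedGradedTrace.curry_mul_swap {S : DGHSemicat.{w, v} k H} {n : ℕ}
    {T : ∀ X : S.Ob, M ⊗[k] S.Hom n X X →ₗ[k] k} (hT : IsClosedGradedTrace 𝓜 S n T) {X Y : S.Ob}
    (g : S.Hom 0 X Y) (x : S.Hom n Y X) :
    (TensorProduct.curry (T X)).flip (S.mul (add_zero n) x g) =
      T Y ∘ₗ tw 𝓜 (zero_add n) g x := by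
  ext m
  refine (hT.mul_swap (add_zero n) (zero_add n) m g x).trans ?_
  rw [zero_mul, pow_zero, one_mul]
  rfl

/-- Apply the criterion with a = 1, b = 0 and τ # T'. Its commutator comes from the first factor
only, since T' has none with degree zero morphisms. The weight is p + 1, nonzero in characteristic
zero; the two factors (−1)^q in the criterion cancel. -/
theorem prod_character_mem_coboundaries_left [CharZero k] (C : CycleOver.{u, w, v} D 𝓜 (p + 1))
    (C' : CycleOver.{u', w', v'} D' 𝓜' q) (τ : ∀ X : C.S.Ob, M ⊗[k] C.S.Hom p X X →ₗ[k] k)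
    (hτ : ∀ (X : C.S.Ob) (h : H) (x : M ⊗[k] C.S.Hom p X X),
      τ X (twistedRact 𝓜 (C.S.act p X X) h x) = counit (R := k) h * τ X x)
    (hτd : ∀ {i : ℕ} (h : i + 1 = p) (X : C.S.Ob) (m : M) (x : C.S.Hom i X X),
      τ X (m ⊗ₜ C.S.d h X X x) = 0)
    (hτc : ∀ (X Z : D) (m : M) (f : X ⟶ Z) (x : C.S.Hom p (C.ρ.obj Z) (C.ρ.obj X)),
      τ _ (m ⊗ₜ C.S.mul (add_zero p) x (C.ρ.map X Z f)) -
        τ _ (tw 𝓜 (zero_add p) (C.ρ.map X Z f) x m) =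
      (-1) ^ p * C.T _ (m ⊗ₜ C.S.mul rfl x (C.S.del (zero_add 1) (C.ρ.map X Z f)))) :
    (C.prod hsub C').character ∈
      coboundaries (𝓜.cotensor 𝓜' hsub) (TensorCat k D D') (p + 1 + q) := by
  refine prod_character_mem_coboundaries hsub C C' (n := p + q) (by omega) 1 0
    (by rw [one_mul, zero_mul, add_zero]; exact Nat.cast_ne_zero.mpr p.succ_ne_zero)
    (traceTensor 𝓜 𝓜' τ C'.T) (traceTensor_invariant hsub hτ C'.isTrace.invariant)
    (fun {_} h X z x => traceTensor_closed hτd C'.isTrace.closed h X z x)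
    fun X Z X' Z' z f f' i j h x x' => ?_
  refine (traceTensor_commutator_tin (X := DGHSemicat.tob (C.ρ.obj X) (C'.ρ.obj X'))
    (Z := DGHSemicat.tob (C.ρ.obj Z) (C'.ρ.obj Z')) hsub τ C'.T h z (C.ρ.map X Z f)
    (C'.ρ.map X' Z' f') x x').trans ?_
  by_cases hi : p = i
  · subst hi
    obtain rfl : q = j := by omega
    have e : (TensorProduct.curry (τ (C.ρ.obj X))).flip (C.S.mul (add_zero p) x (C.ρ.map X Z f)) -
        τ (C.ρ.obj Z) ∘ₗ tw 𝓜 (zero_add p) (C.ρ.map X Z f) x =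
        (-1 : k) ^ p • (TensorProduct.curry (C.T (C.ρ.obj X))).flip
          (C.S.mul rfl x (C.S.del (zero_add 1) (C.ρ.map X Z f))) := by
      ext m
      exact hτc X Z m f x
    have s : (-1 : k) ^ q * (-1) ^ q = 1 := by rw [← mul_pow]; simp
    rw [extendTrace_self, extendTrace_self, extendTrace_self, ← C'.isTrace.curry_mul_swap,
      ← LinearMap.sub_apply, ← evalPair_sub_left, e, evalPair_smul_left, LinearMap.smul_apply,
      smul_eq_mul, zero_mul, add_zero, one_mul, pow_add, mul_assoc, ← mul_assoc ((-1 : k) ^ q), s,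
      one_mul]
  · rw [extendTrace_of_ne _ hi, extendTrace_of_ne _ hi,
      extendTrace_of_ne (p := p + 1) (n := i + 1) _ (by omega), curry_zero_flip, curry_zero_flip,
      LinearMap.zero_comp, evalPair_zero_left, evalPair_zero_left]
    simp

/-- The mirror case a = 0, b = 1, with weight q + 1. The functional carries the sign (−1)^p, which
turns the (−1)^q of the hypothesis on τ into the (−1)^(p+q) of the criterion. -/
theorem prod_character_mem_coboundaries_right [CharZero k] (C : CycleOver.{u, w, v} D 𝓜 p)
    (C' : CycleOver.{u', w', v'} D' 𝓜' (q + 1))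
    (τ : ∀ X : C'.S.Ob, M' ⊗[k] C'.S.Hom q X X →ₗ[k] k)
    (hτ : ∀ (X : C'.S.Ob) (h : H) (x : M' ⊗[k] C'.S.Hom q X X),
      τ X (twistedRact 𝓜' (C'.S.act q X X) h x) = counit (R := k) h * τ X x)
    (hτd : ∀ {i : ℕ} (h : i + 1 = q) (X : C'.S.Ob) (m : M') (x : C'.S.Hom i X X),
      τ X (m ⊗ₜ C'.S.d h X X x) = 0)
    (hτc : ∀ (X Z : D') (m : M') (f : X ⟶ Z) (x : C'.S.Hom q (C'.ρ.obj Z) (C'.ρ.obj X)),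
      τ _ (m ⊗ₜ C'.S.mul (add_zero q) x (C'.ρ.map X Z f)) -
        τ _ (tw 𝓜' (zero_add q) (C'.ρ.map X Z f) x m) =
      (-1) ^ q * C'.T _ (m ⊗ₜ C'.S.mul rfl x (C'.S.del (zero_add 1) (C'.ρ.map X Z f)))) :
    (C.prod hsub C').character ∈
      coboundaries (𝓜.cotensor 𝓜' hsub) (TensorCat k D D') (p + (q + 1)) := by
  refine prod_character_mem_coboundaries hsub C C' (n := p + q) (by omega) 0 1
    (by rw [one_mul, zero_mul, zero_add]; exact Nat.cast_ne_zero.mpr q.succ_ne_zero)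
    (fun X => (-1 : k) ^ p • traceTensor 𝓜 𝓜' C.T τ X) (fun X h x => ?_)
    (fun {_} h X z x => ?_) fun X Z X' Z' z f f' i j h x x' => ?_
  · rw [LinearMap.smul_apply, traceTensor_invariant hsub C.isTrace.invariant hτ,
      LinearMap.smul_apply, smul_eq_mul, smul_eq_mul, mul_left_comm]
  · rw [LinearMap.smul_apply, traceTensor_closed C.isTrace.closed hτd h X z x, smul_zero]
  rw [LinearMap.smul_apply, LinearMap.smul_apply, ← smul_sub]
  refine (congrArg (fun t => (-1 : k) ^ p • t) (traceTensor_commutator_tin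
    (X := DGHSemicat.tob (C.ρ.obj X) (C'.ρ.obj X'))
    (Z := DGHSemicat.tob (C.ρ.obj Z) (C'.ρ.obj Z')) hsub C.T τ h z (C.ρ.map X Z f)
    (C'.ρ.map X' Z' f') x x')).trans ?_
  by_cases hi : p = i
  · subst hi
    obtain rfl : q = j := by omega
    have e : (TensorProduct.curry (τ (C'.ρ.obj X'))).flip
          (C'.S.mul (add_zero q) x' (C'.ρ.map X' Z' f')) -
        τ (C'.ρ.obj Z') ∘ₗ tw 𝓜' (zero_add q) (C'.ρ.map X' Z' f') x' =
        (-1 : k) ^ q • (TensorProduct.curry (C'.T (C'.ρ.obj X'))).flip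
          (C'.S.mul rfl x' (C'.S.del (zero_add 1) (C'.ρ.map X' Z' f'))) := by
      ext m
      exact hτc X' Z' m f' x'
    rw [extendTrace_self, extendTrace_self, extendTrace_self, ← C.isTrace.curry_mul_swap,
      ← LinearMap.sub_apply, ← evalPair_sub_right, e, evalPair_smul_right, LinearMap.smul_apply,
      smul_eq_mul, smul_eq_mul, zero_mul, zero_add, one_mul, pow_add, mul_assoc]
  · rw [extendTrace_of_ne _ hi, extendTrace_of_ne _ hi, curry_zero_flip,
      LinearMap.zero_comp,
      evalPair_zero_left, evalPair_zero_left, evalPair_zero_left]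
    simp

/-- If φ = bψ with ψ a cyclic cochain, the functional of ψ on forms is closed and invariant, and by
`formTrace_commutator_hochschild` its commutators are given by the functional of φ. This is the τ
required. In degree zero the only coboundary is 0. -/
theorem cocycleProduct_mem_left [CharZero k] {φ : cocycles 𝓜 D p} (φ' : cocycles 𝓜' D' q)
    (hφ : φ.1 ∈ coboundaries 𝓜 D p) : (cocycleProduct hsub D D' p q φ φ').1 ∈
      coboundaries (𝓜.cotensor 𝓜' hsub) (TensorCat k D D') (p + q) := by
  cases p with
  | zero =>
    obtain rfl : φ = 0 := Subtype.ext ((Submodule.mem_bot k).mp hφ)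
    rw [map_zero, LinearMap.zero_apply]
    exact Submodule.zero_mem _
  | succ p =>
    obtain ⟨ψ, hψ, e⟩ := hφ
    obtain ⟨hψ1, hψ2⟩ := (mem_cyclicCochains_iff ψ).mp hψ
    refine prod_character_mem_coboundaries_left hsub (universalCycle φ) (universalCycle φ')
      (fun X : D => formTrace 𝓜 ψ X) ((mem_invariantCochains_iff ψ).mp hψ1)
      (fun {_} h X m x => formTrace_d ψ h m x) fun X Z m f x => ?_
    refine (formTrace_commutator_hochschild hψ2 m x f).trans ?_
    rw [e]
    rfl

theorem cocycleProduct_mem_right [CharZero k] (φ : cocycles 𝓜 D p) {φ' : cocycles 𝓜' D' q}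
    (hφ' : φ'.1 ∈ coboundaries 𝓜' D' q) : (cocycleProduct hsub D D' p q φ φ').1 ∈
      coboundaries (𝓜.cotensor 𝓜' hsub) (TensorCat k D D') (p + q) := by
  cases q with
  | zero =>
    obtain rfl : φ' = 0 := Subtype.ext ((Submodule.mem_bot k).mp hφ')
    rw [map_zero]
    exact Submodule.zero_mem _
  | succ q =>
    obtain ⟨ψ, hψ, e⟩ := hφ'
    obtain ⟨hψ1, hψ2⟩ := (mem_cyclicCochains_iff ψ).mp hψ
    refine prod_character_mem_coboundaries_right hsub (universalCycle φ) (universalCycle φ')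
      (fun X : D' => formTrace 𝓜' ψ X) ((mem_invariantCochains_iff ψ).mp hψ1)
      (fun {_} h X m x => formTrace_d ψ h m x) fun X Z m f x => ?_
    refine (formTrace_commutator_hochschild hψ2 m x f).trans ?_
    rw [e]
    rfl

/-- The map on subquotients induced by a bilinear map. -/
noncomputable def Subquotient.lift₂ {V V' V'' : Type*} [AddCommGroup V] [Module k V]
    [AddCommGroup V'] [Module k V'] [AddCommGroup V''] [Module k V''] {Z B : Submodule k V}
    {Z' B' : Submodule k V'} {Z'' B'' : Submodule k V''} (f : Z →ₗ[k] Z' →ₗ[k] Z'')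
    (hl : ∀ x y, x.1 ∈ B → (f x y).1 ∈ B'') (hr : ∀ x y, y.1 ∈ B' → (f x y).1 ∈ B'') :
    Subquotient Z B →ₗ[k] Subquotient Z' B' →ₗ[k] Subquotient Z'' B'' :=
  Submodule.liftQ _ (LinearMap.flip (Submodule.liftQ _ (f.compr₂ (Subquotient.mk Z'' B'')).flip
    fun y hy => LinearMap.mem_ker.mpr (LinearMap.ext fun x =>
      (Submodule.Quotient.mk_eq_zero _).mpr (hr x y hy))))
    fun x hx => LinearMap.mem_ker.mpr (LinearMap.ext fun y => by
      obtain ⟨y, rfl⟩ := Submodule.mkQ_surjective _ y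
      exact (Submodule.Quotient.mk_eq_zero _).mpr (hl x y hx))

theorem Subquotient.lift₂_mk {V V' V'' : Type*} [AddCommGroup V] [Module k V]
    [AddCommGroup V'] [Module k V'] [AddCommGroup V''] [Module k V''] {Z B : Submodule k V}
    {Z' B' : Submodule k V'} {Z'' B'' : Submodule k V''} (f : Z →ₗ[k] Z' →ₗ[k] Z'')
    (hl : ∀ x y, x.1 ∈ B → (f x y).1 ∈ B'') (hr : ∀ x y, y.1 ∈ B' → (f x y).1 ∈ B'') (x : Z)
    (y : Z') : Subquotient.lift₂ f hl hr (Subquotient.mk Z B x) (Subquotient.mk Z' B' y) =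
      Subquotient.mk Z'' B'' (f x y) := rfl

variable (D D' p q) in
/-- The product in Hopf-cyclic cohomology. -/
noncomputable def cohomologyProduct [CharZero k] : HC 𝓜 D p →ₗ[k] HC 𝓜' D' q →ₗ[k]
    HC (𝓜.cotensor 𝓜' hsub) (TensorCat k D D') (p + q) :=
  Subquotient.lift₂ (cocycleProduct hsub D D' p q)
    (fun _ φ' hφ => cocycleProduct_mem_left hsub φ' hφ)
    fun φ _ hφ' => cocycleProduct_mem_right hsub φ hφ'

theorem cohomologyProduct_mk [CharZero k] (φ : cocycles 𝓜 D p) (φ' : cocycles 𝓜' D' q) :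
    cohomologyProduct D D' hsub p q (HC.mk 𝓜 D p φ) (HC.mk 𝓜' D' q φ') =
      HC.mk _ _ (p + q) (cocycleProduct hsub D D' p q φ φ') :=
  Subquotient.lift₂_mk _ _ _ φ φ'

end CohomologyProduct

end HopfCyclic

/-! ### The theorem over ℂ. -/

theorem theorem5p11 {H : Type*} [Ring H] [HopfAlgebra ℂ H] [BijectiveAntipode ℂ H]
    [IsCocomm ℂ H] {M M' : Type*} [AddCommGroup M] [Module ℂ M]
    [AddCommGroup M'] [Module ℂ M'] (𝓜 : SAYDModule ℂ H M) (𝓜' : SAYDModule ℂ H M')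
    (hsub : CotensorIsSubmodule 𝓜 𝓜')
    (D : Type u) [SmallCategory D] [Preadditive D] [Linear ℂ D] [HCategory ℂ H D]
    (D' : Type u') [SmallCategory D'] [Preadditive D'] [Linear ℂ D'] [HCategory ℂ H D'] (p q : ℕ) :
    ∃ (γ : cocycles 𝓜 D p →ₗ[ℂ] cocycles 𝓜' D' q →ₗ[ℂ]
          cocycles (𝓜.cotensor 𝓜' hsub) (TensorCat ℂ D D') (p + q))
      (P : HC 𝓜 D p ⊗[ℂ] HC 𝓜' D' q →ₗ[ℂ]
          HC (𝓜.cotensor 𝓜' hsub) (TensorCat ℂ D D') (p + q)),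
      -- `P` is induced by `γ`
      (∀ φ φ', P (HC.mk 𝓜 D p φ ⊗ₜ HC.mk 𝓜' D' q φ') = HC.mk _ _ (p + q) (γ φ φ')) ∧
      -- all cocycles are characters of cycles
      (∀ φ : cocycles 𝓜 D p, ∃ C : CycleOver.{u, u, u} D 𝓜 p, C.character = φ) ∧
      (∀ φ' : cocycles 𝓜' D' q, ∃ C' : CycleOver.{u', u', u'} D' 𝓜' q, C'.character = φ') ∧
      -- `γ φ φ'` is the character of the tensor product of any cycles with characters `φ`, `φ'`
      (∀ (C : CycleOver.{u, u, u} D 𝓜 p) (C' : CycleOver.{u', u', u'} D' 𝓜' q)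
        (φ : cocycles 𝓜 D p) (φ' : cocycles 𝓜' D' q), C.character = φ → C'.character = φ' →
        ∃ h : IsClosedGradedTrace (𝓜.cotensor 𝓜' hsub) (C.S.tensor C'.S) (p + q)
            (traceTensor 𝓜 𝓜' C.T C'.T),
          (C.tensor hsub C' h).character = γ φ φ') :=
  ⟨cocycleProduct hsub D D' p q, TensorProduct.lift (cohomologyProduct D D' hsub p q),
    fun φ φ' => (TensorProduct.lift.tmul _ _).trans (cohomologyProduct_mk hsub φ φ'),
    fun φ => ⟨universalCycle φ, universalCycle_character φ⟩,
    fun φ' => ⟨universalCycle φ', universalCycle_character φ'⟩,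
    fun C C' _ _ hC hC' => ⟨traceTensor_isClosedGradedTrace hsub C.isTrace C'.isTrace,
      character_prod hsub C C' hC hC'⟩⟩
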